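/- Let $\emptyset\neq\mathcal A\subseteq\mathbb Q^n$ and $\mathcal B\subseteq\mathbb N^n\setminus(2\mathbb N)^n$ be finite and disjoint. For $\mathbf c\in\mathbb R^{\mathcal A\cup\mathcal B}$ let $f_{\mathbf c}(\mathbf x)=\sum_{\alpha\in\mathcal A}c_\alpha|\mathbf x|^\alpha+\sum_{\beta\in\mathcal B}c_\beta\mathbf x^\beta$, a function $\mathbb R^n\to\mathbb R\cup\{\infty\}$ (with value $\infty$ at $\mathbf x$ if for some $\alpha\in\mathcal A$ with $c_\alpha\ne0$ and some $j$ we have $x_j=0$ and $\alpha_j<0$). It is an even AG function if at most one $c_\alpha$ ($\alpha\in\mathcal A$) is negative and all $c_\beta$ ($\beta\in\mathcal B$) are zero, and an odd AG function if all $c_\alpha$ ($\alpha\in\mathcal A$) are non-negative and at most one $c_\beta$ ($\beta\in\mathcal B$) is nonzero. The rational $\mathcal S$-cone $C_{\mathcal S}(\mathcal A,\mathcal B)$ is the set of functions $f_{\mathbf c}$ with $\mathbf c$ in the conic hull of the coefficient vectors of the non-negative (even or odd) AG functions. A reduced circuit $(A,\beta)\in R(\mathcal A,\mathcal A\cup\mathcal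 B)$ consists of an affinely independent $A\subseteq\mathcal A$ and a point $\beta\in(\mathcal A\cup\mathcal B)\setminus A$ in the relative interior of $\operatorname{conv}A$ such that $\mathcal A\cap\operatorname{conv}(A)\subseteq A\cup\{\beta\}$; it is odd if $\beta\in\mathcal B$ and even otherwise. Let $\lambda=(\lambda_\alpha)_{\alpha\in A}$ be the barycentric coordinates of $\beta$ with respect to $A$, let $p$ be their smallest common denominator, $p_\alpha=p\lambda_\alpha$, $K=\lceil\log_2p\rceil$ and $\Theta=\prod_{\alpha\in A}\lambda_\alpha^{\lambda_\alpha}$ (all depending on $(A,\beta)$). The circuit variables of $(A,\beta)$ are $2^K$ real variables $\mathbf x^{A,\beta}=(x_\beta,(x_{k,i}))$, $1\le k\le K$, $1\le i\le2^{K-k}$. An order of appearance for $(A,\beta)$ is a sequence of $2^K$ symbols in which $c_\alpha$ appears $p_\alpha$ times for each $\alpha\in A$ and $\Theta x_\beta$ appears $2^K-p$ times. Every reduced circuit has an order of appearance. Fix any one order for each reduced circuit, and for $1\le l\le 2^{K-1}$ let $u_l,w_l$ denote the symbols in positions $2l-1$ and $2l$. Then: (a) For all $\mathbf c\in\mathbb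 R^{\mathcal A\cup\mathcal B}$, $f_{\mathbf c}\in C_{\mathcal S}(\mathcal A,\mathcal B)$ if and only if there are $\mathbf d\in\mathbb R_{\ge0}^{\mathcal A}$ and, for each $(A,\beta)\in R(\mathcal A,\mathcal A\cup\mathcal B)$, a vector $\mathbf c^{A,\beta}\in\mathbb R^{\mathcal A\cup\mathcal B}$ vanishing outside $A\cup\{\beta\}$ and circuit variables $\mathbf x^{A,\beta}$, with $$\mathbf c=(\mathbf d,0)+\sum_{(A,\beta)\in R(\mathcal A,\mathcal A\cup\mathcal B)}\mathbf c^{A,\beta},$$ such that for every $(A,\beta)$, writing $c=\mathbf c^{A,\beta}$ and $x=\mathbf x^{A,\beta}$: 1. $\begin{pmatrix}x_{k-1,2i-1}&x_{k,i}\\x_{k,i}&x_{k-1,2i}\end{pmatrix}\succeq0$ for $2\le k\le K$, $1\le i\le2^{K-k}$; 2. $x_{K,1}-\Theta x_\beta\ge0$; 3. $x_\beta+c_\beta\ge0$; 4. $\|c_\beta\|_2\le x_\beta$ if $(A,\beta)$ is odd; 5. $\begin{pmatrix}u_l&x_{1,l}\\x_{1,l}&w_l\end{pmatrix}\succeq0$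 for $1\le l\le2^{K-1}$. (b) The set of coefficient vectors of $C_{\mathcal S}(\mathcal A,\mathcal B)$ is the projection to $\mathbb R^{\mathcal A\cup\mathcal B}$ of the lifted cone $\widehat C(\mathcal A,\mathcal B)$. Here $\widehat C(\mathcal A,\mathcal B)$ is the Minkowski sum of the following subsets of the space of all pairs of a vector in $\mathbb R^{\mathcal A\cup\mathcal B}$ and a family of circuit variables for all reduced circuits. For each reduced circuit $(A,\beta)$ we take the set of pairs $(c,\mathbf x)$ such that $c$ vanishes outside $A\cup\{\beta\}$, the variables of all other circuits are $0$, the circuit matrix (block diagonal, with the blocks in 1 and 5 and the two $1\times1$ blocks given by the left-hand sides of 2 and 3) is positive semidefinite, and, if $(A,\beta)$ is odd, $\begin{pmatrix}x_\beta&c_\beta\\c_\beta&x_\beta\end{pmatrix}\succeq0$. For each $\alpha\in\mathcal A$ we take the set of pairs $(te_\alpha,0)$ with $t\ge0$, where $e_\alpha$ is the unit vector. (c) Call a subset of $\mathbb R^m$ second-order representable if it is the projection of a set $\{z:\|M_iz+b_i\|_2\le c_i^Tz+d_i,\ i=1,\dots,N\}$ with real symmetric matrices $M_i$, vectors $b_i,c_i$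 and scalars $d_i$. The set of coefficient vectors of the rational $\mathcal S$-cone $C_{\mathcal S}(\mathcal A,\mathcal B)$ is second-order representable. (d) In particular, for every finite $\mathcal T\subseteq\mathbb N^n$, the set of coefficient vectors in $\mathbb R^{\mathcal T}$ of the SONC cone $C_{\mathrm{SONC}}(\mathcal T)=\sum_{(A,\beta)}P_{A,\beta}$ is second-order representable. The sum is over all affinely independent $A\subseteq\mathcal T\cap(2\mathbb N)^n$ and $\beta\in\mathcal T$ in the relative interior of $\operatorname{conv}A$ (including $A=\{\beta\}$), and $P_{A,\beta}$ is the set of real polynomials with support in $A\cup\{\beta\}$ that are non-negative on $\mathbb R^n$. -/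

import Mathlib

open scoped Pointwise

noncomputable section

namespace SCone

/-! ### Signed sums of arithmetic-geometric functions

`𝒜` is a finite set of real exponents and `ℬ` a finite set of natural exponents.  For disjoint
`𝒜` and `ℬ`, vectors indexed by `𝒜 ∪ ℬ` are functions on the disjoint sum of the index types. -/

/-- A natural exponent, regarded as a point of `ℝⁿ`. -/
def natVec {n : ℕ} (b : Fin n → ℕ) : Fin n → ℝ := fun j => (b j : ℝ)

/-- Coefficient vectors indexed by `𝒜 ∪ ℬ`. -/
abbrev Coeff {n : ℕ} (𝒜 : Finset (Fin n → ℝ)) (ℬ : Finset (Fin n → ℕ)) : Type :=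
  (↥𝒜 ⊕ ↥ℬ) → ℝ

/-- The exponent in `ℝⁿ` that belongs to an index. -/
def expo {n : ℕ} {𝒜 : Finset (Fin n → ℝ)} {ℬ : Finset (Fin n → ℕ)} : ↥𝒜 ⊕ ↥ℬ → (Fin n → ℝ)
  | Sum.inl a => (a : Fin n → ℝ)
  | Sum.inr b => natVec (b : Fin n → ℕ)

/-- `|x|^a` is infinite at `x`: some coordinate of `x` is zero and its exponent is negative. -/
def InfiniteAt {n : ℕ} (a x : Fin n → ℝ) : Prop := ∃ j, x j = 0 ∧ a j < 0

open Classical in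
/-- The function `x ↦ ∑ c_α |x|^α + ∑ c_β x^β` from `ℝⁿ` to `ℝ ∪ {∞}` with coefficient vector `c`.
Its value is `∞` where one of the `|x|^α` that occur with a nonzero coefficient is infinite. -/
def sFun {n : ℕ} {𝒜 : Finset (Fin n → ℝ)} {ℬ : Finset (Fin n → ℕ)} (c : Coeff 𝒜 ℬ)
    (x : Fin n → ℝ) : WithTop ℝ :=
  if ∃ a : ↥𝒜, c (Sum.inl a) ≠ 0 ∧ InfiniteAt (a : Fin n → ℝ) x then ⊤
  else (((∑ a : ↥𝒜, c (Sum.inl a) * ∏ j, |x j| ^ ((a : Fin n → ℝ) j))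
    + ∑ b : ↥ℬ, c (Sum.inr b) * ∏ j, x j ^ ((b : Fin n → ℕ) j) : ℝ) : WithTop ℝ)

/-- Coefficient vectors of even AG functions. -/
def IsEvenAG {n : ℕ} {𝒜 : Finset (Fin n → ℝ)} {ℬ : Finset (Fin n → ℕ)} (c : Coeff 𝒜 ℬ) : Prop :=
  (∀ a a' : ↥𝒜, c (Sum.inl a) < 0 → c (Sum.inl a') < 0 → a = a') ∧ ∀ b : ↥ℬ, c (Sum.inr b) = 0

/-- Coefficient vectors of odd AG functions. -/
def IsOddAG {n : ℕ} {𝒜 : Finset (Fin n → ℝ)} {ℬ : Finset (Fin n → ℕ)} (c : Coeff 𝒜 ℬ) : Prop :=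
  (∀ a : ↥𝒜, 0 ≤ c (Sum.inl a)) ∧
    ∀ b b' : ↥ℬ, c (Sum.inr b) ≠ 0 → c (Sum.inr b') ≠ 0 → b = b'

/-- The conic hull, in the coefficient space, of the non-negative AG functions. -/
def sConeCoeff {n : ℕ} (𝒜 : Finset (Fin n → ℝ)) (ℬ : Finset (Fin n → ℕ)) :
    PointedCone ℝ (Coeff 𝒜 ℬ) :=
  PointedCone.hull ℝ {c | (IsEvenAG c ∨ IsOddAG c) ∧ ∀ x, 0 ≤ sFun c x}

/-- The `𝒮`-cone, a set of functions on `ℝⁿ` with values in `ℝ ∪ {∞}`. -/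
def sCone {n : ℕ} (𝒜 : Finset (Fin n → ℝ)) (ℬ : Finset (Fin n → ℕ)) :
    Set ((Fin n → ℝ) → WithTop ℝ) :=
  sFun '' (sConeCoeff 𝒜 ℬ : Set (Coeff 𝒜 ℬ))

/-- All exponents in `𝒜` have rational coordinates. -/
def IsRationalSet {n : ℕ} (𝒜 : Finset (Fin n → ℝ)) : Prop :=
  ∀ a ∈ 𝒜, ∀ j, ∃ q : ℚ, a j = (q : ℝ)

/-! ### Reduced circuits -/

/-- The points of `ℝⁿ` in a finite subset of `𝒜`. -/
def pts {n : ℕ} {𝒜 : Finset (Fin n → ℝ)} (A : Finset ↥𝒜) : Set (Fin n → ℝ) :=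
  {y | ∃ a ∈ A, (a : Fin n → ℝ) = y}

/-- `(A, β)` is a reduced circuit with outer exponents `A ⊆ 𝒜` and inner exponent `β ∈ 𝒜 ∪ ℬ`. -/
def IsReducedCircuit {n : ℕ} {𝒜 : Finset (Fin n → ℝ)} {ℬ : Finset (Fin n → ℕ)}
    (r : Finset ↥𝒜 × (↥𝒜 ⊕ ↥ℬ)) : Prop :=
  AffineIndependent ℝ (fun a : ↥r.1 => ((a : ↥𝒜) : Fin n → ℝ)) ∧
  expo r.2 ∈ intrinsicInterior ℝ (convexHull ℝ (pts r.1)) ∧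
  expo r.2 ∉ pts r.1 ∧
  ∀ a : ↥𝒜, (a : Fin n → ℝ) ∈ convexHull ℝ (pts r.1) → a ∈ r.1 ∨ (a : Fin n → ℝ) = expo r.2

/-- The finite set `R(𝒜, 𝒜 ∪ ℬ)` of all reduced circuits. -/
abbrev RedCircuit {n : ℕ} (𝒜 : Finset (Fin n → ℝ)) (ℬ : Finset (Fin n → ℕ)) : Type :=
  {r : Finset ↥𝒜 × (↥𝒜 ⊕ ↥ℬ) // IsReducedCircuit r}

instance {n : ℕ} (𝒜 : Finset (Fin n → ℝ)) (ℬ : Finset (Fin n → ℕ)) :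
    Fintype (RedCircuit 𝒜 ℬ) := Fintype.ofFinite _

section Circuit

variable {n : ℕ} {𝒜 : Finset (Fin n → ℝ)} {ℬ : Finset (Fin n → ℕ)}

/-- The outer exponents `A` of the circuit `(A, β)`. -/
def RedCircuit.outer (r : RedCircuit 𝒜 ℬ) : Finset ↥𝒜 := r.1.1

/-- The inner exponent `β` of the circuit `(A, β)`. -/
def RedCircuit.inner (r : RedCircuit 𝒜 ℬ) : ↥𝒜 ⊕ ↥ℬ := r.1.2

/-- The circuit is odd: its inner exponent is in `ℬ`. -/
def RedCircuit.IsOdd (r : RedCircuit 𝒜 ℬ) : Prop := ∃ b : ↥ℬ, r.inner = Sum.inr b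

/-- `l` holds the coordinates of `y` as a convex combination of `A`, extended by zero to `𝒜`. -/
def IsBarycentric (A : Finset ↥𝒜) (y : Fin n → ℝ) (l : ↥𝒜 → ℝ) : Prop :=
  (∀ a, 0 ≤ l a) ∧ (∀ a, a ∉ A → l a = 0) ∧ ∑ a ∈ A, l a = 1 ∧
    ∑ a ∈ A, l a • (a : Fin n → ℝ) = y

open Classical in
/-- The barycentric coordinates `λ` of the circuit; they are unique since `A` is affinely
independent, and exist since `β` is in the convex hull of `A`. -/
def RedCircuit.bary (r : RedCircuit 𝒜 ℬ) : ↥𝒜 → ℝ :=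
  if h : ∃ l, IsBarycentric r.outer (expo r.inner) l then h.choose else 0

/-- The smallest common denominator `p` of the barycentric coordinates (zero if there is none,
which does not happen for rational `𝒜`). -/
def RedCircuit.den (r : RedCircuit 𝒜 ℬ) : ℕ :=
  sInf {p : ℕ | 0 < p ∧ ∀ a, ∃ m : ℕ, r.bary a * p = m}

/-- The numerators `p_α = λ_α p`. -/
def RedCircuit.num (r : RedCircuit 𝒜 ℬ) (a : ↥𝒜) : ℕ := ⌊r.bary a * r.den⌋₊

/-- `⌈log₂ p⌉`. -/
def RedCircuit.depth (r : RedCircuit 𝒜 ℬ) : ℕ := Nat.clog 2 r.den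

/-- `∏ λ_α ^ λ_α` over `α ∈ A`. -/
def RedCircuit.theta (r : RedCircuit 𝒜 ℬ) : ℝ := ∏ a ∈ r.outer, r.bary a ^ r.bary a

/-- The indices `(k, i)` with `lo ≤ k ≤ K` and `1 ≤ i ≤ 2 ^ (K - k)`. -/
def treeIdx (lo K : ℕ) : Finset (Σ _ : ℕ, ℕ) :=
  (Finset.Icc lo K).sigma fun k => Finset.Icc 1 (2 ^ (K - k))

/-- The index set of the `2 ^ ⌈log₂ p⌉` circuit variables: `none` for `x_β`, and the pairs `(k, i)`
with `1 ≤ k ≤ ⌈log₂ p⌉` and `1 ≤ i ≤ 2 ^ (⌈log₂ p⌉ - k)` for the variables `x_{k,i}`. -/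
abbrev RedCircuit.Var (r : RedCircuit 𝒜 ℬ) : Type := Option ↥(treeIdx 1 r.depth)

/-- The circuit variable `x_{k,i}` (only used for admissible indices). -/
def RedCircuit.node (r : RedCircuit 𝒜 ℬ) (x : r.Var → ℝ) (k i : ℕ) : ℝ :=
  if h : (⟨k, i⟩ : Σ _ : ℕ, ℕ) ∈ treeIdx 1 r.depth then x (some ⟨_, h⟩) else 0

open Classical in
/-- An order of appearance of the entries `u, w` in the bottom blocks: the slots
`1, …, 2 ^ ⌈log₂ p⌉` are filled with the symbols `c_α` (written `some α`), each `p_α` times, and with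
the symbol `(∏ λ_α ^ λ_α) x_β` (written `none`), `2 ^ ⌈log₂ p⌉ - p` times. -/
def RedCircuit.IsArrangement (r : RedCircuit 𝒜 ℬ) (s : ℕ → Option ↥𝒜) : Prop :=
  (∀ a : ↥𝒜, ((Finset.Icc 1 (2 ^ r.depth)).filter fun q => s q = some a).card = r.num a) ∧
  ((Finset.Icc 1 (2 ^ r.depth)).filter fun q => s q = none).card = 2 ^ r.depth - r.den

/-- The entry in slot `q`. -/
def RedCircuit.entry (r : RedCircuit 𝒜 ℬ) (s : ℕ → Option ↥𝒜) (c : Coeff 𝒜 ℬ)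
    (x : r.Var → ℝ) (q : ℕ) : ℝ :=
  match s q with
  | some a => c (Sum.inl a)
  | none => r.theta * x none

/-- `c` vanishes outside of `A ∪ {β}`. -/
def RedCircuit.Supports (r : RedCircuit 𝒜 ℬ) (c : Coeff 𝒜 ℬ) : Prop :=
  ∀ t : ↥𝒜 ⊕ ↥ℬ, (∀ a ∈ r.outer, t ≠ Sum.inl a) → t ≠ r.inner → c t = 0

/-- The explicit second-order conditions on the coefficient vector and the circuit variables of one
reduced circuit; the bottom block `l` has the entries of the slots `2l - 1` and `2l`. -/
structure RedCircuit.Conditions (r : RedCircuit 𝒜 ℬ) (s : ℕ → Option ↥𝒜) (c : Coeff 𝒜 ℬ)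
    (x : r.Var → ℝ) : Prop where
  inner_block : ∀ k ∈ Finset.Icc 2 r.depth, ∀ i ∈ Finset.Icc 1 (2 ^ (r.depth - k)),
    (!![r.node x (k - 1) (2 * i - 1), r.node x k i;
        r.node x k i, r.node x (k - 1) (2 * i)]).PosSemidef
  root : 0 ≤ r.node x r.depth 1 - r.theta * x none
  coeff : 0 ≤ x none + c r.inner
  odd : r.IsOdd → ‖c r.inner‖ ≤ x none
  bottom_block : ∀ l ∈ Finset.Icc 1 (2 ^ (r.depth - 1)),
    (!![r.entry s c x (2 * l - 1), r.node x 1 l;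
        r.node x 1 l, r.entry s c x (2 * l)]).PosSemidef

/-! ### Circuit matrices and the lifted cone -/

/-- Labels of the blocks of the circuit matrix: the `2 × 2` blocks with `k ≥ 2`, the two singleton
blocks, and the `2 × 2` blocks at the bottom. -/
abbrev RedCircuit.Block (r : RedCircuit 𝒜 ℬ) : Type :=
  ↥(treeIdx 2 r.depth) ⊕ (Fin 2 ⊕ ↥(Finset.Icc 1 (2 ^ (r.depth - 1))))

/-- The size of a block. -/
def RedCircuit.blockSize (r : RedCircuit 𝒜 ℬ) : r.Block → ℕ
  | Sum.inl _ => 2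
  | Sum.inr (Sum.inl _) => 1
  | Sum.inr (Sum.inr _) => 2

/-- The blocks of the circuit matrix. -/
def RedCircuit.block (r : RedCircuit 𝒜 ℬ) (s : ℕ → Option ↥𝒜) (c : Coeff 𝒜 ℬ)
    (x : r.Var → ℝ) : (t : r.Block) → Matrix (Fin (r.blockSize t)) (Fin (r.blockSize t)) ℝ
  | Sum.inl q =>
      !![r.node x (q.1.1 - 1) (2 * q.1.2 - 1), r.node x q.1.1 q.1.2;
         r.node x q.1.1 q.1.2, r.node x (q.1.1 - 1) (2 * q.1.2)]
  | Sum.inr (Sum.inl j) =>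
      !![if j = 0 then r.node x r.depth 1 - r.theta * x none else x none + c r.inner]
  | Sum.inr (Sum.inr l) =>
      !![r.entry s c x (2 * (l : ℕ) - 1), r.node x 1 l;
         r.node x 1 l, r.entry s c x (2 * (l : ℕ))]

open Classical in
/-- The block diagonal circuit matrix. -/
def RedCircuit.circuitMatrix (r : RedCircuit 𝒜 ℬ) (s : ℕ → Option ↥𝒜) (c : Coeff 𝒜 ℬ)
    (x : r.Var → ℝ) : Matrix (Σ t : r.Block, Fin (r.blockSize t))
      (Σ t : r.Block, Fin (r.blockSize t)) ℝ :=
  Matrix.blockDiagonal' (r.block s c x)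

/-- The space of all circuit variables. -/
abbrev AllVars (𝒜 : Finset (Fin n → ℝ)) (ℬ : Finset (Fin n → ℕ)) : Type :=
  (r : RedCircuit 𝒜 ℬ) → r.Var → ℝ

/-- The lifted cone of one reduced circuit, embedded into the common space by zeros in the
coordinates of the other circuits.  For an odd circuit there is one further `2 × 2` block. -/
def RedCircuit.lifted (r : RedCircuit 𝒜 ℬ) (s : ℕ → Option ↥𝒜) :
    Set (Coeff 𝒜 ℬ × AllVars 𝒜 ℬ) :=
  {z | (r.circuitMatrix s z.1 (z.2 r)).PosSemidef ∧
    (r.IsOdd → (!![z.2 r none, z.1 r.inner; z.1 r.inner, z.2 r none]).PosSemidef) ∧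
    r.Supports z.1 ∧ ∀ r', r' ≠ r → z.2 r' = 0}

/-- The lifted cone of a singleton circuit `(α)`, which stands for the functions `t |x|^α` with
`t ≥ 0` and has no circuit variables of its own. -/
def liftedSingleton (𝒜 : Finset (Fin n → ℝ)) (ℬ : Finset (Fin n → ℕ)) (a : ↥𝒜) :
    Set (Coeff 𝒜 ℬ × AllVars 𝒜 ℬ) :=
  {z | 0 ≤ z.1 (Sum.inl a) ∧ (∀ t, t ≠ Sum.inl a → z.1 t = 0) ∧ z.2 = 0}

/-- The lifted cone, a Minkowski sum over all reduced circuits and all singleton circuits. -/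
def liftedCone (σ : RedCircuit 𝒜 ℬ → ℕ → Option ↥𝒜) : Set (Coeff 𝒜 ℬ × AllVars 𝒜 ℬ) :=
  (∑ r : RedCircuit 𝒜 ℬ, r.lifted (σ r)) + ∑ a : ↥𝒜, liftedSingleton 𝒜 ℬ a

end Circuit

/-! ### Second-order representability -/

/-- `S` is the projection, on the first coordinates, of the feasible set
`{z | ‖Mᵢ z + bᵢ‖₂ ≤ cᵢᵀ z + dᵢ for all i}` of a second-order cone program with symmetric `Mᵢ`. -/
def IsSecondOrderRepresentable {ι : Type*} [Fintype ι] (S : Set (ι → ℝ)) : Prop :=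
  ∃ (N m : ℕ) (M : Fin m → Matrix (ι ⊕ Fin N) (ι ⊕ Fin N) ℝ)
    (b c : Fin m → (ι ⊕ Fin N) → ℝ) (d : Fin m → ℝ),
    (∀ i, (M i).IsSymm) ∧
    S = (fun (z : ι ⊕ Fin N → ℝ) (t : ι) => z (Sum.inl t)) ''
      {z | ∀ i, ‖WithLp.toLp 2 (Matrix.mulVec (M i) z + b i)‖ ≤ c i ⬝ᵥ z + d i}

/-! ### The SONC cone -/

/-- `(A, β)` is a circuit of even exponents in the support set `𝒮`: `A` consists of even exponents
and is affinely independent, and `β ∈ 𝒮` is in the relative interior of its convex hull. -/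
def IsPolyCircuit {n : ℕ} {𝒮 : Finset (Fin n →₀ ℕ)} (r : Finset ↥𝒮 × ↥𝒮) : Prop :=
  (∀ a ∈ r.1, ∀ j, Even ((a : Fin n →₀ ℕ) j)) ∧
  AffineIndependent ℝ (fun a : ↥r.1 => natVec ((a : ↥𝒮) : Fin n →₀ ℕ)) ∧
  natVec (r.2 : Fin n →₀ ℕ) ∈
    intrinsicInterior ℝ (convexHull ℝ {y | ∃ a ∈ r.1, natVec (a : Fin n →₀ ℕ) = y})

/-- The finite set of all circuits in the support set `𝒮`. -/
abbrev PolyCircuit {n : ℕ} (𝒮 : Finset (Fin n →₀ ℕ)) : Type :=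
  {r : Finset ↥𝒮 × ↥𝒮 // IsPolyCircuit r}

instance {n : ℕ} (𝒮 : Finset (Fin n →₀ ℕ)) : Fintype (PolyCircuit 𝒮) := Fintype.ofFinite _

/-- The polynomials with support in `A ∪ {β}` that are non-negative on `ℝⁿ`. -/
def PolyCircuit.nonneg {n : ℕ} {𝒮 : Finset (Fin n →₀ ℕ)} (r : PolyCircuit 𝒮) :
    Set (MvPolynomial (Fin n) ℝ) :=
  {f | (∀ e ∈ f.support, (∃ a ∈ r.1.1, (a : Fin n →₀ ℕ) = e) ∨ e = (r.1.2 : Fin n →₀ ℕ)) ∧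
    ∀ x : Fin n → ℝ, 0 ≤ MvPolynomial.eval x f}

/-- The cone of SONC polynomials with support in `𝒮`. -/
def soncCone {n : ℕ} (𝒮 : Finset (Fin n →₀ ℕ)) : Set (MvPolynomial (Fin n) ℝ) :=
  ∑ r : PolyCircuit 𝒮, r.nonneg

/-- The polynomial with coefficient vector `c`. -/
def polyOf {n : ℕ} {𝒮 : Finset (Fin n →₀ ℕ)} (c : ↥𝒮 → ℝ) : MvPolynomial (Fin n) ℝ :=
  ∑ a : ↥𝒮, MvPolynomial.monomial (a : Fin n →₀ ℕ) (c a)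

end SCone

end

/-!
The coefficient vector is determined by the function (`sFun_injective`, linear independence of
characters), so everything takes place in the coefficient space.

The second-order conditions of one reduced circuit are a binary tree of geometric means. The blocks
say that the square of each node is at most the product of its children, so the root is at most the
geometric mean of the `2 ^ K` leaves. The slots filled with `Θ x_β` cancel against the root, and what
remains is `Θ x_β ≤ ∏ c_α ^ λ_α`. Conversely the tree of actual geometric means satisfies the
conditions. Eliminating the circuit variables thus leaves the bound of the inner coefficient by the
circuit number (`RedCircuit.exists_conditions_iff`), and a vector with this bound is non-negative by
the inequality of weighted arithmetic and geometric means (`RedCircuit.IsBounded.sFun_nonneg`).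

The core is the converse: a non-negative AG function decomposes into reduced circuits
(`hasCircuitDecomposition_of_AG`). Non-negativity on the positive orthant, for odd functions together
with a sign change, says that `∑ c_α exp ⟨α - β, w⟩ ≥ |c_β|` for all `w`. The infimum need not be
attained, but the vectors of terms along minimizers of a regularized problem have a limit `u`, which
is balanced, `∑ u_α (α - β) = 0`, has total weight at least `|c_β|`, and on its support is still the
vector of terms at a common point `w` (`exists_balanced_certificate`). By Carathéodory's theorem the
balanced vector `∑ u_α e_α - (∑ u_α) e_β` is a conic combination of circuit vectors
`∑ λ_α e_α - e_β`. A circuit with a further exponent of `𝒜` in its convex hull splits into circuits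
of larger total weight (`Circ.exists_heavier`), while the total weight is bounded by strict convexity
of the square of the norm, so that a combination of maximal weight uses reduced circuits only
(`exists_reduced_decomposition`). Transporting it back with the character `exp ⟨β - ·, w⟩` gives the
decomposition of `c`.

The lifted cone is the same description with its blocks collected into one matrix
(`image_fst_liftedCone`). A positive semidefinite `2 × 2` block with linear entries `p, q, r` is the
second-order condition `‖(2q, p - r)‖ ≤ p + r`, and the two rows on the left can be replaced by a
symmetric square matrix, the square root of their Gram matrix (`exists_socp_of_posSemidef`). Finally,
the SONC cone is the `𝒮`-cone of the even and the odd exponents of its support set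
(`mem_soncCoeff_iff`), since the outer coefficients of a non-negative circuit polynomial are
non-negative.
-/

noncomputable section

namespace SCone

/-! ### Barycentric coordinates -/

/-- The barycentric coordinates of an affinely independent set extend to affine functions
`x ↦ ⟨w a, x⟩ + k a` on the whole space. -/
lemma exists_affine_coords {n : ℕ} {ι : Type*} {p : ι → Fin n → ℝ} {A : Finset ι}
    (hA : AffineIndependent ℝ (fun a : ↥A => p a)) :
    ∃ (w : ι → Fin n → ℝ) (k : ι → ℝ), ∀ (l : ι → ℝ), ∑ a ∈ A, l a = 1 →
      ∀ a ∈ A, w a ⬝ᵥ (∑ a ∈ A, l a • p a) + k a = l a := by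
  classical
  -- the homogenized points `(p a, 1)` are linearly independent and have a dual family
  let v : ↥A → (Fin n → ℝ) × ℝ := fun a => (p a, 1)
  have hv : LinearIndependent ℝ v := by
    rw [Fintype.linearIndependent_iff]
    intro g hg i
    have h1 : ∑ i, g i • p i = 0 := by
      simpa [v, Prod.fst_sum] using congrArg Prod.fst hg
    have h2 : ∑ i, g i = 0 := by
      simpa [v, Prod.snd_sum] using congrArg Prod.snd hg
    exact hA.eq_zero_of_sum_eq_zero h2 h1 i (Finset.mem_univ _)
  obtain ⟨f, hf⟩ := LinearMap.exists_leftInverse_of_injective _ (LinearMap.ker_eq_bot.2 hv)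
  let G : ι → (Fin n → ℝ) × ℝ → ℝ := fun a x => if h : a ∈ A then f x ⟨a, h⟩ else 0
  refine ⟨fun a j => G a (Pi.single j 1, 0), fun a => G a (0, 1), fun l hl a ha => ?_⟩
  have key : f (∑ a ∈ A, l a • p a, 1) ⟨a, ha⟩ = l a := by
    have : ((∑ a ∈ A, l a • p a, 1) : (Fin n → ℝ) × ℝ)
        = Finsupp.linearCombination ℝ v (Finsupp.equivFunOnFinite.symm fun a : ↥A => l a) := by
      rw [Finsupp.linearCombination_apply, Finsupp.sum_fintype _ _ (by simp)]
      ext1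
      · simp only [Prod.fst_sum, v, Prod.smul_mk]
        rw [← Finset.sum_coe_sort]; rfl
      · simp only [Prod.snd_sum, v, Prod.smul_mk, smul_eq_mul, mul_one]
        rw [← hl, ← Finset.sum_coe_sort]; rfl
    rw [this, ← LinearMap.comp_apply, hf]; rfl
  set y := ∑ a ∈ A, l a • p a
  have h2 : ((y, 1) : (Fin n → ℝ) × ℝ)
      = ∑ j, y j • ((Pi.single j 1, 0) : (Fin n → ℝ) × ℝ) + (0, 1) := by
    ext1
    · simp only [Prod.fst_add, Prod.fst_sum, Prod.smul_mk, add_zero]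
      exact pi_eq_sum_univ' y
    · simp [Prod.snd_sum]
  rw [← key, h2, map_add, map_sum]
  simp only [map_smul]
  simp [G, ha, dotProduct, mul_comm]

/-- Points of the convex hull of finitely many points are their convex combinations. -/
lemma mem_convexHull_image_finset {n : ℕ} {ι : Type*} {p : ι → Fin n → ℝ} {A : Finset ι}
    (hp : Function.Injective p) {y : Fin n → ℝ} :
    y ∈ convexHull ℝ (p '' A) ↔ ∃ l : ι → ℝ, (∀ a, 0 ≤ l a) ∧ (∀ a, a ∉ A → l a = 0) ∧
      ∑ a ∈ A, l a = 1 ∧ ∑ a ∈ A, l a • p a = y := by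
  classical
  rw [← Finset.coe_image, Finset.mem_convexHull']
  constructor
  · rintro ⟨w, h0, h1, h2⟩
    rw [Finset.sum_image hp.injOn] at h1 h2
    refine ⟨fun a => if a ∈ A then w (p a) else 0, fun a => ?_, fun a ha => by simp [ha], ?_, ?_⟩
    · dsimp only
      split_ifs with ha
      · exact h0 _ (Finset.mem_image_of_mem _ ha)
      · exact le_rfl
    · rw [← h1]; exact Finset.sum_congr rfl fun a ha => by simp [ha]
    · rw [← h2]; exact Finset.sum_congr rfl fun a ha => by simp [ha]
  · rintro ⟨l, h0, -, h1, h2⟩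
    refine ⟨fun x => ∑ a ∈ A, if p a = x then l a else 0,
      fun x hx => Finset.sum_nonneg fun a _ => ?_, ?_, ?_⟩
    · split_ifs
      · exact h0 a
      · exact le_rfl
    · rw [Finset.sum_image hp.injOn, ← h1]
      exact Finset.sum_congr rfl fun a ha => by simp [hp.eq_iff, ha]
    · rw [Finset.sum_image hp.injOn, ← h2]
      exact Finset.sum_congr rfl fun a ha => by simp [hp.eq_iff, ha]

section Barycentric

variable {n : ℕ} {𝒜 : Finset (Fin n → ℝ)} {A : Finset ↥𝒜} {y : Fin n → ℝ} {l : ↥𝒜 → ℝ}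

lemma IsBarycentric.unique
    (hA : AffineIndependent ℝ (fun a : ↥A => ((a : ↥𝒜) : Fin n → ℝ)))
    (hl : IsBarycentric A y l) {m : ↥𝒜 → ℝ} (hm : ∑ a ∈ A, m a = 1)
    (hmy : ∑ a ∈ A, m a • (a : Fin n → ℝ) = y) : ∀ a ∈ A, m a = l a := by
  obtain ⟨w, k, h⟩ := exists_affine_coords hA
  intro a ha
  rw [← h l hl.2.2.1 a ha, ← h m hm a ha, hl.2.2.2, hmy]

lemma pts_eq_range (A : Finset ↥𝒜) :
    pts A = Set.range (fun a : ↥A => ((a : ↥𝒜) : Fin n → ℝ)) := by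
  ext y; simp [pts]

lemma mem_convexHull_pts :
    y ∈ convexHull ℝ (pts A) ↔ ∃ l, IsBarycentric A y l :=
  mem_convexHull_image_finset (p := fun a : ↥𝒜 => (a : Fin n → ℝ)) Subtype.val_injective

/-- Relative interior of a simplex: all barycentric coordinates are positive. -/
lemma mem_intrinsicInterior_pts
    (hA : AffineIndependent ℝ (fun a : ↥A => ((a : ↥𝒜) : Fin n → ℝ))) :
    y ∈ intrinsicInterior ℝ (convexHull ℝ (pts A)) ↔
      ∃ l, IsBarycentric A y l ∧ ∀ a ∈ A, 0 < l a := by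
  classical
  constructor
  · intro hy
    obtain ⟨l, hl⟩ := mem_convexHull_pts.1 (intrinsicInterior_subset hy)
    refine ⟨l, hl, fun a ha => ?_⟩
    obtain ⟨z, hz, hzy⟩ := mem_intrinsicInterior.1 hy
    have haA : (a : Fin n → ℝ) ∈ affineSpan ℝ (convexHull ℝ (pts A)) :=
      subset_affineSpan ℝ _ (subset_convexHull ℝ _ ⟨a, ha, rfl⟩)
    -- a small prolongation of the segment from `a` to `y` stays in the hull
    let φ : ℝ → affineSpan ℝ (convexHull ℝ (pts A)) :=
      fun t => ⟨AffineMap.lineMap (a : Fin n → ℝ) y t,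
        AffineMap.lineMap_mem t haA (hzy ▸ z.2)⟩
    have hφ' : ∀ t, ((φ t : _) : Fin n → ℝ) = AffineMap.lineMap (a : Fin n → ℝ) y t :=
      fun t => rfl
    have hφ : Continuous φ := by
      rw [continuous_induced_rng]
      have : (Subtype.val ∘ φ) = fun t => AffineMap.lineMap (a : Fin n → ℝ) y t := funext hφ'
      rw [this]; exact AffineMap.lineMap_continuous
    have h1 : φ 1 = z := Subtype.ext (by simp [φ, hzy])
    have hnh : ∀ᶠ t in nhds (1 : ℝ), φ t ∈ ((↑) ⁻¹' (convexHull ℝ (pts A)) :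
        Set (affineSpan ℝ (convexHull ℝ (pts A)))) := by
      apply hφ.continuousAt.eventually_mem
      rw [h1]; exact mem_interior_iff_mem_nhds.1 hz
    obtain ⟨ε, hε, hb⟩ := Metric.eventually_nhds_iff.1 hnh
    have h2 := @hb (1 + ε / 2) (by simp [abs_of_pos hε, hε])
    change AffineMap.lineMap (a : Fin n → ℝ) y (1 + ε / 2) ∈ convexHull ℝ (pts A) at h2
    obtain ⟨μ, hμ⟩ := mem_convexHull_pts.1 h2
    -- the coordinates of the prolongation are `(1 + ε/2) l - (ε/2) e_a`, non-negative at `a`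
    have := IsBarycentric.unique hA hμ
      (m := fun b => (1 + ε / 2) * l b - if b = a then ε / 2 else 0)
      (by simp [Finset.sum_sub_distrib, ← Finset.mul_sum, hl.2.2.1, ha])
      (by
        simp only [sub_smul, mul_smul, Finset.sum_sub_distrib, ← Finset.smul_sum, hl.2.2.2,
          ite_smul, zero_smul, Finset.sum_ite_eq', ha, if_true]
        rw [AffineMap.lineMap_apply_module]
        module) a ha
    have h0 := hμ.1 a
    simp only [if_true] at this
    rw [← this] at h0
    by_contra hc
    nlinarith [hl.1 a]
  · rintro ⟨l, hl, hpos⟩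
    obtain ⟨w, k, hwk⟩ := exists_affine_coords hA
    have hyA : y ∈ affineSpan ℝ (convexHull ℝ (pts A)) :=
      subset_affineSpan ℝ _ (mem_convexHull_pts.2 ⟨l, hl⟩)
    refine mem_intrinsicInterior.2 ⟨⟨y, hyA⟩, ?_, rfl⟩
    rw [mem_interior_iff_mem_nhds]
    have hev : ∀ᶠ z : affineSpan ℝ (convexHull ℝ (pts A)) in nhds ⟨y, hyA⟩,
        ∀ a ∈ A, 0 < w a ⬝ᵥ (z : Fin n → ℝ) + k a := by
      rw [Filter.eventually_all_finset]
      intro a ha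
      have hc : Continuous fun z : affineSpan ℝ (convexHull ℝ (pts A)) =>
          w a ⬝ᵥ (z : Fin n → ℝ) + k a :=
        (continuous_const.dotProduct continuous_subtype_val).add continuous_const
      apply hc.continuousAt.eventually_const_lt
      show 0 < w a ⬝ᵥ y + k a
      have := hwk l hl.2.2.1 a ha
      rw [hl.2.2.2] at this
      rw [this]; exact hpos a ha
    filter_upwards [hev] with z hz
    rw [Set.mem_preimage, mem_convexHull_pts]
    have hzS : (z : Fin n → ℝ) ∈ affineSpan ℝ (pts A) := by
      have := z.2
      simpa only [affineSpan_convexHull] using this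
    simp only [pts_eq_range] at hzS
    obtain ⟨μ, hμ1, hμ2⟩ := eq_affineCombination_of_mem_affineSpan_of_fintype hzS
    rw [Finset.affineCombination_eq_linear_combination _ _ _ hμ1] at hμ2
    let m : ↥𝒜 → ℝ := fun a => if h : a ∈ A then μ ⟨a, h⟩ else 0
    have hm1 : ∑ a ∈ A, m a = 1 := by
      rw [← hμ1, ← Finset.sum_coe_sort]; simp [m]
    have hm2 : ∑ a ∈ A, m a • (a : Fin n → ℝ) = z := by
      rw [hμ2, ← Finset.sum_coe_sort]; simp [m]
    refine ⟨m, fun a => ?_, fun a ha => by simp [m, ha], hm1, hm2⟩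
    by_cases ha : a ∈ A
    · rw [← hwk m hm1 a ha, hm2]; exact (hz a ha).le
    · simp [m, ha]

end Barycentric

/-! ### Barycentric coordinates of reduced circuits -/

section CircuitData

variable {n : ℕ} {𝒜 : Finset (Fin n → ℝ)} {ℬ : Finset (Fin n → ℕ)}

lemma RedCircuit.isBarycentric_bary (r : RedCircuit 𝒜 ℬ) :
    IsBarycentric r.outer (expo r.inner) r.bary := by
  have h : ∃ l, IsBarycentric r.outer (expo r.inner) l :=
    mem_convexHull_pts.1 (intrinsicInterior_subset r.2.2.1)
  rw [RedCircuit.bary, dif_pos h]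
  exact h.choose_spec

lemma RedCircuit.bary_eq (r : RedCircuit 𝒜 ℬ) {l : ↥𝒜 → ℝ}
    (hl : IsBarycentric r.outer (expo r.inner) l) : r.bary = l := by
  funext a
  by_cases ha : a ∈ r.outer
  · exact hl.unique r.2.1 r.isBarycentric_bary.2.2.1 r.isBarycentric_bary.2.2.2 a ha
  · rw [hl.2.1 a ha, r.isBarycentric_bary.2.1 a ha]

lemma RedCircuit.bary_pos (r : RedCircuit 𝒜 ℬ) {a : ↥𝒜} (ha : a ∈ r.outer) : 0 < r.bary a := by
  obtain ⟨l, hl, hpos⟩ := (mem_intrinsicInterior_pts r.2.1).1 r.2.2.1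
  rw [r.bary_eq hl]; exact hpos a ha

lemma RedCircuit.sum_bary (r : RedCircuit 𝒜 ℬ) : ∑ a ∈ r.outer, r.bary a = 1 :=
  r.isBarycentric_bary.2.2.1

lemma RedCircuit.sum_univ_bary (r : RedCircuit 𝒜 ℬ) : ∑ a, r.bary a = 1 := by
  rw [← r.sum_bary]
  exact (Finset.sum_subset (Finset.subset_univ _) fun a _ ha => r.isBarycentric_bary.2.1 a ha).symm

lemma RedCircuit.inner_ne (r : RedCircuit 𝒜 ℬ) {a : ↥𝒜} (ha : a ∈ r.outer) :
    Sum.inl a ≠ r.inner := fun h => r.2.2.2.1 ⟨a, ha, by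
      have : expo r.inner = a := by rw [← h]; rfl
      exact this.symm⟩

lemma RedCircuit.theta_pos (r : RedCircuit 𝒜 ℬ) : 0 < r.theta :=
  Finset.prod_pos fun _ ha => Real.rpow_pos_of_pos (r.bary_pos ha) _

lemma expo_rational (hrat : IsRationalSet 𝒜) (i : ↥𝒜 ⊕ ↥ℬ) (j : Fin n) :
    ∃ q : ℚ, expo i j = (q : ℝ) := by
  rcases i with a | b
  · exact hrat a a.2 j
  · exact ⟨((b : Fin n → ℕ) j : ℚ), by simp [expo, natVec]⟩

/-- A `ℚ`-linear retraction `ℝ → ℚ` maps the barycentric coordinates of a rational circuit to a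
second solution of the same linear system, so that the coordinates are rational by uniqueness. -/
lemma RedCircuit.bary_rational (hrat : IsRationalSet 𝒜) (r : RedCircuit 𝒜 ℬ) (a : ↥𝒜) :
    ∃ q : ℚ, 0 ≤ q ∧ r.bary a = (q : ℝ) := by
  obtain ⟨π, hπ⟩ := LinearMap.exists_leftInverse_of_injective (Algebra.linearMap ℚ ℝ)
    (LinearMap.ker_eq_bot.2 (algebraMap ℚ ℝ).injective)
  have hπq : ∀ q : ℚ, π (q : ℝ) = q := fun q => by
    have := LinearMap.congr_fun hπ q
    simpa using this
  have hb := r.isBarycentric_bary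
  suffices h : ((π (r.bary a) : ℚ) : ℝ) = r.bary a by
    refine ⟨π (r.bary a), ?_, h.symm⟩
    have := hb.1 a
    rw [← h] at this
    exact_mod_cast this
  by_cases ha : a ∈ r.outer
  · refine hb.unique r.2.1 (m := fun a => ((π (r.bary a) : ℚ) : ℝ)) ?_ ?_ a ha
    · rw [← Rat.cast_sum, ← map_sum]
      change ((π (∑ a ∈ r.outer, r.bary a) : ℚ) : ℝ) = 1
      rw [hb.2.2.1]
      have := hπq 1
      simp only [Rat.cast_one] at this
      exact_mod_cast this
    · funext j
      obtain ⟨q, hq⟩ := expo_rational hrat r.inner j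
      have hj := congrFun hb.2.2.2 j
      rw [hq, Finset.sum_apply] at hj
      rw [hq, Finset.sum_apply, ← hπq q, ← hj, map_sum, Rat.cast_sum]
      refine Finset.sum_congr rfl fun b _ => ?_
      obtain ⟨q', hq'⟩ := hrat b b.2 j
      have : r.bary b * (q' : ℝ) = q' • r.bary b := by rw [Rat.smul_def, mul_comm]
      simp only [Pi.smul_apply, smul_eq_mul]
      rw [hq', this, map_smul]
      simp [mul_comm]
  · rw [hb.2.1 a ha]; simp

/-- The infimum that defines the denominator is attained: the product of the denominators of the
barycentric coordinates is a common denominator. -/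
lemma RedCircuit.den_spec (hrat : IsRationalSet 𝒜) (r : RedCircuit 𝒜 ℬ) :
    0 < r.den ∧ ∀ a, ∃ m : ℕ, r.bary a * r.den = m := by
  refine Nat.sInf_mem (s := {p : ℕ | 0 < p ∧ ∀ a, ∃ m : ℕ, r.bary a * p = m}) ?_
  choose q hq0 hq using r.bary_rational hrat
  refine ⟨∏ a, (q a).den, Finset.prod_pos fun a _ => (q a).den_pos, fun a => ?_⟩
  obtain ⟨k, hk⟩ := Finset.dvd_prod_of_mem (fun a => (q a).den) (Finset.mem_univ a)
  refine ⟨(q a).num.toNat * k, ?_⟩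
  have h1 : (((q a).num.toNat : ℕ) : ℝ) = ((q a).num : ℝ) := by
    exact_mod_cast Int.toNat_of_nonneg (Rat.num_nonneg.2 (hq0 a))
  have h2 : (q a : ℝ) * ((q a).den : ℝ) = ((q a).num : ℝ) := by
    exact_mod_cast Rat.mul_den_eq_num (q a)
  rw [hq, hk]
  push_cast
  rw [h1, ← h2]; ring

lemma RedCircuit.num_eq (hrat : IsRationalSet 𝒜) (r : RedCircuit 𝒜 ℬ) (a : ↥𝒜) :
    (r.num a : ℝ) = r.bary a * r.den := by
  obtain ⟨m, hm⟩ := (r.den_spec hrat).2 a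
  rw [RedCircuit.num, hm, Nat.floor_natCast]

lemma RedCircuit.num_pos (hrat : IsRationalSet 𝒜) (r : RedCircuit 𝒜 ℬ) {a : ↥𝒜}
    (ha : a ∈ r.outer) : 0 < r.num a := by
  have : (0 : ℝ) < r.num a := by
    rw [r.num_eq hrat]
    exact mul_pos (r.bary_pos ha) (by exact_mod_cast (r.den_spec hrat).1)
  exact_mod_cast this

lemma RedCircuit.num_eq_zero (hrat : IsRationalSet 𝒜) (r : RedCircuit 𝒜 ℬ) {a : ↥𝒜}
    (ha : a ∉ r.outer) : r.num a = 0 := by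
  have : (r.num a : ℝ) = 0 := by
    rw [r.num_eq hrat, r.isBarycentric_bary.2.1 a ha, zero_mul]
  exact_mod_cast this

lemma RedCircuit.sum_num (hrat : IsRationalSet 𝒜) (r : RedCircuit 𝒜 ℬ) :
    ∑ a, r.num a = r.den := by
  have : ((∑ a, r.num a : ℕ) : ℝ) = r.den := by
    push_cast
    simp only [r.num_eq hrat, ← Finset.sum_mul, r.sum_univ_bary, one_mul]
  exact_mod_cast this

/-- If the denominator were `1`, the inner exponent would be one of the outer exponents. -/
lemma RedCircuit.two_le_den (hrat : IsRationalSet 𝒜) (r : RedCircuit 𝒜 ℬ) : 2 ≤ r.den := by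
  by_contra hlt
  have h1 : r.den = 1 := by have := (r.den_spec hrat).1; omega
  have hs := r.sum_num hrat
  have hb := r.isBarycentric_bary
  rw [h1] at hs
  -- the numerators sum up to one and are positive on the outer exponents, so there is only one
  obtain ⟨a, ha, hna⟩ : ∃ a ∈ r.outer, r.num a ≠ 0 := by
    by_contra! hc
    have : ∑ a, r.num a = 0 := Finset.sum_eq_zero fun a _ => by
      by_cases ha : a ∈ r.outer
      · exact hc a ha
      · exact r.num_eq_zero hrat ha
    omega
  have hother : ∀ b ∈ r.outer, b ≠ a → False := by
    intro b hb' hba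
    have h2 : r.num a + r.num b ≤ ∑ a, r.num a := by
      classical
      rw [← Finset.sum_pair hba.symm]
      exact Finset.sum_le_sum_of_subset (Finset.subset_univ _)
    have := r.num_pos hrat hb'
    omega
  have hA : r.outer = {a} := by
    ext b
    simp only [Finset.mem_singleton]
    exact ⟨fun h => by_contra fun hc => hother b h hc, fun h => h ▸ ha⟩
  apply r.2.2.2.1
  refine ⟨a, ha, ?_⟩
  have h3 := hb.2.2.2
  have h4 := hb.2.2.1
  rw [hA] at h3 h4
  simp only [Finset.sum_singleton] at h3 h4
  rw [h4, one_smul] at h3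
  exact h3

lemma RedCircuit.one_le_depth (hrat : IsRationalSet 𝒜) (r : RedCircuit 𝒜 ℬ) : 1 ≤ r.depth :=
  Nat.clog_pos (by norm_num) (r.two_le_den hrat)

lemma RedCircuit.den_le (r : RedCircuit 𝒜 ℬ) : r.den ≤ 2 ^ r.depth :=
  Nat.le_pow_clog (by norm_num) _

/-- Slots `1, …, N` can be filled with symbols of prescribed multiplicities of total `N`. -/
lemma exists_fill {τ : Type*} [Fintype τ] [DecidableEq τ] [Inhabited τ] (m : τ → ℕ) (N : ℕ)
    (h : ∑ t, m t = N) :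
    ∃ s : ℕ → τ, ∀ t, ((Finset.Icc 1 N).filter fun q => s q = t).card = m t := by
  have hc : Fintype.card ↥(Finset.Icc 1 N) = Fintype.card (Σ t, Fin (m t)) := by
    simp [h]
  let e := Fintype.equivOfCardEq hc
  refine ⟨fun q => if hq : q ∈ Finset.Icc 1 N then (e ⟨q, hq⟩).1 else default, fun t => ?_⟩
  have : m t = (Finset.univ.filter fun p : (Σ t, Fin (m t)) => p.1 = t).card := by
    rw [← Fintype.card_subtype]
    rw [Fintype.card_congr (Equiv.sigmaSubtype t)]
    simp
  rw [this]
  refine Finset.card_bij' (fun q hq => e ⟨q, (Finset.mem_filter.1 hq).1⟩)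
    (fun p _ => ((e.symm p : ↥(Finset.Icc 1 N)) : ℕ)) ?_ ?_ ?_ ?_
  · intro q hq
    have h1 := (Finset.mem_filter.1 hq).1
    have h2 := (Finset.mem_filter.1 hq).2
    simp only [h1, dif_pos] at h2
    simpa using h2
  · intro p hp
    have h2 := (Finset.mem_filter.1 hp).2
    refine Finset.mem_filter.2 ⟨(e.symm p).2, ?_⟩
    simp [h2]
  · intro q hq; simp
  · intro p hp; simp

lemma RedCircuit.exists_isArrangement (hrat : IsRationalSet 𝒜) (r : RedCircuit 𝒜 ℬ) :
    ∃ s, r.IsArrangement s := by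
  classical
  obtain ⟨s, hs⟩ := exists_fill
    (fun t : Option ↥𝒜 => t.elim (2 ^ r.depth - r.den) fun a => r.num a) (2 ^ r.depth) (by
      rw [Fintype.sum_option]
      simp only [Option.elim_none, Option.elim_some, r.sum_num hrat]
      have := r.den_le
      omega)
  refine ⟨s, fun a => ?_, ?_⟩
  · convert hs (some a); rfl
  · convert hs none; rfl

end CircuitData

/-! ### Binary trees of geometric means -/

lemma posSemidef_fin_two {a b d : ℝ} :
    (!![a, b; b, d]).PosSemidef ↔ 0 ≤ a ∧ 0 ≤ d ∧ b ^ 2 ≤ a * d := by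
  constructor
  · intro h
    have h0 := h.diag_nonneg (i := 0)
    have h1 := h.diag_nonneg (i := 1)
    have h2 := h.det_nonneg
    rw [Matrix.det_fin_two_of] at h2
    exact ⟨by simpa using h0, by simpa using h1, by nlinarith⟩
  · rintro ⟨ha, hd, hb⟩
    refine Matrix.PosSemidef.of_dotProduct_mulVec_nonneg ?_ fun x => ?_
    · ext i j; fin_cases i <;> fin_cases j <;> simp
    · simp only [Matrix.mulVec, dotProduct, Fin.sum_univ_two, Pi.star_apply, star_trivial,
        Matrix.of_apply, Matrix.cons_val_zero, Matrix.cons_val_one]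
      rcases ha.eq_or_lt with rfl | ha
      · have : b = 0 := by nlinarith [sq_nonneg b]
        subst this
        nlinarith [mul_nonneg hd (sq_nonneg (x 1))]
      · have h1 : 0 ≤ a * (a * x 0 ^ 2 + 2 * b * x 0 * x 1 + d * x 1 ^ 2) := by
          nlinarith [sq_nonneg (a * x 0 + b * x 1), mul_nonneg (sub_nonneg.2 hb) (sq_nonneg (x 1))]
        have h2 := nonneg_of_mul_nonneg_right h1 ha
        linarith

lemma prod_Icc_two_mul (g : ℕ → ℝ) (m : ℕ) :
    ∏ l ∈ Finset.Icc 1 (2 * m), g l = ∏ l ∈ Finset.Icc 1 m, g (2 * l - 1) * g (2 * l) := by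
  induction m with
  | zero => simp
  | succ m ih =>
    rw [Finset.prod_Icc_succ_top (by omega), ← ih, show 2 * (m + 1) = 2 * m + 1 + 1 by ring,
      Finset.prod_Icc_succ_top (by omega), Finset.prod_Icc_succ_top (by omega), mul_assoc,
      show 2 * m + 1 + 1 - 1 = 2 * m + 1 by omega]

/-- If the square of each node is at most the product of its two children, the root to the power
`2 ^ K` is at most the product of the leaves. -/
lemma pow_root_le_prod_leaves (K : ℕ) (T : ℕ → ℕ → ℝ)
    (h : ∀ k < K, ∀ i ∈ Finset.Icc 1 (2 ^ (K - (k + 1))),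
      T (k + 1) i ^ 2 ≤ T k (2 * i - 1) * T k (2 * i)) :
    T K 1 ^ 2 ^ K ≤ ∏ l ∈ Finset.Icc 1 (2 ^ K), T 0 l := by
  have key : ∀ k ≤ K, ∏ l ∈ Finset.Icc 1 (2 ^ (K - k)), T k l ^ 2 ^ k
      ≤ ∏ l ∈ Finset.Icc 1 (2 ^ K), T 0 l := by
    intro k
    induction k with
    | zero => intro _; simp
    | succ k ih =>
      intro hk
      refine le_trans ?_ (ih (by omega))
      rw [show K - k = (K - (k + 1)) + 1 by omega, pow_succ' 2 (K - (k + 1)), prod_Icc_two_mul]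
      refine Finset.prod_le_prod (fun l _ => ?_) fun l hl => ?_
      · rw [pow_succ' 2 k, pow_mul]; positivity
      · rw [pow_succ' 2 k, pow_mul, ← mul_pow]
        exact pow_le_pow_left₀ (sq_nonneg _) (h k (by omega) l hl) _
  simpa using key K le_rfl

/-- The tree of iterated geometric means of neighbours, with leaves `e` at level `0`. -/
def meanTree (e : ℕ → ℝ) : ℕ → ℕ → ℝ
  | 0, i => e i
  | k + 1, i => √(meanTree e k (2 * i - 1) * meanTree e k (2 * i))

lemma meanTree_nonneg {e : ℕ → ℝ} (he : ∀ i, 0 ≤ e i) (k i : ℕ) : 0 ≤ meanTree e k i := by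
  cases k with
  | zero => exact he i
  | succ k => exact Real.sqrt_nonneg _

lemma meanTree_sq {e : ℕ → ℝ} (he : ∀ i, 0 ≤ e i) (k i : ℕ) :
    meanTree e (k + 1) i ^ 2 = meanTree e k (2 * i - 1) * meanTree e k (2 * i) :=
  Real.sq_sqrt (mul_nonneg (meanTree_nonneg he _ _) (meanTree_nonneg he _ _))

lemma meanTree_root {e : ℕ → ℝ} (he : ∀ i, 0 ≤ e i) (K : ℕ) :
    meanTree e K 1 ^ 2 ^ K = ∏ l ∈ Finset.Icc 1 (2 ^ K), e l := by
  have key : ∀ k ≤ K, ∏ l ∈ Finset.Icc 1 (2 ^ (K - k)), meanTree e k l ^ 2 ^ k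
      = ∏ l ∈ Finset.Icc 1 (2 ^ K), e l := by
    intro k
    induction k with
    | zero => intro _; simp [meanTree]
    | succ k ih =>
      intro hk
      rw [← ih (by omega), show K - k = (K - (k + 1)) + 1 by omega, pow_succ' 2 (K - (k + 1)), prod_Icc_two_mul]
      refine Finset.prod_congr rfl fun l _ => ?_
      rw [pow_succ' 2 k, pow_mul, ← mul_pow, meanTree_sq he]
  simpa using key K le_rfl

/-! ### Eliminating the circuit variables -/

section Conditions

variable {n : ℕ} {𝒜 : Finset (Fin n → ℝ)} {ℬ : Finset (Fin n → ℕ)}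

/-- The binary tree of a circuit: the entries of the slots are the leaves at level `0`, and the
circuit variables `x_{k,i}` are the nodes above. -/
def RedCircuit.tree (r : RedCircuit 𝒜 ℬ) (s : ℕ → Option ↥𝒜) (c : Coeff 𝒜 ℬ)
    (x : r.Var → ℝ) : ℕ → ℕ → ℝ
  | 0, i => r.entry s c x i
  | k + 1, i => r.node x (k + 1) i

/-- The blocks on all levels say uniformly that the square of a node of the tree is at most the
product of its children, and that the children are non-negative. -/
lemma RedCircuit.conditions_iff (hrat : IsRationalSet 𝒜) (r : RedCircuit 𝒜 ℬ)
    (s : ℕ → Option ↥𝒜) (c : Coeff 𝒜 ℬ) (x : r.Var → ℝ) :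
    r.Conditions s c x ↔
      (∀ k < r.depth, ∀ i ∈ Finset.Icc 1 (2 ^ (r.depth - (k + 1))),
        0 ≤ r.tree s c x k (2 * i - 1) ∧ 0 ≤ r.tree s c x k (2 * i) ∧
        r.tree s c x (k + 1) i ^ 2 ≤ r.tree s c x k (2 * i - 1) * r.tree s c x k (2 * i)) ∧
      r.theta * x none ≤ r.tree s c x r.depth 1 ∧ 0 ≤ x none + c r.inner ∧
      (r.IsOdd → ‖c r.inner‖ ≤ x none) := by
  have hroot : r.tree s c x r.depth 1 = r.node x r.depth 1 := by
    obtain ⟨d, hd⟩ := Nat.exists_eq_add_of_le' (r.one_le_depth hrat)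
    rw [hd]; rfl
  rw [hroot]
  constructor
  · intro h
    refine ⟨fun k hk i hi => ?_, sub_nonneg.1 h.root, h.coeff, h.odd⟩
    cases k with
    | zero => exact posSemidef_fin_two.1 (h.bottom_block i hi)
    | succ k =>
      exact posSemidef_fin_two.1 (h.inner_block (k + 1 + 1) (Finset.mem_Icc.2 ⟨by omega, hk⟩) i hi)
  · rintro ⟨h1, h2, h3, h4⟩
    refine ⟨fun k hk i hi => ?_, sub_nonneg.2 h2, h3, h4, fun l hl => ?_⟩
    · obtain ⟨hk2, hkd⟩ := Finset.mem_Icc.1 hk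
      obtain ⟨j, rfl⟩ := Nat.exists_eq_add_of_le' hk2
      exact posSemidef_fin_two.2 (h1 (j + 1) hkd i hi)
    · exact posSemidef_fin_two.2 (h1 0 (r.one_le_depth hrat) l hl)

/-- A product over the slots depends only on the multiplicities of the symbols. -/
lemma RedCircuit.IsArrangement.prod_eq {r : RedCircuit 𝒜 ℬ} {s : ℕ → Option ↥𝒜}
    (hs : r.IsArrangement s) (g : Option ↥𝒜 → ℝ) :
    ∏ q ∈ Finset.Icc 1 (2 ^ r.depth), g (s q)
      = g none ^ (2 ^ r.depth - r.den) * ∏ a, g (some a) ^ r.num a := by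
  classical
  rw [← Finset.prod_fiberwise', Fintype.prod_option]
  simp only [Finset.prod_const]
  congr 1
  · rw [← hs.2]
  · refine Finset.prod_congr rfl fun a _ => ?_
    rw [← hs.1 a]

lemma RedCircuit.IsArrangement.mem_outer (hrat : IsRationalSet 𝒜) {r : RedCircuit 𝒜 ℬ}
    {s : ℕ → Option ↥𝒜} (hs : r.IsArrangement s) {q : ℕ}
    (hq : q ∈ Finset.Icc 1 (2 ^ r.depth)) {a : ↥𝒜} (ha : s q = some a) : a ∈ r.outer := by
  classical
  by_contra hc
  have h := hs.1 a
  rw [r.num_eq_zero hrat hc, Finset.card_eq_zero] at h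
  have : q ∈ (∅ : Finset ℕ) := by rw [← h]; exact Finset.mem_filter.2 ⟨hq, ha⟩
  simp at this

lemma RedCircuit.IsArrangement.exists_slot (hrat : IsRationalSet 𝒜) {r : RedCircuit 𝒜 ℬ}
    {s : ℕ → Option ↥𝒜} (hs : r.IsArrangement s) {a : ↥𝒜} (ha : a ∈ r.outer) :
    ∃ q ∈ Finset.Icc 1 (2 ^ r.depth), s q = some a := by
  classical
  have h := r.num_pos hrat ha
  rw [← hs.1 a, Finset.card_pos] at h
  obtain ⟨q, hq⟩ := h
  exact ⟨q, (Finset.mem_filter.1 hq).1, (Finset.mem_filter.1 hq).2⟩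

/-- The weighted geometric mean `∏ c_α ^ λ_α` of the outer coefficients of a circuit. -/
def RedCircuit.geomMean (r : RedCircuit 𝒜 ℬ) (c : Coeff 𝒜 ℬ) : ℝ :=
  ∏ a ∈ r.outer, c (Sum.inl a) ^ r.bary a

/-- The outer coefficients are non-negative, and the inner coefficient is bounded by the circuit
number `∏ (c_α / λ_α) ^ λ_α`, in absolute value if the circuit is odd. The bounds are stated
after multiplication with `∏ λ_α ^ λ_α`. -/
def RedCircuit.IsBounded (r : RedCircuit 𝒜 ℬ) (c : Coeff 𝒜 ℬ) : Prop :=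
  (∀ a ∈ r.outer, 0 ≤ c (Sum.inl a)) ∧ r.theta * (-c r.inner) ≤ r.geomMean c ∧
    (r.IsOdd → r.theta * |c r.inner| ≤ r.geomMean c)

lemma RedCircuit.geomMean_nonneg (r : RedCircuit 𝒜 ℬ) {c : Coeff 𝒜 ℬ}
    (hc : ∀ a ∈ r.outer, 0 ≤ c (Sum.inl a)) : 0 ≤ r.geomMean c :=
  Finset.prod_nonneg fun a ha => Real.rpow_nonneg (hc a ha) _

lemma RedCircuit.geomMean_pow_den (hrat : IsRationalSet 𝒜) (r : RedCircuit 𝒜 ℬ) {c : Coeff 𝒜 ℬ}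
    (hc : ∀ a ∈ r.outer, 0 ≤ c (Sum.inl a)) :
    r.geomMean c ^ r.den = ∏ a, c (Sum.inl a) ^ r.num a := by
  rw [RedCircuit.geomMean, ← Finset.prod_pow]
  rw [← Finset.prod_subset (Finset.subset_univ r.outer)
    fun a _ ha => by rw [r.num_eq_zero hrat ha, pow_zero]]
  refine Finset.prod_congr rfl fun a ha => ?_
  rw [← Real.rpow_natCast, ← Real.rpow_natCast, ← Real.rpow_mul (hc a ha), r.num_eq hrat]

/-- Eliminating the circuit variables from the second-order conditions leaves the bound by the
circuit number. -/
theorem RedCircuit.exists_conditions_iff (hrat : IsRationalSet 𝒜) (r : RedCircuit 𝒜 ℬ)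
    {s : ℕ → Option ↥𝒜} (hs : r.IsArrangement s) (c : Coeff 𝒜 ℬ) :
    (∃ x, r.Conditions s c x) ↔ r.IsBounded c := by
  have hθ := r.theta_pos
  have hK := r.one_le_depth hrat
  have hpow : 2 ^ r.depth = 2 * 2 ^ (r.depth - 1) := by
    rw [← pow_succ', Nat.sub_add_cancel hK]
  constructor
  · rintro ⟨x, hx⟩
    rw [r.conditions_iff hrat] at hx
    obtain ⟨h1, h2, h3, h4⟩ := hx
    have hleaf : ∀ q ∈ Finset.Icc 1 (2 ^ r.depth), 0 ≤ r.entry s c x q := by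
      intro q hq
      rw [Finset.mem_Icc] at hq
      obtain ⟨l, hl | hl⟩ := Nat.even_or_odd' q
      · have := (h1 0 hK l (Finset.mem_Icc.2 ⟨by omega, by simp only [zero_add]; omega⟩)).2.1
        rw [hl]; exact this
      · have := (h1 0 hK (l + 1) (Finset.mem_Icc.2 ⟨by omega, by simp only [zero_add]; omega⟩)).1
        rw [show 2 * (l + 1) - 1 = q by omega] at this
        exact this
    have hc : ∀ a ∈ r.outer, 0 ≤ c (Sum.inl a) := by
      intro a ha
      obtain ⟨q, hq, hqa⟩ := hs.exists_slot hrat ha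
      have := hleaf q hq
      rwa [RedCircuit.entry, hqa] at this
    have hG := r.geomMean_nonneg hc
    have key : r.theta * x none ≤ r.geomMean c := by
      rcases le_or_gt (x none) 0 with hX | hX
      · exact (mul_nonpos_of_nonneg_of_nonpos hθ.le hX).trans hG
      · have hpos := mul_pos hθ hX
        -- the slots with the symbol `Θ x_β` contribute a power that cancels against the root
        have h5 : (r.theta * x none) ^ 2 ^ r.depth ≤
            (r.theta * x none) ^ (2 ^ r.depth - r.den) * r.geomMean c ^ r.den := by
          calc _ ≤ r.tree s c x r.depth 1 ^ 2 ^ r.depth := pow_le_pow_left₀ hpos.le h2 _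
            _ ≤ ∏ l ∈ Finset.Icc 1 (2 ^ r.depth), r.tree s c x 0 l :=
              pow_root_le_prod_leaves _ _ fun k hk i hi => (h1 k hk i hi).2.2
            _ = _ := by
              rw [r.geomMean_pow_den hrat hc]
              exact hs.prod_eq fun o => match o with
                | some a => c (Sum.inl a)
                | none => r.theta * x none
        rw [← Nat.sub_add_cancel r.den_le, pow_add, Nat.add_sub_cancel] at h5
        have h6 := le_of_mul_le_mul_left h5 (pow_pos hpos _)
        exact le_of_pow_le_pow_left₀ (r.den_spec hrat).1.ne' hG h6
    refine ⟨hc, le_trans (mul_le_mul_of_nonneg_left (by linarith) hθ.le) key, fun ho => ?_⟩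
    exact le_trans (mul_le_mul_of_nonneg_left (h4 ho) hθ.le) key
  · rintro ⟨hc, h1, h2⟩
    have hG := r.geomMean_nonneg hc
    let g : Option ↥𝒜 → ℝ := fun o => match o with
      | some a => c (Sum.inl a)
      | none => r.geomMean c
    -- witness: `x_β` is the geometric mean over `Θ`, so that all geometric means in the tree are
    -- attained; the absolute value only affects slots outside of `1, …, 2 ^ K`
    let e : ℕ → ℝ := fun q => |g (s q)|
    have he0 : ∀ q, 0 ≤ e q := fun q => abs_nonneg _
    let x : r.Var → ℝ := fun v => match v with
      | none => r.geomMean c / r.theta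
      | some p => meanTree e p.1.1 p.1.2
    have hx : r.theta * x none = r.geomMean c := mul_div_cancel₀ _ hθ.ne'
    have he : ∀ q ∈ Finset.Icc 1 (2 ^ r.depth), g (s q) = e q := by
      intro q hq
      refine (abs_of_nonneg ?_).symm
      rcases hsq : s q with _ | a
      · exact hG
      · exact hc a (hs.mem_outer hrat hq hsq)
    have htree : ∀ k ≤ r.depth, ∀ i ∈ Finset.Icc 1 (2 ^ (r.depth - k)),
        r.tree s c x k i = meanTree e k i := by
      intro k hk i hi
      cases k with
      | zero =>
        change r.entry s c x i = e i
        rw [← he i hi, RedCircuit.entry]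
        rcases s i with _ | a
        · exact hx
        · rfl
      | succ k =>
        change r.node x (k + 1) i = _
        rw [RedCircuit.node, dif_pos (show (⟨k + 1, i⟩ : Σ _ : ℕ, ℕ) ∈ treeIdx 1 r.depth from
          Finset.mem_sigma.2 ⟨Finset.mem_Icc.2 ⟨Nat.le_add_left 1 k, hk⟩, hi⟩)]
    refine ⟨x, (r.conditions_iff hrat _ _ _).2 ⟨fun k hk i hi => ?_, ?_, ?_, fun ho => ?_⟩⟩
    · have hi' := Finset.mem_Icc.1 hi
      have h2k : 2 ^ (r.depth - k) = 2 * 2 ^ (r.depth - (k + 1)) := by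
        rw [← pow_succ']
        exact congrArg _ (by omega)
      rw [htree (k + 1) hk i hi, htree k hk.le (2 * i - 1) (Finset.mem_Icc.2 (by omega)),
        htree k hk.le (2 * i) (Finset.mem_Icc.2 (by omega))]
      exact ⟨meanTree_nonneg he0 _ _, meanTree_nonneg he0 _ _, (meanTree_sq he0 _ _).le⟩
    · rw [htree _ le_rfl 1 (by simp), hx]
      refine le_of_pow_le_pow_left₀ (n := 2 ^ r.depth) (by positivity)
        (meanTree_nonneg he0 _ _) ?_
      rw [meanTree_root he0, ← Finset.prod_congr rfl he, hs.prod_eq g]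
      change _ ≤ r.geomMean c ^ _ * ∏ a, c (Sum.inl a) ^ r.num a
      rw [← r.geomMean_pow_den hrat hc, ← pow_add, Nat.sub_add_cancel r.den_le]
    · have : r.theta * (-c r.inner) ≤ r.theta * x none := by rw [hx]; exact h1
      have := le_of_mul_le_mul_left this hθ
      linarith
    · have : r.theta * |c r.inner| ≤ r.theta * x none := by rw [hx]; exact h2 ho
      exact le_of_mul_le_mul_left this hθ

end Conditions

/-! ### Evaluation of the functions -/

section Evaluation

variable {n : ℕ} {𝒜 : Finset (Fin n → ℝ)} {ℬ : Finset (Fin n → ℕ)}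

/-- The function `|x|^α` or `x^β` that belongs to an index (a real number even where `|x|^α` is
infinite). -/
def monom (x : Fin n → ℝ) : ↥𝒜 ⊕ ↥ℬ → ℝ
  | Sum.inl a => ∏ j, |x j| ^ ((a : Fin n → ℝ) j)
  | Sum.inr b => ∏ j, x j ^ ((b : Fin n → ℕ) j)

lemma sFun_of_infinite {c : Coeff 𝒜 ℬ} {x : Fin n → ℝ}
    (h : ∃ a : ↥𝒜, c (Sum.inl a) ≠ 0 ∧ InfiniteAt (a : Fin n → ℝ) x) : sFun c x = ⊤ := if_pos h

lemma sFun_of_finite {c : Coeff 𝒜 ℬ} {x : Fin n → ℝ}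
    (h : ¬∃ a : ↥𝒜, c (Sum.inl a) ≠ 0 ∧ InfiniteAt (a : Fin n → ℝ) x) :
    sFun c x = ((∑ i, c i * monom x i : ℝ) : WithTop ℝ) := by
  rw [Fintype.sum_sum_type]
  exact if_neg h

lemma sFun_of_ne_zero (c : Coeff 𝒜 ℬ) {x : Fin n → ℝ} (hx : ∀ j, x j ≠ 0) :
    sFun c x = ((∑ i, c i * monom x i : ℝ) : WithTop ℝ) :=
  sFun_of_finite fun ⟨_, _, j, hj, _⟩ => hx j hj

lemma abs_monom (x : Fin n → ℝ) (i : ↥𝒜 ⊕ ↥ℬ) : |monom x i| = ∏ j, |x j| ^ expo i j := by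
  rcases i with a | b
  · rw [monom, Finset.abs_prod]
    exact Finset.prod_congr rfl fun j _ => abs_of_nonneg (Real.rpow_nonneg (abs_nonneg _) _)
  · rw [monom, Finset.abs_prod]
    refine Finset.prod_congr rfl fun j _ => ?_
    rw [abs_pow, expo, natVec, Real.rpow_natCast]

lemma monom_inl_nonneg (x : Fin n → ℝ) (a : ↥𝒜) : 0 ≤ monom (ℬ := ℬ) x (Sum.inl a) :=
  Finset.prod_nonneg fun _ _ => Real.rpow_nonneg (abs_nonneg _) _

lemma prod_exp_rpow (a w : Fin n → ℝ) : ∏ j, Real.exp (w j) ^ a j = Real.exp (a ⬝ᵥ w) := by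
  simp only [← Real.exp_mul, dotProduct, ← Real.exp_sum, mul_comm]

lemma monom_exp (w : Fin n → ℝ) (i : ↥𝒜 ⊕ ↥ℬ) :
    monom (fun j => Real.exp (w j)) i = Real.exp (expo i ⬝ᵥ w) := by
  rw [← prod_exp_rpow]
  rcases i with a | b
  · simp [monom, expo]
  · simp [monom, expo, natVec]

/-- Flipping the sign of a coordinate in which `b` is odd changes the sign of `x^b`. -/
lemma exists_monom_eq_neg (b : ↥ℬ) (hb : ∃ j, ¬ Even ((b : Fin n → ℕ) j)) (w : Fin n → ℝ) :
    ∃ x : Fin n → ℝ, (∀ j, x j ≠ 0) ∧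
      (∀ a : ↥𝒜, monom (ℬ := ℬ) x (Sum.inl a) = Real.exp ((a : Fin n → ℝ) ⬝ᵥ w)) ∧
      monom (𝒜 := 𝒜) x (Sum.inr b) = -Real.exp (natVec b ⬝ᵥ w) := by
  classical
  obtain ⟨j₀, hj⟩ := hb
  refine ⟨fun j => if j = j₀ then -Real.exp (w j) else Real.exp (w j), fun j => ?_, fun a => ?_, ?_⟩
  · dsimp only; split_ifs
    · exact neg_ne_zero.2 (Real.exp_ne_zero _)
    · exact Real.exp_ne_zero _
  · rw [← prod_exp_rpow, monom]
    refine Finset.prod_congr rfl fun j _ => ?_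
    split_ifs <;> simp
  · rw [← prod_exp_rpow, monom, ← Finset.mul_prod_erase _ _ (Finset.mem_univ j₀),
      ← Finset.mul_prod_erase (Finset.univ) (fun j => Real.exp (w j) ^ natVec (b : Fin n → ℕ) j)
        (Finset.mem_univ j₀), if_pos rfl, (Nat.not_even_iff_odd.1 hj).neg_pow, neg_mul]
    congr 2
    · simp [natVec]
    · refine Finset.prod_congr rfl fun j hj => ?_
      rw [if_neg (Finset.ne_of_mem_erase hj)]; simp [natVec]

lemma expo_injective (hdisj : ∀ b ∈ ℬ, natVec b ∉ 𝒜) :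
    Function.Injective (expo : ↥𝒜 ⊕ ↥ℬ → Fin n → ℝ) := by
  rintro (a | b) (a' | b') h
  · exact congrArg _ (Subtype.ext h)
  · exact absurd a.2 (by rw [show (a : Fin n → ℝ) = natVec b' from h]; exact hdisj _ b'.2)
  · exact absurd a'.2 (by rw [show (a' : Fin n → ℝ) = natVec b from h.symm]; exact hdisj _ b.2)
  · refine congrArg _ (Subtype.ext ?_)
    funext j
    have : natVec (b : Fin n → ℕ) j = natVec (b' : Fin n → ℕ) j := congrFun h j
    simp only [natVec] at this
    exact_mod_cast this

/-- The character `w ↦ exp ⟨a, w⟩` of the additive group `ℝⁿ`. -/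
def expChar (a : Fin n → ℝ) : Multiplicative (Fin n → ℝ) →* ℝ where
  toFun w := Real.exp (a ⬝ᵥ w.toAdd)
  map_one' := by simp
  map_mul' v w := by simp [dotProduct_add, Real.exp_add]

lemma expChar_injective : Function.Injective (expChar : (Fin n → ℝ) → _) := by
  intro a b h
  funext j
  have := DFunLike.congr_fun h (Multiplicative.ofAdd (Pi.single j 1))
  simpa [expChar] using this

/-- The coefficient vector is determined by the function, since distinct exponentials are linearly
independent. -/
lemma sFun_injective (hdisj : ∀ b ∈ ℬ, natVec b ∉ 𝒜) :
    Function.Injective (sFun : Coeff 𝒜 ℬ → _) := by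
  intro c c' h
  have hli : LinearIndependent ℝ (fun i : ↥𝒜 ⊕ ↥ℬ =>
      (expChar (expo i) : Multiplicative (Fin n → ℝ) → ℝ)) :=
    (linearIndependent_monoidHom (Multiplicative (Fin n → ℝ)) ℝ).comp
      (fun i : ↥𝒜 ⊕ ↥ℬ => expChar (expo i)) (expChar_injective.comp (expo_injective hdisj))
  rw [Fintype.linearIndependent_iff] at hli
  have := hli (c - c') (by
    funext w
    have hw := congrFun h (fun j => Real.exp (w.toAdd j))
    rw [sFun_of_ne_zero _ fun j => Real.exp_ne_zero _,
      sFun_of_ne_zero _ fun j => Real.exp_ne_zero _, WithTop.coe_inj] at hw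
    simp only [monom_exp] at hw
    simp only [Finset.sum_apply, Pi.smul_apply, Pi.sub_apply, smul_eq_mul, sub_mul,
      Finset.sum_sub_distrib, Pi.zero_apply]
    exact sub_eq_zero.2 hw)
  funext i
  exact sub_eq_zero.1 (this i)

lemma mem_sCone_iff (hdisj : ∀ b ∈ ℬ, natVec b ∉ 𝒜) (c : Coeff 𝒜 ℬ) :
    sFun c ∈ sCone 𝒜 ℬ ↔ c ∈ sConeCoeff 𝒜 ℬ :=
  (sFun_injective hdisj).mem_set_image

lemma RedCircuit.Supports.sum_eq {r : RedCircuit 𝒜 ℬ} {c : Coeff 𝒜 ℬ} (hc : r.Supports c)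
    (g : ↥𝒜 ⊕ ↥ℬ → ℝ) :
    ∑ i, c i * g i = ∑ a ∈ r.outer, c (Sum.inl a) * g (Sum.inl a) + c r.inner * g r.inner := by
  classical
  have hni : r.inner ∉ r.outer.map (Function.Embedding.inl : ↥𝒜 ↪ ↥𝒜 ⊕ ↥ℬ) := by
    rw [Finset.mem_map]
    rintro ⟨a, ha, h⟩
    exact r.inner_ne ha h
  rw [← Finset.sum_subset (Finset.subset_univ
    (insert r.inner (r.outer.map (Function.Embedding.inl : ↥𝒜 ↪ ↥𝒜 ⊕ ↥ℬ))))]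
  · rw [Finset.sum_insert hni, Finset.sum_map, add_comm]; rfl
  · intro t _ ht
    rw [Finset.mem_insert, Finset.mem_map, not_or] at ht
    rw [hc t (fun a ha h => ht.2 ⟨a, ha, h.symm⟩) ht.1, zero_mul]

/-- On points where the outer functions are finite, `|x|^β` is their weighted geometric mean. -/
lemma RedCircuit.prod_rpow_bary (r : RedCircuit 𝒜 ℬ) {x : Fin n → ℝ}
    (hx : ∀ a ∈ r.outer, ¬InfiniteAt (a : Fin n → ℝ) x) :
    ∏ a ∈ r.outer, monom (ℬ := ℬ) x (Sum.inl a) ^ r.bary a = |monom x r.inner| := by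
  rw [abs_monom]
  simp only [monom]
  simp_rw [← Real.finsetProd_rpow _ _ (fun j _ => Real.rpow_nonneg (abs_nonneg (x j)) _)]
  rw [Finset.prod_comm]
  refine Finset.prod_congr rfl fun j _ => ?_
  have hj := congrFun r.isBarycentric_bary.2.2.2 j
  simp only [Finset.sum_apply, Pi.smul_apply, smul_eq_mul] at hj
  simp_rw [← Real.rpow_mul (abs_nonneg (x j)), ← hj]
  have hcomm : ∑ a ∈ r.outer, r.bary a * (a : Fin n → ℝ) j
      = ∑ a ∈ r.outer, (a : Fin n → ℝ) j * r.bary a :=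
    Finset.sum_congr rfl fun _ _ => mul_comm _ _
  rw [hcomm]
  by_cases h0 : x j = 0
  · rw [Real.rpow_sum_of_nonneg (abs_nonneg _)]
    intro a ha
    refine mul_nonneg ?_ (r.bary_pos ha).le
    by_contra hneg
    exact hx a ha ⟨j, h0, not_le.1 hneg⟩
  · rw [Real.rpow_sum_of_pos (abs_pos.2 h0)]

/-- The inequality of weighted arithmetic and geometric means for the terms of a circuit. -/
lemma RedCircuit.geomMean_mul_le (r : RedCircuit 𝒜 ℬ) {c : Coeff 𝒜 ℬ}
    (hc : ∀ a ∈ r.outer, 0 ≤ c (Sum.inl a)) {x : Fin n → ℝ}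
    (hx : ∀ a ∈ r.outer, ¬InfiniteAt (a : Fin n → ℝ) x) :
    r.geomMean c * |monom x r.inner| ≤
      r.theta * ∑ a ∈ r.outer, c (Sum.inl a) * monom (ℬ := ℬ) x (Sum.inl a) := by
  have h := Real.geom_mean_le_arith_mean_weighted r.outer r.bary
    (fun a => c (Sum.inl a) * monom (ℬ := ℬ) x (Sum.inl a) / r.bary a)
    (fun a ha => (r.bary_pos ha).le) r.sum_bary
    (fun a ha => div_nonneg (mul_nonneg (hc a ha) (monom_inl_nonneg x a)) (r.bary_pos ha).le)
  have h1 : ∑ a ∈ r.outer, r.bary a * (c (Sum.inl a) * monom (ℬ := ℬ) x (Sum.inl a) / r.bary a)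
      = ∑ a ∈ r.outer, c (Sum.inl a) * monom (ℬ := ℬ) x (Sum.inl a) :=
    Finset.sum_congr rfl fun a ha => mul_div_cancel₀ _ (r.bary_pos ha).ne'
  rw [h1] at h
  refine le_trans (le_of_eq ?_) (mul_le_mul_of_nonneg_left h r.theta_pos.le)
  rw [← r.prod_rpow_bary hx, RedCircuit.geomMean, RedCircuit.theta, ← Finset.prod_mul_distrib,
    ← Finset.prod_mul_distrib]
  refine Finset.prod_congr rfl fun a ha => ?_
  have hb := r.bary_pos ha
  rw [Real.div_rpow (mul_nonneg (hc a ha) (monom_inl_nonneg x a)) hb.le,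
    Real.mul_rpow (hc a ha) (monom_inl_nonneg x a), mul_div_cancel₀]
  exact (Real.rpow_pos_of_pos hb _).ne'

theorem RedCircuit.IsBounded.sFun_nonneg {r : RedCircuit 𝒜 ℬ} {c : Coeff 𝒜 ℬ}
    (h : r.IsBounded c) (hc : r.Supports c) (x : Fin n → ℝ) : 0 ≤ sFun c x := by
  by_cases hinf : ∃ a : ↥𝒜, c (Sum.inl a) ≠ 0 ∧ InfiniteAt (a : Fin n → ℝ) x
  · rw [sFun_of_infinite hinf]; exact le_top
  rw [sFun_of_finite hinf, hc.sum_eq]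
  have hS : 0 ≤ ∑ a ∈ r.outer, c (Sum.inl a) * monom (ℬ := ℬ) x (Sum.inl a) :=
    Finset.sum_nonneg fun a ha => mul_nonneg (h.1 a ha) (monom_inl_nonneg x a)
  -- a positive bound on the inner coefficient forces all outer coefficients to be nonzero
  have key : ∀ K : ℝ, r.theta * K ≤ r.geomMean c →
      K * |monom x r.inner| ≤ ∑ a ∈ r.outer, c (Sum.inl a) * monom (ℬ := ℬ) x (Sum.inl a) := by
    intro K hK
    rcases le_or_gt K 0 with hK0 | hK0
    · exact (mul_nonpos_of_nonpos_of_nonneg hK0 (abs_nonneg _)).trans hS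
    · have hG : 0 < r.geomMean c := (mul_pos r.theta_pos hK0).trans_le hK
      have hx : ∀ a ∈ r.outer, ¬InfiniteAt (a : Fin n → ℝ) x := by
        intro a ha hia
        refine hinf ⟨a, fun h0 => hG.ne' ?_, hia⟩
        exact Finset.prod_eq_zero ha (by rw [h0, Real.zero_rpow (r.bary_pos ha).ne'])
      have h1 := r.geomMean_mul_le h.1 hx
      have h2 := mul_le_mul_of_nonneg_right hK (abs_nonneg (monom x r.inner))
      rw [mul_assoc] at h2
      exact le_of_mul_le_mul_left (h2.trans h1) r.theta_pos
  rw [← WithTop.coe_zero, WithTop.coe_le_coe]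
  rcases hi : r.inner with β | b
  · have h1 := key _ h.2.1
    rw [hi, abs_of_nonneg (monom_inl_nonneg x β)] at h1
    linarith
  · have h1 := key _ (h.2.2 ⟨b, hi⟩)
    rw [hi, ← abs_mul] at h1
    linarith [neg_abs_le (c (Sum.inr b) * monom (𝒜 := 𝒜) x (Sum.inr b))]

end Evaluation

/-! ### Approximate minimizers of sums of exponentials -/

section Exponentials

variable {n : ℕ} {ι : Type*} [Fintype ι]

/-- The minimizer of a sum of exponentials with a quadratic regularization, and the vanishing of
the gradient there. -/
lemma exists_regularized_minimizer (b : ι → Fin n → ℝ) (c : ι → ℝ) (hc : ∀ i, 0 ≤ c i)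
    {ε : ℝ} (hε : 0 < ε) :
    ∃ w : Fin n → ℝ, ∑ i, c i * Real.exp (b i ⬝ᵥ w) ≤ ∑ i, c i ∧
      ∀ j, (∑ i, c i * Real.exp (b i ⬝ᵥ w) * b i j) ^ 2 ≤ 4 * ε * ∑ i, c i := by
  classical
  -- `F` is coercive; at its minimizer `ε |w|² ≤ F 0 = ∑ c`, and the gradient of the sum is `-2 ε w`
  let F : (Fin n → ℝ) → ℝ := fun w => ∑ i, c i * Real.exp (b i ⬝ᵥ w) + ε * (w ⬝ᵥ w)
  have hF : Continuous F := by
    have h1 : ∀ i, Continuous fun w : Fin n → ℝ => b i ⬝ᵥ w := fun i =>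
      continuous_const.dotProduct continuous_id
    have h2 : Continuous fun w : Fin n → ℝ => w ⬝ᵥ w := continuous_id.dotProduct continuous_id
    fun_prop
  have hF0 : F 0 = ∑ i, c i := by simp [F]
  have hg : ∀ w, 0 ≤ ∑ i, c i * Real.exp (b i ⬝ᵥ w) := fun w =>
    Finset.sum_nonneg fun i _ => mul_nonneg (hc i) (Real.exp_pos _).le
  have hG : 0 ≤ ∑ i, c i := Finset.sum_nonneg fun i _ => hc i
  have hsq : ∀ (w : Fin n → ℝ) j, w j ^ 2 ≤ w ⬝ᵥ w := fun w j => by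
    rw [sq]
    exact Finset.single_le_sum (f := fun j => w j * w j) (fun j _ => mul_self_nonneg _)
      (Finset.mem_univ j)
  obtain ⟨w, hw⟩ := hF.exists_forall_le' 0 (by
    filter_upwards [(tendsto_norm_cocompact_atTop (E := Fin n → ℝ)).eventually
      (Filter.eventually_gt_atTop √((∑ i, c i) / ε))] with w hw
    rw [hF0]
    have : (∑ i, c i) / ε ≤ w ⬝ᵥ w := by
      by_contra! hlt
      refine absurd hw (not_lt.2 ((pi_norm_le_iff_of_nonneg (Real.sqrt_nonneg _)).2 fun j => ?_))
      rw [Real.norm_eq_abs]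
      exact Real.abs_le_sqrt ((hsq w j).trans hlt.le)
    rw [div_le_iff₀' hε] at this
    have := hg w
    simp only [F]; linarith)
  have hw0 := hw 0
  rw [hF0] at hw0
  have hww : 0 ≤ w ⬝ᵥ w := Finset.sum_nonneg fun j _ => mul_self_nonneg _
  refine ⟨w, by simp only [F] at hw0; nlinarith [mul_nonneg hε.le hww], fun j => ?_⟩
  have hline : ∀ s : ℝ, F (w + s • Pi.single j 1)
      = ∑ i, c i * Real.exp (b i ⬝ᵥ w + s * b i j) + ε * (w ⬝ᵥ w + 2 * s * w j + s ^ 2) := by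
    intro s
    simp only [F, dotProduct_add, add_dotProduct, dotProduct_smul, smul_dotProduct,
      dotProduct_single, single_dotProduct, Pi.add_apply, Pi.smul_apply, smul_eq_mul, Pi.single_eq_same, mul_one,
      one_mul]
    ring
  have hder : HasDerivAt (fun s : ℝ => F (w + s • Pi.single j 1))
      (∑ i, c i * (Real.exp (b i ⬝ᵥ w) * b i j) + ε * (2 * w j)) 0 := by
    simp_rw [hline]
    refine HasDerivAt.add (HasDerivAt.fun_sum fun i _ => HasDerivAt.const_mul _ ?_)
      (HasDerivAt.const_mul _ ?_)
    · have h1 : HasDerivAt (fun s : ℝ => b i ⬝ᵥ w + s * b i j) (b i j) 0 := by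
        simpa using ((hasDerivAt_id (0 : ℝ)).mul_const (b i j)).const_add (b i ⬝ᵥ w)
      simpa using h1.exp
    · have h1 : HasDerivAt (fun s : ℝ => 2 * s * w j) (2 * w j) 0 := by
        simpa using ((hasDerivAt_id (0 : ℝ)).const_mul 2).mul_const (w j)
      have h2 : HasDerivAt (fun s : ℝ => s ^ 2) 0 0 := by
        simpa using hasDerivAt_pow 2 (0 : ℝ)
      simpa using (h1.const_add (w ⬝ᵥ w)).fun_add h2
  have hmin : IsLocalMin (fun s : ℝ => F (w + s • Pi.single j 1)) 0 :=
    Filter.Eventually.of_forall fun s => by simpa using hw _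
  have h0 := hmin.hasDerivAt_eq_zero hder
  simp only [← mul_assoc] at h0
  have h1 : ∑ i, c i * Real.exp (b i ⬝ᵥ w) * b i j = -(2 * ε * w j) := by linarith
  rw [h1]
  have h2 : ε * w j ^ 2 ≤ ∑ i, c i := by
    refine (mul_le_mul_of_nonneg_left (hsq w j) hε.le).trans ?_
    have := hg w
    simp only [F] at hw0; linarith
  nlinarith [mul_le_mul_of_nonneg_left h2 hε.le]

/-- A lower bound `t` of a sum of exponentials has a certificate `u`: a balanced vector of total
weight at least `t`, which on its support is the vector of terms at a common point `w`.  It is a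
limit of the vectors of terms along approximate minimizers; the terms that tend to zero leave the
support. -/
theorem exists_balanced_certificate (b : ι → Fin n → ℝ) (c : ι → ℝ) (hc : ∀ i, 0 ≤ c i) {t : ℝ}
    (ht : ∀ w, t ≤ ∑ i, c i * Real.exp (b i ⬝ᵥ w)) :
    ∃ (u : ι → ℝ) (w : Fin n → ℝ), (∀ i, 0 ≤ u i) ∧ ∑ i, u i • b i = 0 ∧ t ≤ ∑ i, u i ∧
      ∀ i, u i = 0 ∨ u i = c i * Real.exp (b i ⬝ᵥ w) := by
  classical
  choose w hw1 hw2 using fun m : ℕ =>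
    exists_regularized_minimizer b c hc (ε := 1 / ((m : ℝ) + 1)) (by positivity)
  let v : ℕ → ι → ℝ := fun m i => c i * Real.exp (b i ⬝ᵥ w m)
  have hv0 : ∀ m i, 0 ≤ v m i := fun m i => mul_nonneg (hc i) (Real.exp_pos _).le
  have hvmem : ∀ m, v m ∈ Set.Icc (0 : ι → ℝ) (fun _ => ∑ i, c i) := fun m =>
    ⟨hv0 m, fun i => (Finset.single_le_sum (fun i _ => hv0 m i) (Finset.mem_univ i)).trans (hw1 m)⟩
  obtain ⟨u, hu, φ, hφ, hlim⟩ := isCompact_Icc.tendsto_subseq hvmem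
  have hlimi : ∀ i, Filter.Tendsto (fun m => v (φ m) i) Filter.atTop (nhds (u i)) := fun i =>
    (tendsto_pi_nhds.1 hlim) i
  have hbal : ∑ i, u i • b i = 0 := by
    funext j
    have h1 : Filter.Tendsto (fun m => (∑ i, v (φ m) i * b i j) ^ 2) Filter.atTop
        (nhds ((∑ i, u i * b i j) ^ 2)) :=
      (tendsto_finsetSum _ fun i _ => (hlimi i).mul_const _).pow 2
    have h2 : Filter.Tendsto (fun m => 4 * (1 / ((φ m : ℝ) + 1)) * ∑ i, c i) Filter.atTop
        (nhds (4 * 0 * ∑ i, c i)) :=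
      ((tendsto_one_div_add_atTop_nhds_zero_nat.comp hφ.tendsto_atTop).const_mul 4).mul_const _
    have h3 := le_of_tendsto_of_tendsto' h1 h2 fun m => hw2 (φ m) j
    have h4 : (∑ i, u i * b i j) = 0 := by
      have : (∑ i, u i * b i j) ^ 2 = 0 := le_antisymm (by simpa using h3) (sq_nonneg _)
      exact pow_eq_zero_iff (two_ne_zero) |>.1 this
    simpa [Finset.sum_apply] using h4
  have htu : t ≤ ∑ i, u i :=
    ge_of_tendsto' (tendsto_finsetSum _ fun i _ => hlimi i) fun m => ht _
  -- the exponents on the support converge, and stay in the range of a linear map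
  let Λ : (Fin n → ℝ) →ₗ[ℝ] ({i // u i ≠ 0} → ℝ) :=
    { toFun := fun w i => b i ⬝ᵥ w
      map_add' := fun x y => by funext i; simp [dotProduct_add]
      map_smul' := fun s x => by funext i; simp [dotProduct_smul] }
  have hc0 : ∀ i, u i ≠ 0 → c i ≠ 0 := by
    intro i hi h0
    refine hi (tendsto_nhds_unique (hlimi i) ?_)
    simp only [v, h0, zero_mul]
    exact tendsto_const_nhds
  have hΛ : Filter.Tendsto (fun m => Λ (w (φ m))) Filter.atTop
      (nhds fun i => Real.log (u i / c i)) := by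
    refine tendsto_pi_nhds.2 fun i => ?_
    have h1 : Filter.Tendsto (fun m => Real.log (v (φ m) i / c i)) Filter.atTop
        (nhds (Real.log (u i / c i))) :=
      ((hlimi i).div_const _).log (div_ne_zero i.2 (hc0 i i.2))
    refine h1.congr fun m => ?_
    simp only [v]
    rw [mul_div_cancel_left₀ _ (hc0 i i.2), Real.log_exp]; rfl
  have hmem : (fun i : {i // u i ≠ 0} => Real.log (u i / c i)) ∈ (LinearMap.range Λ : Set _) :=
    (Submodule.closed_of_finiteDimensional (LinearMap.range Λ)).mem_of_tendsto hΛ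
      (Filter.Eventually.of_forall fun m => ⟨_, rfl⟩)
  obtain ⟨w', hw'⟩ := hmem
  refine ⟨u, w', hu.1, hbal, htu, fun i => ?_⟩
  by_cases hi : u i = 0
  · exact Or.inl hi
  · right
    have h1 : b i ⬝ᵥ w' = Real.log (u i / c i) := congrFun hw' ⟨i, hi⟩
    have hci := (hc i).lt_of_ne (hc0 i hi).symm
    have hui := (hu.1 i).lt_of_ne (Ne.symm hi)
    rw [h1, Real.exp_log (div_pos hui hci), mul_div_cancel₀ _ hci.ne']

end Exponentials

/-! ### Decomposition of balanced vectors into reduced circuits -/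

section Circuits

variable {n : ℕ} {𝒜 : Finset (Fin n → ℝ)} {ℬ : Finset (Fin n → ℕ)}

open Classical in
/-- The vector `∑ u_α e_α - (∑ u_α) e_i`, the coefficient vector of a weighted inequality of means
that is tight at the all-ones vector if `u` is balanced at the exponent of `i`. -/
def balVec (u : ↥𝒜 → ℝ) (i : ↥𝒜 ⊕ ↥ℬ) : Coeff 𝒜 ℬ := Sum.elim u 0 - Pi.single i (∑ a, u a)

/-- The weighted mean of `𝒜` with weights `u` is the point `y`. -/
def IsBalanced (u : ↥𝒜 → ℝ) (y : Fin n → ℝ) : Prop :=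
  ∑ a, u a • ((a : Fin n → ℝ) - y) = 0

lemma balVec_add (u v : ↥𝒜 → ℝ) (i : ↥𝒜 ⊕ ↥ℬ) :
    balVec (u + v) i = balVec u i + balVec v i := by
  classical
  funext t
  rcases t with a | b <;>
  simp only [balVec, Pi.add_apply, Pi.sub_apply, Sum.elim_inl, Sum.elim_inr, Pi.zero_apply,
    Finset.sum_add_distrib, Pi.single_apply] <;> split_ifs <;> ring

lemma balVec_smul (τ : ℝ) (u : ↥𝒜 → ℝ) (i : ↥𝒜 ⊕ ↥ℬ) :
    balVec (τ • u) i = τ • balVec u i := by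
  classical
  funext t
  rcases t with a | b <;>
  simp only [balVec, Pi.smul_apply, Pi.sub_apply, Sum.elim_inl, Sum.elim_inr, Pi.zero_apply,
    Pi.single_apply, smul_eq_mul, ← Finset.mul_sum] <;> split_ifs <;> ring

lemma IsBarycentric.sum_univ {A : Finset ↥𝒜} {y : Fin n → ℝ} {l : ↥𝒜 → ℝ}
    (hl : IsBarycentric A y l) : ∑ a, l a = 1 := by
  rw [← hl.2.2.1]
  exact (Finset.sum_subset (Finset.subset_univ _) fun a _ ha => hl.2.1 a ha).symm

lemma IsBarycentric.sum_univ_smul {A : Finset ↥𝒜} {y : Fin n → ℝ} {l : ↥𝒜 → ℝ}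
    (hl : IsBarycentric A y l) : ∑ a, l a • (a : Fin n → ℝ) = y := by
  rw [← hl.2.2.2]
  exact (Finset.sum_subset (Finset.subset_univ _)
    fun a _ ha => by rw [hl.2.1 a ha, zero_smul]).symm

lemma isBalanced_iff {u : ↥𝒜 → ℝ} {y : Fin n → ℝ} :
    IsBalanced u y ↔ ∑ a, u a • (a : Fin n → ℝ) = (∑ a, u a) • y := by
  simp only [IsBalanced, smul_sub, Finset.sum_sub_distrib, ← Finset.sum_smul, sub_eq_zero]

lemma IsBarycentric.isBalanced {A : Finset ↥𝒜} {y : Fin n → ℝ} {l : ↥𝒜 → ℝ}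
    (hl : IsBarycentric A y l) : IsBalanced l y := by
  rw [isBalanced_iff, hl.sum_univ, hl.sum_univ_smul, one_smul]

variable (𝒜 ℬ) in
/-- All circuits, reduced or not, whose inner exponent is not one of the outer ones. -/
abbrev Circ : Type :=
  {r : Finset ↥𝒜 × (↥𝒜 ⊕ ↥ℬ) // AffineIndependent ℝ (fun a : ↥r.1 => ((a : ↥𝒜) : Fin n → ℝ)) ∧
    (∃ l, IsBarycentric r.1 (expo r.2) l ∧ ∀ a ∈ r.1, 0 < l a) ∧ expo r.2 ∉ pts r.1}

instance : Fintype (Circ 𝒜 ℬ) := Fintype.ofFinite _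

/-- The barycentric coordinates of a circuit. -/
def Circ.bary (r : Circ 𝒜 ℬ) : ↥𝒜 → ℝ := r.2.2.1.choose

lemma Circ.isBarycentric_bary (r : Circ 𝒜 ℬ) : IsBarycentric r.1.1 (expo r.1.2) r.bary :=
  r.2.2.1.choose_spec.1

lemma Circ.bary_pos (r : Circ 𝒜 ℬ) {a : ↥𝒜} (ha : a ∈ r.1.1) : 0 < r.bary a :=
  r.2.2.1.choose_spec.2 a ha

/-- The coefficient vector `∑ λ_α e_α - e_β` of a circuit. -/
def Circ.vec (r : Circ 𝒜 ℬ) : Coeff 𝒜 ℬ := balVec r.bary r.1.2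

/-- Carathéodory's theorem for points of `𝒜`. -/
lemma exists_affineIndependent_barycentric {S : Finset ↥𝒜} {y : Fin n → ℝ}
    (hy : y ∈ convexHull ℝ (pts S)) :
    ∃ A ⊆ S, AffineIndependent ℝ (fun a : ↥A => ((a : ↥𝒜) : Fin n → ℝ)) ∧
      ∃ l, IsBarycentric A y l ∧ ∀ a ∈ A, 0 < l a := by
  classical
  obtain ⟨ι, _, z, w, hz, hzi, hw, hw1, hwy⟩ := eq_pos_convex_span_of_mem_convexHull hy
  choose f hfS hf using fun i => hz (Set.mem_range_self i)
  have hfz : (fun i => ((f i : ↥𝒜) : Fin n → ℝ)) = z := funext hf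
  have hinj : Function.Injective f := fun i j h => hzi.injective (by rw [← hf i, ← hf j, h])
  have hl : ∀ i, (∑ j, if f j = f i then w j else 0) = w i := fun i => by
    simp [hinj.eq_iff]
  refine ⟨Finset.univ.image f, ?_, ?_, fun a => ∑ j, if f j = a then w j else 0,
    ⟨fun a => Finset.sum_nonneg fun j _ => ?_, fun a ha => Finset.sum_eq_zero fun j _ => ?_,
      ?_, ?_⟩, ?_⟩
  · intro a ha
    obtain ⟨i, -, rfl⟩ := Finset.mem_image.1 ha
    exact hfS i
  · have hmem : ∀ a : ↥(Finset.univ.image f), ∃ i, f i = a := fun a => by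
      obtain ⟨i, -, hi⟩ := Finset.mem_image.1 a.2
      exact ⟨i, hi⟩
    choose g hg using hmem
    have hginj : Function.Injective g := fun a b h => Subtype.ext (by rw [← hg a, ← hg b, h])
    have := hzi.comp_embedding ⟨g, hginj⟩
    have hfg : (z ∘ ⇑(⟨g, hginj⟩ : ↥(Finset.univ.image f) ↪ ι))
        = fun a : ↥(Finset.univ.image f) => ((a : ↥𝒜) : Fin n → ℝ) := by
      funext a
      change z (g a) = _
      rw [← hf, hg]
    rwa [hfg] at this
  · split_ifs
    · exact (hw j).le
    · exact le_rfl
  · rw [if_neg]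
    rintro rfl
    exact ha (Finset.mem_image_of_mem _ (Finset.mem_univ j))
  · rw [Finset.sum_image hinj.injOn]
    simp only [hl, hw1]
  · rw [Finset.sum_image hinj.injOn]
    simp only [hl, hf, hwy]
  · intro a ha
    obtain ⟨i, -, rfl⟩ := Finset.mem_image.1 ha
    exact (hw i).trans_eq (hl i).symm

/-- A balanced vector is a conic combination of circuit vectors with the same inner exponent, by
induction on the size of its support. -/
lemma exists_circ_decomposition (i : ↥𝒜 ⊕ ↥ℬ) (u : ↥𝒜 → ℝ) (hu : ∀ a, 0 ≤ u a)
    (hi : ∀ a : ↥𝒜, (a : Fin n → ℝ) = expo i → u a = 0) (hb : IsBalanced u (expo i)) :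
    ∃ s : Circ 𝒜 ℬ → ℝ, (∀ r, 0 ≤ s r) ∧ ∑ r, s r • r.vec = balVec u i ∧
      ∑ r, s r = ∑ a, u a := by
  classical
  induction hN : (Finset.univ.filter fun a => u a ≠ 0).card using Nat.strong_induction_on
    generalizing u with
  | _ N ih =>
  by_cases hu0 : u = 0
  · subst hu0
    refine ⟨0, fun _ => le_rfl, ?_, by simp⟩
    have := balVec_smul 0 (0 : ↥𝒜 → ℝ) i
    simp only [zero_smul] at this
    simp [this]
  set S := Finset.univ.filter fun a => u a ≠ 0
  have hT : 0 < ∑ a, u a := by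
    refine (Finset.sum_nonneg fun a _ => hu a).lt_of_ne fun h => hu0 ?_
    funext a
    exact (Finset.sum_eq_zero_iff_of_nonneg fun a _ => hu a).1 h.symm a (Finset.mem_univ a)
  have hS : ∀ a ∉ S, u a = 0 := fun a ha => by
    by_contra h; exact ha (Finset.mem_filter.2 ⟨Finset.mem_univ _, h⟩)
  have hmem : expo i ∈ convexHull ℝ (pts S) := by
    refine mem_convexHull_pts.2 ⟨fun a => (∑ a, u a)⁻¹ * u a,
      fun a => mul_nonneg (inv_nonneg.2 hT.le) (hu a), fun a ha => by simp only [hS a ha, mul_zero], ?_, ?_⟩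
    · rw [← Finset.mul_sum, Finset.sum_subset (Finset.subset_univ S) fun a _ ha => hS a ha]
      exact inv_mul_cancel₀ hT.ne'
    · simp only [mul_smul]
      rw [← Finset.smul_sum, Finset.sum_subset (Finset.subset_univ S)
        fun a _ ha => by rw [hS a ha, zero_smul], isBalanced_iff.1 hb, smul_smul,
        inv_mul_cancel₀ hT.ne', one_smul]
  obtain ⟨A, hAS, hA, l, hl, hlpos⟩ := exists_affineIndependent_barycentric hmem
  have hnot : expo i ∉ pts A := by
    rintro ⟨a, ha, hai⟩
    exact (Finset.mem_filter.1 (hAS ha)).2 (hi a hai)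
  let r : Circ 𝒜 ℬ := ⟨(A, i), hA, ⟨l, hl, hlpos⟩, hnot⟩
  have hrl : r.bary = l := by
    funext a
    by_cases ha : a ∈ A
    · exact hl.unique hA r.isBarycentric_bary.2.2.1 r.isBarycentric_bary.2.2.2 a ha
    · rw [hl.2.1 a ha, r.isBarycentric_bary.2.1 a ha]
  have hAne : A.Nonempty := by
    rw [Finset.nonempty_iff_ne_empty]
    rintro rfl
    simpa using hl.2.2.1
  -- subtract the largest multiple of the circuit; the exponent `a₀` leaves the support
  obtain ⟨a₀, ha₀, hmin⟩ := Finset.exists_min_image A (fun a => u a / l a) hAne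
  set τ := u a₀ / l a₀
  have hτ : 0 ≤ τ := div_nonneg (hu a₀) (hl.1 a₀)
  have hle : ∀ a, τ * l a ≤ u a := fun a => by
    by_cases ha : a ∈ A
    · have := hmin a ha
      rwa [le_div_iff₀ (hlpos a ha)] at this
    · rw [hl.2.1 a ha, mul_zero]; exact hu a
  have heq : τ * l a₀ = u a₀ := div_mul_cancel₀ _ (hlpos a₀ ha₀).ne'
  set u' : ↥𝒜 → ℝ := fun a => u a - τ * l a
  have hu' : u = u' + τ • l := by
    funext a; simp [u']
  obtain ⟨s, hs0, hs1, hs2⟩ := ih (Finset.univ.filter fun a => u' a ≠ 0).card (by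
      rw [← hN]
      refine Finset.card_lt_card (Finset.ssubset_iff_subset_ne.2 ⟨?_, fun h => ?_⟩)
      · intro a ha
        refine Finset.mem_filter.2 ⟨Finset.mem_univ _, fun h0 => (Finset.mem_filter.1 ha).2 ?_⟩
        have h1 := hle a
        have h2 := mul_nonneg hτ (hl.1 a)
        simp only [u']
        linarith
      · have : a₀ ∈ S := hAS ha₀
        change _ = S at h
        rw [← h] at this
        exact (Finset.mem_filter.1 this).2 (by simp only [u', heq, sub_self]))
    u' (fun a => sub_nonneg.2 (hle a)) (fun a hai => by
      have h1 := hle a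
      have h2 := mul_nonneg hτ (hl.1 a)
      have h3 := hi a hai
      simp only [u']
      linarith)
    (by
      have h1 := hl.isBalanced
      simp only [IsBalanced] at hb h1 ⊢
      simp only [u', sub_smul, Finset.sum_sub_distrib, hb, mul_smul, ← Finset.smul_sum, h1,
        smul_zero, sub_zero]) rfl
  refine ⟨s + Pi.single r τ, fun q => add_nonneg (hs0 q) ?_, ?_, ?_⟩
  · rw [Pi.single_apply]; split_ifs
    · exact hτ
    · exact le_rfl
  · simp only [Pi.add_apply, add_smul, Finset.sum_add_distrib, hs1]
    rw [hu', balVec_add, balVec_smul]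
    congr 1
    rw [Finset.sum_eq_single r (fun q _ hq => by rw [Pi.single_eq_of_ne hq, zero_smul])
      (fun h => absurd (Finset.mem_univ _) h), Pi.single_eq_same, Circ.vec, hrl]
  · simp only [Pi.add_apply, Finset.sum_add_distrib, hs2]
    rw [Finset.sum_pi_single', if_pos (Finset.mem_univ _), hu']
    simp only [Pi.add_apply, Finset.sum_add_distrib, Pi.smul_apply, smul_eq_mul, ← Finset.mul_sum,
      hl.sum_univ, mul_one]

/-- The linear functional `∑ v_i |expo i|²`. -/
def sqMoment : Coeff 𝒜 ℬ →ₗ[ℝ] ℝ where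
  toFun v := ∑ i, v i * (expo i ⬝ᵥ expo i)
  map_add' v w := by simp [add_mul, Finset.sum_add_distrib]
  map_smul' t v := by
    simp only [Pi.smul_apply, smul_eq_mul, mul_assoc, ← Finset.mul_sum, RingHom.id_apply]

/-- Positivity of the functional on circuit vectors is strict convexity of the square of the Euclidean
norm. It bounds the weights in decompositions into circuits. -/
lemma Circ.sqMoment_vec_pos (r : Circ 𝒜 ℬ) : 0 < sqMoment r.vec := by
  classical
  have hb := r.isBarycentric_bary
  have h1 : sqMoment r.vec
      = ∑ a, r.bary a * ((a : Fin n → ℝ) ⬝ᵥ a) - expo r.1.2 ⬝ᵥ expo r.1.2 := by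
    change ∑ i, _ * _ = _
    simp only [Circ.vec, balVec, Pi.sub_apply, sub_mul, Finset.sum_sub_distrib, hb.sum_univ]
    congr 1
    · simp [Fintype.sum_sum_type, expo]
    · simp [Pi.single_apply]
  have h2 : sqMoment r.vec = ∑ a ∈ r.1.1, r.bary a *
      (((a : Fin n → ℝ) - expo r.1.2) ⬝ᵥ ((a : Fin n → ℝ) - expo r.1.2)) := by
    rw [Finset.sum_subset (Finset.subset_univ _) fun a _ ha => by rw [hb.2.1 a ha, zero_mul], h1]
    have h3 : ∑ a, r.bary a * ((a : Fin n → ℝ) ⬝ᵥ expo r.1.2) = expo r.1.2 ⬝ᵥ expo r.1.2 := by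
      conv_rhs => enter [1]; rw [← hb.sum_univ_smul]
      simp only [sum_dotProduct, smul_dotProduct, smul_eq_mul]
    have h4 : ∀ a : ↥𝒜, r.bary a *
        (((a : Fin n → ℝ) - expo r.1.2) ⬝ᵥ ((a : Fin n → ℝ) - expo r.1.2))
        = r.bary a * ((a : Fin n → ℝ) ⬝ᵥ a) - 2 * (r.bary a * ((a : Fin n → ℝ) ⬝ᵥ expo r.1.2))
          + r.bary a * (expo r.1.2 ⬝ᵥ expo r.1.2) := fun a => by
      rw [sub_dotProduct, dotProduct_sub, dotProduct_sub, dotProduct_comm (expo r.1.2) (a : _ → _)]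
      ring
    simp only [h4, Finset.sum_add_distrib, Finset.sum_sub_distrib, ← Finset.mul_sum, h3,
      ← Finset.sum_mul, hb.sum_univ]
    ring
  have hne : r.1.1.Nonempty := by
    rw [Finset.nonempty_iff_ne_empty]
    intro h
    have := hb.2.2.1
    rw [h] at this
    simp at this
  rw [h2]
  refine Finset.sum_pos (fun a ha => mul_pos (r.bary_pos ha) ?_) hne
  have h0 : (a : Fin n → ℝ) - expo r.1.2 ≠ 0 := fun h => r.2.2.2 ⟨a, ha, sub_eq_zero.1 h⟩
  have h5 := Matrix.dotProduct_star_self_pos_iff.2 h0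
  simpa using h5

/-- A circuit that is not reduced splits into circuits of larger total weight: an exponent `δ` in
its convex hull gives `λ - e_β = τ (μ - e_δ) + (λ - τ μ + τ e_δ - e_β)`. -/
lemma Circ.exists_heavier (r : Circ 𝒜 ℬ) {δ : ↥𝒜}
    (hδ : (δ : Fin n → ℝ) ∈ convexHull ℝ (pts r.1.1)) (hδA : δ ∉ r.1.1)
    (hδβ : (δ : Fin n → ℝ) ≠ expo r.1.2) :
    ∃ s : Circ 𝒜 ℬ → ℝ, (∀ q, 0 ≤ s q) ∧ ∑ q, s q • q.vec = r.vec ∧ 1 < ∑ q, s q := by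
  classical
  obtain ⟨μ, hμ⟩ := mem_convexHull_pts.1 hδ
  have hb := r.isBarycentric_bary
  have hne : r.1.1.Nonempty := by
    rw [Finset.nonempty_iff_ne_empty]
    intro h
    have := hb.2.2.1
    rw [h] at this
    simp at this
  -- with `τ = min λ` the vector `λ - τ μ` stays non-negative; the total weight becomes `1 + τ`
  obtain ⟨a₀, ha₀, hmin⟩ := Finset.exists_min_image r.1.1 r.bary hne
  set τ := r.bary a₀
  have hτ : 0 < τ := r.bary_pos ha₀
  have hμ1 : ∀ a, μ a ≤ 1 := fun a => by
    rw [← hμ.sum_univ]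
    exact Finset.single_le_sum (fun a _ => hμ.1 a) (Finset.mem_univ a)
  have hle : ∀ a, τ * μ a ≤ r.bary a := fun a => by
    by_cases ha : a ∈ r.1.1
    · exact (mul_le_of_le_one_right hτ.le (hμ1 a)).trans (hmin a ha)
    · rw [hμ.2.1 a ha, mul_zero]; exact hb.1 a
  obtain ⟨s₁, h10, h11, h12⟩ := exists_circ_decomposition (ℬ := ℬ) (Sum.inl δ) μ hμ.1
    (fun a ha => hμ.2.1 a fun h => hδA (by rwa [Subtype.ext ha] at h)) hμ.isBalanced
  set v : ↥𝒜 → ℝ := fun a => r.bary a - τ * μ a + if a = δ then τ else 0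
  have hvsum : ∑ a, v a = 1 := by
    simp only [v, Finset.sum_add_distrib, Finset.sum_sub_distrib, ← Finset.mul_sum, hb.sum_univ,
      hμ.sum_univ, Finset.sum_ite_eq', Finset.mem_univ, if_true]
    ring
  obtain ⟨s₂, h20, h21, h22⟩ := exists_circ_decomposition r.1.2 v
    (fun a => add_nonneg (sub_nonneg.2 (hle a)) (by split_ifs <;> [exact hτ.le; exact le_rfl]))
    (fun a ha => by
      have haA : a ∉ r.1.1 := fun h => r.2.2.2 ⟨a, h, ha⟩
      have haδ : a ≠ δ := by rintro rfl; exact hδβ ha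
      simp [v, hb.2.1 a haA, hμ.2.1 a haA, haδ])
    (by
      rw [isBalanced_iff, hvsum]
      simp only [v, add_smul, sub_smul, mul_smul, Finset.sum_add_distrib, Finset.sum_sub_distrib,
        ← Finset.smul_sum, hb.sum_univ_smul, hμ.sum_univ_smul, ite_smul, zero_smul,
        Finset.sum_ite_eq', Finset.mem_univ, if_true]
      module)
  refine ⟨τ • s₁ + s₂, fun q => add_nonneg (mul_nonneg hτ.le (h10 q)) (h20 q), ?_, ?_⟩
  · simp only [Pi.add_apply, Pi.smul_apply, add_smul, smul_assoc, Finset.sum_add_distrib,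
      ← Finset.smul_sum, h11, h21]
    funext t
    simp only [Circ.vec, balVec, hvsum, hμ.sum_univ, hb.sum_univ]
    rcases t with a | b
    · by_cases ha : a = δ
      · subst ha; simp [v]; ring
      · simp [v, ha, Pi.single_apply]; ring
    · simp
  · simp only [Pi.add_apply, Pi.smul_apply, smul_eq_mul, Finset.sum_add_distrib, ← Finset.mul_sum,
      h12, h22, hvsum, hμ.sum_univ]
    linarith

/-- A balanced vector is a conic combination of vectors of reduced circuits: a decomposition of
maximal total weight does not use other circuits. -/
theorem exists_reduced_decomposition (i : ↥𝒜 ⊕ ↥ℬ) (u : ↥𝒜 → ℝ) (hu : ∀ a, 0 ≤ u a)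
    (hi : ∀ a : ↥𝒜, (a : Fin n → ℝ) = expo i → u a = 0) (hb : IsBalanced u (expo i)) :
    ∃ s : RedCircuit 𝒜 ℬ → ℝ, (∀ r, 0 ≤ s r) ∧
      ∑ r, s r • balVec r.bary r.inner = balVec u i := by
  classical
  obtain ⟨s₀, h00, h01, -⟩ := exists_circ_decomposition i u hu hi hb
  let Q : Set (Circ 𝒜 ℬ → ℝ) := {s | (∀ r, 0 ≤ s r) ∧ ∑ r, s r • r.vec = balVec u i}
  have hQsub : Q ⊆ Set.Icc 0 (fun r => sqMoment (balVec u i) / sqMoment r.vec) := by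
    rintro s ⟨h1, h2⟩
    refine ⟨h1, fun r => ?_⟩
    rw [le_div_iff₀ r.sqMoment_vec_pos, ← h2, map_sum]
    simp only [map_smul, smul_eq_mul]
    exact Finset.single_le_sum (f := fun r : Circ 𝒜 ℬ => s r * sqMoment r.vec)
      (fun r _ => mul_nonneg (h1 r) r.sqMoment_vec_pos.le) (Finset.mem_univ r)
  have hQclosed : IsClosed Q := by
    refine IsClosed.inter ?_ ?_
    · exact (isClosed_le continuous_const continuous_id :
        IsClosed {s : Circ 𝒜 ℬ → ℝ | 0 ≤ s})
    · exact isClosed_eq (by fun_prop) continuous_const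
  have hQ : IsCompact Q := isCompact_Icc.of_isClosed_subset hQclosed hQsub
  obtain ⟨s, hs, hmax⟩ := hQ.exists_isMaxOn ⟨s₀, h00, h01⟩
    (f := fun s => ∑ r, s r) (by fun_prop)
  have hred : ∀ r, s r ≠ 0 → IsReducedCircuit r.1 := by
    intro r hr
    refine ⟨r.2.1, (mem_intrinsicInterior_pts r.2.1).2 r.2.2.1, r.2.2.2, fun δ hδ => ?_⟩
    by_contra! hc
    obtain ⟨s', h0, h1, h2⟩ := r.exists_heavier hδ hc.1 hc.2
    have hsr : 0 < s r := (hs.1 r).lt_of_ne hr.symm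
    -- replacing the circuit `r` by its splitting increases the total weight
    have hmem : s - Pi.single r (s r) + s r • s' ∈ Q := by
      refine ⟨fun q => add_nonneg ?_ (mul_nonneg hsr.le (h0 q)), ?_⟩
      · by_cases hq : q = r
        · subst hq; simp
        · simp [Pi.single_eq_of_ne hq, hs.1 q]
      · simp only [Pi.add_apply, Pi.sub_apply, Pi.smul_apply, add_smul, sub_smul, smul_assoc,
          Finset.sum_add_distrib, Finset.sum_sub_distrib, ← Finset.smul_sum, h1, hs.2]
        rw [Finset.sum_eq_single r (fun q _ hq => by rw [Pi.single_eq_of_ne hq, zero_smul])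
          (fun h => absurd (Finset.mem_univ _) h), Pi.single_eq_same, sub_add_cancel]
    have hle := hmax hmem
    simp only [Pi.add_apply, Pi.sub_apply, Pi.smul_apply, smul_eq_mul, Finset.sum_add_distrib,
      Finset.sum_sub_distrib, ← Finset.mul_sum, Finset.sum_pi_single', Finset.mem_univ,
      if_true, Set.mem_ofPred_eq] at hle
    nlinarith
  let e : RedCircuit 𝒜 ℬ → Circ 𝒜 ℬ := fun r =>
    ⟨r.1, r.2.1, ⟨r.bary, r.isBarycentric_bary, fun a ha => r.bary_pos ha⟩, r.2.2.2.1⟩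
  refine ⟨fun r => s (e r), fun r => hs.1 _, ?_⟩
  rw [← hs.2]
  refine Fintype.sum_of_injective e (fun r q h => Subtype.ext (congrArg (fun q : Circ 𝒜 ℬ => q.1) h)) _ _
    (fun r hr => ?_) fun r => ?_
  · have : s r = 0 := by
      by_contra h
      exact hr ⟨⟨r.1, hred r h⟩, rfl⟩
    rw [this, zero_smul]
  · rw [Circ.vec, r.bary_eq (e r).isBarycentric_bary]; rfl

end Circuits

/-! ### Non-negative functions as sums over reduced circuits -/

section Decomposition

variable {n : ℕ} {𝒜 : Finset (Fin n → ℝ)} {ℬ : Finset (Fin n → ℕ)}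

/-- `c` is a sum of vectors that satisfy the bounds by the circuit numbers, one for each reduced
circuit, and a non-negative vector on `𝒜`. -/
def HasCircuitDecomposition (c : Coeff 𝒜 ℬ) : Prop :=
  ∃ (C : RedCircuit 𝒜 ℬ → Coeff 𝒜 ℬ) (d : ↥𝒜 → ℝ),
    c = (∑ r, C r) + Sum.elim d 0 ∧ (∀ a, 0 ≤ d a) ∧
      ∀ r : RedCircuit 𝒜 ℬ, r.Supports (C r) ∧ r.IsBounded (C r)

/-- The circuit vectors `λ - e_β`, rescaled by a character and with the inner entry shrunk by a
factor in `[-1, 1]`, satisfy the bound by the circuit number. -/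
lemma RedCircuit.isBounded_rescaled (r : RedCircuit 𝒜 ℬ) {s : ℝ} (hs : 0 ≤ s) (y w : Fin n → ℝ)
    (ρ : ↥𝒜 ⊕ ↥ℬ → ℝ) (hρ : ∀ a, ρ (Sum.inl a) = 1) (hρ1 : ∀ i, |ρ i| ≤ 1) :
    r.Supports (fun t => s * balVec r.bary r.inner t * Real.exp ((y - expo t) ⬝ᵥ w) * ρ t) ∧
    r.IsBounded (fun t => s * balVec r.bary r.inner t * Real.exp ((y - expo t) ⬝ᵥ w) * ρ t) := by
  classical
  have houter : ∀ a ∈ r.outer, balVec r.bary r.inner (Sum.inl a) = r.bary a := fun a ha => by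
    simp [balVec, Pi.single_eq_of_ne (r.inner_ne ha)]
  have hinner : balVec r.bary r.inner r.inner = -1 := by
    rcases hi : r.inner with β | b
    · have : r.bary β = 0 := r.isBarycentric_bary.2.1 β fun h => r.inner_ne h hi.symm
      simp only [balVec, Pi.sub_apply, Sum.elim_inl, Pi.single_eq_same, this, r.sum_univ_bary,
        zero_sub]
    · simp only [balVec, Pi.sub_apply, Sum.elim_inr, Pi.zero_apply, Pi.single_eq_same,
        r.sum_univ_bary, zero_sub]
  set C : Coeff 𝒜 ℬ := fun t => s * balVec r.bary r.inner t * Real.exp ((y - expo t) ⬝ᵥ w) * ρ t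
  have hCo : ∀ a ∈ r.outer,
      C (Sum.inl a) = s * (r.bary a * Real.exp ((y - (a : Fin n → ℝ)) ⬝ᵥ w)) := fun a ha => by
    simp only [C, houter a ha, hρ, mul_one, mul_assoc]; rfl
  have hCi : C r.inner = -(s * Real.exp ((y - expo r.inner) ⬝ᵥ w) * ρ r.inner) := by
    simp only [C, hinner]; ring
  have hexp : ∏ a ∈ r.outer, Real.exp ((y - (a : Fin n → ℝ)) ⬝ᵥ w) ^ r.bary a
      = Real.exp ((y - expo r.inner) ⬝ᵥ w) := by
    simp only [← Real.exp_mul, ← Real.exp_sum]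
    congr 1
    have hb := r.isBarycentric_bary
    rw [← hb.2.2.2]
    simp only [sub_dotProduct, sum_dotProduct, smul_dotProduct, smul_eq_mul, sub_mul,
      Finset.sum_sub_distrib]
    rw [← Finset.mul_sum, hb.2.2.1, mul_one]
    congr 1
    exact Finset.sum_congr rfl fun _ _ => mul_comm _ _
  have hG : r.geomMean C = r.theta * (s * Real.exp ((y - expo r.inner) ⬝ᵥ w)) := by
    have h1 : r.geomMean C = ∏ a ∈ r.outer, (s ^ r.bary a * (r.bary a ^ r.bary a *
        Real.exp ((y - (a : Fin n → ℝ)) ⬝ᵥ w) ^ r.bary a)) := by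
      refine Finset.prod_congr rfl fun a ha => ?_
      have hp := (r.bary_pos ha).le
      rw [hCo a ha, Real.mul_rpow hs (mul_nonneg hp (Real.exp_pos _).le),
        Real.mul_rpow hp (Real.exp_pos _).le]
    rw [h1, Finset.prod_mul_distrib, Finset.prod_mul_distrib, hexp,
      ← Real.rpow_sum_of_nonneg hs fun a ha => (r.bary_pos ha).le, r.sum_bary, Real.rpow_one,
      RedCircuit.theta]
    ring
  have hE : 0 ≤ s * Real.exp ((y - expo r.inner) ⬝ᵥ w) := mul_nonneg hs (Real.exp_pos _).le
  refine ⟨fun t h1 h2 => ?_, fun a ha => ?_, ?_, fun _ => ?_⟩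
  · have : balVec r.bary r.inner t = 0 := by
      rcases t with a | b
      · have ha : r.bary a = 0 := r.isBarycentric_bary.2.1 a fun h => h1 a h rfl
        simp [balVec, ha, Pi.single_eq_of_ne h2]
      · simp [balVec, Pi.single_eq_of_ne h2]
    simp only [C, this, mul_zero, zero_mul]
  · rw [hCo a ha]
    exact mul_nonneg hs (mul_nonneg (r.bary_pos ha).le (Real.exp_pos _).le)
  · rw [hG, hCi, neg_neg]
    exact mul_le_mul_of_nonneg_left
      (mul_le_of_le_one_right hE ((le_abs_self _).trans (hρ1 _))) r.theta_pos.le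
  · rw [hG, hCi, abs_neg, abs_mul, abs_of_nonneg hE]
    exact mul_le_mul_of_nonneg_left (mul_le_of_le_one_right hE (hρ1 _)) r.theta_pos.le

open Classical in
/-- If the term with the one distinguished exponent is dominated by the others on the positive
orthant, the coefficient vector decomposes into reduced circuits. -/
lemma hasCircuitDecomposition_of_bound (hdisj : ∀ b ∈ ℬ, natVec b ∉ 𝒜) (c : Coeff 𝒜 ℬ)
    (i : ↥𝒜 ⊕ ↥ℬ) (hi0 : c i ≠ 0) (hinl : ∀ a, Sum.inl a ≠ i → 0 ≤ c (Sum.inl a))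
    (hneg : ∀ a, Sum.inl a = i → c i < 0) (hinr : ∀ b, Sum.inr b ≠ i → c (Sum.inr b) = 0)
    (h : ∀ w, |c i| * Real.exp (expo i ⬝ᵥ w) ≤
      ∑ a : ↥𝒜, (if Sum.inl a = i then 0 else c (Sum.inl a)) *
        Real.exp ((a : Fin n → ℝ) ⬝ᵥ w)) :
    HasCircuitDecomposition c := by
  set γ : ↥𝒜 → ℝ := fun a => if Sum.inl a = i then 0 else c (Sum.inl a)
  have hγ : ∀ a, 0 ≤ γ a := fun a => by
    simp only [γ]; split_ifs with ha
    · exact le_rfl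
    · exact hinl a ha
  obtain ⟨u, w, hu, hbal, htu, huw⟩ := exists_balanced_certificate
    (fun a : ↥𝒜 => (a : Fin n → ℝ) - expo i) γ hγ (t := |c i|) (fun w => by
      have h1 := mul_le_mul_of_nonneg_right (h w) (Real.exp_pos (-(expo i ⬝ᵥ w))).le
      rw [mul_assoc, ← Real.exp_add, add_neg_cancel, Real.exp_zero, mul_one, Finset.sum_mul] at h1
      refine h1.trans (le_of_eq (Finset.sum_congr rfl fun a _ => ?_))
      rw [mul_assoc, ← Real.exp_add, sub_dotProduct, sub_eq_add_neg])
  have hui : ∀ a, Sum.inl a = i → u a = 0 := fun a ha => by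
    rcases huw a with h0 | h0
    · exact h0
    · rw [h0]; simp [γ, ha]
  obtain ⟨s, hs0, hs⟩ := exists_reduced_decomposition i u hu
    (fun a ha => hui a (expo_injective hdisj ha)) hbal
  set T := ∑ a, u a
  have hT : 0 < T := (abs_pos.2 hi0).trans_le htu
  -- `T ≥ |c i|` may be too large for the inner coefficient: an odd one is scaled by `ρ`, an even one
  -- is corrected by the non-negative remainder
  let ρ : ↥𝒜 ⊕ ↥ℬ → ℝ := Sum.elim (fun _ => 1) fun b => if Sum.inr b = i then -c i / T else 1
  have hρ1 : ∀ t, |ρ t| ≤ 1 := by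
    rintro (a | b)
    · simp [ρ]
    · simp only [ρ, Sum.elim_inr]
      split_ifs
      · rw [abs_div, abs_neg, abs_of_pos hT]
        exact (div_le_one hT).2 htu
      · simp
  let C : RedCircuit 𝒜 ℬ → Coeff 𝒜 ℬ := fun r t =>
    s r * balVec r.bary r.inner t * Real.exp ((expo i - expo t) ⬝ᵥ w) * ρ t
  have hsum : ∀ t, (∑ r, C r) t = balVec u i t * Real.exp ((expo i - expo t) ⬝ᵥ w) * ρ t := by
    intro t
    rw [← hs]
    simp only [C, Finset.sum_apply, Pi.smul_apply, smul_eq_mul, Finset.sum_mul]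
  refine ⟨C, fun a => c (Sum.inl a) - (∑ r, C r) (Sum.inl a), ?_, fun a => ?_, fun r =>
    r.isBounded_rescaled (hs0 r) _ _ _ (fun a => rfl) hρ1⟩
  · funext t
    rcases t with a | b
    · simp
    · rw [Pi.add_apply, hsum, Sum.elim_inr, Pi.zero_apply, add_zero]
      by_cases hb : Sum.inr b = i
      · subst hb
        simp only [balVec, Pi.sub_apply, Sum.elim_inr, Pi.zero_apply, Pi.single_eq_same, zero_sub,
          sub_self, zero_dotProduct, Real.exp_zero, mul_one, ρ, if_true]
        field_simp
        rfl
      · rw [hinr b hb]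
        simp [balVec, Pi.single_eq_of_ne hb]
  · dsimp only
    rw [hsum]
    simp only [ρ, Sum.elim_inl, mul_one]
    by_cases ha : Sum.inl a = i
    · have h1 := hneg a ha
      subst ha
      rw [abs_of_neg h1] at htu
      simp only [balVec, Pi.sub_apply, Sum.elim_inl, Pi.single_eq_same, hui a rfl, sub_self,
        zero_dotProduct, Real.exp_zero, mul_one]
      linarith
    · have h1 : balVec u i (Sum.inl a) = u a := by
        simp [balVec, Pi.single_eq_of_ne ha]
      rw [h1]
      rcases huw a with h0 | h0
      · rw [h0, zero_mul, sub_zero]; exact hinl a ha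
      · rw [h0, mul_assoc, ← Real.exp_add]
        have h2 : ((a : Fin n → ℝ) - expo i) ⬝ᵥ w + (expo i - expo (Sum.inl a : ↥𝒜 ⊕ ↥ℬ)) ⬝ᵥ w = 0 := by
          rw [← add_dotProduct]
          simp [expo]
        rw [h2, Real.exp_zero, mul_one]
        simp [γ, ha]

lemma RedCircuit.supports_zero (r : RedCircuit 𝒜 ℬ) : r.Supports 0 := fun _ _ _ => rfl

lemma RedCircuit.isBounded_zero (r : RedCircuit 𝒜 ℬ) : r.IsBounded 0 := by
  have h := r.geomMean_nonneg (c := 0) fun _ _ => le_rfl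
  exact ⟨fun _ _ => le_rfl, by simpa using h, fun _ => by simpa using h⟩

lemma hasCircuitDecomposition_of_nonneg (c : Coeff 𝒜 ℬ) (h1 : ∀ a, 0 ≤ c (Sum.inl a))
    (h2 : ∀ b, c (Sum.inr b) = 0) : HasCircuitDecomposition c := by
  refine ⟨0, fun a => c (Sum.inl a), ?_, h1, fun r => ⟨r.supports_zero, r.isBounded_zero⟩⟩
  funext t
  rcases t with a | b
  · simp
  · simp [h2]

/-- A non-negative AG function decomposes into reduced circuits. -/
theorem hasCircuitDecomposition_of_AG (hodd : ∀ b ∈ ℬ, ∃ j, ¬ Even (b j))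
    (hdisj : ∀ b ∈ ℬ, natVec b ∉ 𝒜) (c : Coeff 𝒜 ℬ) (hAG : IsEvenAG c ∨ IsOddAG c)
    (hc : ∀ x, 0 ≤ sFun c x) : HasCircuitDecomposition c := by
  classical
  have hval : ∀ x : Fin n → ℝ, (∀ j, x j ≠ 0) → 0 ≤ ∑ i, c i * monom x i := by
    intro x hx
    have := hc x
    rw [sFun_of_ne_zero c hx] at this
    exact_mod_cast this
  by_cases hpos : (∀ a, 0 ≤ c (Sum.inl a)) ∧ ∀ b, c (Sum.inr b) = 0
  · exact hasCircuitDecomposition_of_nonneg c hpos.1 hpos.2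
  rcases hAG with ⟨h1, h2⟩ | ⟨h1, h2⟩
  · obtain ⟨a₀, ha₀⟩ : ∃ a, c (Sum.inl a) < 0 := by
      by_contra! hcon
      exact hpos ⟨hcon, h2⟩
    refine hasCircuitDecomposition_of_bound hdisj c (Sum.inl a₀) ha₀.ne (fun a ha => ?_)
      (fun a _ => ha₀) (fun b _ => h2 b) fun w => ?_
    · by_contra! hneg
      exact ha (congrArg _ (h1 a a₀ hneg ha₀))
    · have hw := hval (fun j => Real.exp (w j)) fun j => Real.exp_ne_zero _
      simp only [Fintype.sum_sum_type, h2, zero_mul, Finset.sum_const_zero, add_zero,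
        monom_exp] at hw
      rw [← Finset.add_sum_erase _ _ (Finset.mem_univ a₀)] at hw ⊢
      rw [if_pos rfl, zero_mul, zero_add, abs_of_neg ha₀]
      have : ∑ a ∈ Finset.univ.erase a₀,
          (if (Sum.inl a : ↥𝒜 ⊕ ↥ℬ) = Sum.inl a₀ then 0 else c (Sum.inl a)) *
            Real.exp ((a : Fin n → ℝ) ⬝ᵥ w)
          = ∑ a ∈ Finset.univ.erase a₀, c (Sum.inl a) *
            Real.exp (expo (Sum.inl a : ↥𝒜 ⊕ ↥ℬ) ⬝ᵥ w) := by
        refine Finset.sum_congr rfl fun a ha => ?_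
        rw [if_neg fun h => Finset.ne_of_mem_erase ha (Sum.inl_injective h)]; rfl
      rw [this]
      linarith
  · obtain ⟨b₀, hb₀⟩ : ∃ b, c (Sum.inr b) ≠ 0 := by
      by_contra! hcon
      exact hpos ⟨h1, hcon⟩
    have h0 : ∀ b, b ≠ b₀ → c (Sum.inr b) = 0 := fun b hb => by
      by_contra hcb
      exact hb (h2 b b₀ hcb hb₀)
    refine hasCircuitDecomposition_of_bound hdisj c (Sum.inr b₀) hb₀ (fun a _ => h1 a)
      (fun a ha => by simp at ha) (fun b hb => h0 b fun h => hb (congrArg _ h)) fun w => ?_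
    have hsum : ∀ x, ∑ i, c i * monom x i
        = ∑ a, c (Sum.inl a) * monom (ℬ := ℬ) x (Sum.inl a)
          + c (Sum.inr b₀) * monom (𝒜 := 𝒜) x (Sum.inr b₀) := by
      intro x
      rw [Fintype.sum_sum_type]
      congr 1
      exact Finset.sum_eq_single b₀ (fun b _ hb => by rw [h0 b hb, zero_mul])
        (fun h => absurd (Finset.mem_univ _) h)
    simp only [reduceCtorEq, if_false]
    have hw := hval (fun j => Real.exp (w j)) fun j => Real.exp_ne_zero _
    rw [hsum] at hw
    simp only [monom_exp] at hw
    obtain ⟨x, hx0, hxa, hxb⟩ := exists_monom_eq_neg (𝒜 := 𝒜) b₀ (hodd b₀ b₀.2) w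
    have hx := hval x hx0
    rw [hsum, hxb] at hx
    simp only [hxa] at hx
    have e1 : ∀ a : ↥𝒜, expo (Sum.inl a : ↥𝒜 ⊕ ↥ℬ) = a := fun a => rfl
    have e2 : expo (Sum.inr b₀ : ↥𝒜 ⊕ ↥ℬ) = natVec b₀ := rfl
    simp only [e1] at hw
    rw [e2] at hw ⊢
    rcases abs_cases (c (Sum.inr b₀)) with ⟨h, -⟩ | ⟨h, -⟩ <;> rw [h] <;> linarith

/-! ### The second-order description of the cone -/

lemma RedCircuit.node_add (r : RedCircuit 𝒜 ℬ) (x y : r.Var → ℝ) (k i : ℕ) :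
    r.node (x + y) k i = r.node x k i + r.node y k i := by
  unfold RedCircuit.node; split_ifs <;> simp

lemma RedCircuit.node_smul (r : RedCircuit 𝒜 ℬ) (t : ℝ) (x : r.Var → ℝ) (k i : ℕ) :
    r.node (t • x) k i = t * r.node x k i := by
  unfold RedCircuit.node; split_ifs <;> simp

lemma RedCircuit.entry_add (r : RedCircuit 𝒜 ℬ) (s : ℕ → Option ↥𝒜) (c d : Coeff 𝒜 ℬ)
    (x y : r.Var → ℝ) (q : ℕ) :
    r.entry s (c + d) (x + y) q = r.entry s c x q + r.entry s d y q := by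
  unfold RedCircuit.entry; split <;> simp [mul_add]

lemma RedCircuit.entry_smul (r : RedCircuit 𝒜 ℬ) (s : ℕ → Option ↥𝒜) (t : ℝ) (c : Coeff 𝒜 ℬ)
    (x : r.Var → ℝ) (q : ℕ) :
    r.entry s (t • c) (t • x) q = t * r.entry s c x q := by
  unfold RedCircuit.entry; split <;> simp [mul_left_comm]

lemma posSemidef_fin_two_add {a b d a' b' d' : ℝ} (h : (!![a, b; b, d]).PosSemidef)
    (h' : (!![a', b'; b', d']).PosSemidef) :
    (!![a + a', b + b'; b + b', d + d']).PosSemidef := by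
  convert h.add h' using 1
  ext i j; fin_cases i <;> fin_cases j <;> rfl

lemma posSemidef_fin_two_smul {a b d t : ℝ} (ht : 0 ≤ t) (h : (!![a, b; b, d]).PosSemidef) :
    (!![t * a, t * b; t * b, t * d]).PosSemidef := by
  convert h.smul ht using 1
  ext i j; fin_cases i <;> fin_cases j <;> rfl

lemma RedCircuit.Conditions.add {r : RedCircuit 𝒜 ℬ} {s : ℕ → Option ↥𝒜} {c d : Coeff 𝒜 ℬ}
    {x y : r.Var → ℝ} (h : r.Conditions s c x) (h' : r.Conditions s d y) :
    r.Conditions s (c + d) (x + y) where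
  inner_block k hk i hi := by
    simp only [RedCircuit.node_add]
    exact posSemidef_fin_two_add (h.inner_block k hk i hi) (h'.inner_block k hk i hi)
  root := by
    have h1 := h.root; have h2 := h'.root
    rw [RedCircuit.node_add, Pi.add_apply]; linarith
  coeff := by
    have h1 := h.coeff; have h2 := h'.coeff
    simp only [Pi.add_apply]; linarith
  odd ho := (norm_add_le _ _).trans (add_le_add (h.odd ho) (h'.odd ho))
  bottom_block l hl := by
    simp only [RedCircuit.node_add, RedCircuit.entry_add]
    exact posSemidef_fin_two_add (h.bottom_block l hl) (h'.bottom_block l hl)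

lemma RedCircuit.Conditions.smul {r : RedCircuit 𝒜 ℬ} {s : ℕ → Option ↥𝒜} {c : Coeff 𝒜 ℬ}
    {x : r.Var → ℝ} {t : ℝ} (ht : 0 ≤ t) (h : r.Conditions s c x) :
    r.Conditions s (t • c) (t • x) where
  inner_block k hk i hi := by
    simp only [RedCircuit.node_smul]
    exact posSemidef_fin_two_smul ht (h.inner_block k hk i hi)
  root := by
    have h1 := mul_nonneg ht h.root
    rw [RedCircuit.node_smul, Pi.smul_apply, smul_eq_mul]; linarith
  coeff := by
    have h1 := mul_nonneg ht h.coeff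
    simp only [Pi.smul_apply, smul_eq_mul]; linarith
  odd ho := by
    rw [Pi.smul_apply, norm_smul, Real.norm_of_nonneg ht]
    exact mul_le_mul_of_nonneg_left (h.odd ho) ht
  bottom_block l hl := by
    simp only [RedCircuit.node_smul, RedCircuit.entry_smul]
    exact posSemidef_fin_two_smul ht (h.bottom_block l hl)

lemma RedCircuit.Supports.add {r : RedCircuit 𝒜 ℬ} {c d : Coeff 𝒜 ℬ} (hc : r.Supports c)
    (hd : r.Supports d) : r.Supports (c + d) := fun t h1 h2 => by
  rw [Pi.add_apply, hc t h1 h2, hd t h1 h2, add_zero]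

lemma RedCircuit.Supports.smul {r : RedCircuit 𝒜 ℬ} {c : Coeff 𝒜 ℬ} (hc : r.Supports c)
    (t : ℝ) : r.Supports (t • c) := fun i h1 h2 => by
  rw [Pi.smul_apply, hc i h1 h2, smul_zero]

/-- `c` satisfies the second-order description: it is a sum of vectors which together with suitable
circuit variables satisfy the conditions of their circuits, and of a non-negative vector. -/
def HasLift (σ : RedCircuit 𝒜 ℬ → ℕ → Option ↥𝒜) (c : Coeff 𝒜 ℬ) : Prop :=
  ∃ (C : RedCircuit 𝒜 ℬ → Coeff 𝒜 ℬ) (d : ↥𝒜 → ℝ) (x : AllVars 𝒜 ℬ),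
    c = (∑ r, C r) + Sum.elim d 0 ∧ (∀ a, 0 ≤ d a) ∧
    ∀ r : RedCircuit 𝒜 ℬ, r.Supports (C r) ∧ r.Conditions (σ r) (C r) (x r)

lemma hasLift_iff (hrat : IsRationalSet 𝒜) {σ : RedCircuit 𝒜 ℬ → ℕ → Option ↥𝒜}
    (hσ : ∀ r : RedCircuit 𝒜 ℬ, r.IsArrangement (σ r)) (c : Coeff 𝒜 ℬ) :
    HasLift σ c ↔ HasCircuitDecomposition c := by
  constructor
  · rintro ⟨C, d, x, h1, h2, h3⟩
    exact ⟨C, d, h1, h2, fun r =>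
      ⟨(h3 r).1, (r.exists_conditions_iff hrat (hσ r) _).1 ⟨x r, (h3 r).2⟩⟩⟩
  · rintro ⟨C, d, h1, h2, h3⟩
    choose x hx using fun r : RedCircuit 𝒜 ℬ => (r.exists_conditions_iff hrat (hσ r) _).2 (h3 r).2
    exact ⟨C, d, x, h1, h2, fun r => ⟨(h3 r).1, hx r⟩⟩

lemma HasLift.add {σ : RedCircuit 𝒜 ℬ → ℕ → Option ↥𝒜} {c c' : Coeff 𝒜 ℬ}
    (h : HasLift σ c) (h' : HasLift σ c') : HasLift σ (c + c') := by
  obtain ⟨C, d, x, h1, h2, h3⟩ := h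
  obtain ⟨C', d', x', h1', h2', h3'⟩ := h'
  refine ⟨C + C', d + d', x + x', ?_, fun a => add_nonneg (h2 a) (h2' a), fun r =>
    ⟨(h3 r).1.add (h3' r).1, (h3 r).2.add (h3' r).2⟩⟩
  rw [h1, h1']
  simp only [Pi.add_apply, Finset.sum_add_distrib]
  funext t
  rcases t with a | b
  · simp only [Pi.add_apply, Sum.elim_inl]; ring
  · simp only [Pi.add_apply, Sum.elim_inr, Pi.zero_apply]; ring

lemma HasLift.smul {σ : RedCircuit 𝒜 ℬ → ℕ → Option ↥𝒜} {c : Coeff 𝒜 ℬ} {t : ℝ} (ht : 0 ≤ t)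
    (h : HasLift σ c) : HasLift σ (t • c) := by
  obtain ⟨C, d, x, h1, h2, h3⟩ := h
  refine ⟨t • C, t • d, t • x, ?_, fun a => mul_nonneg ht (h2 a), fun r =>
    ⟨(h3 r).1.smul t, (h3 r).2.smul ht⟩⟩
  rw [h1, smul_add, Finset.smul_sum]
  congr 1
  funext i
  rcases i with a | b <;> simp

lemma RedCircuit.IsBounded.mem_sConeCoeff {r : RedCircuit 𝒜 ℬ} {c : Coeff 𝒜 ℬ}
    (h : r.IsBounded c) (hc : r.Supports c) : c ∈ sConeCoeff 𝒜 ℬ := by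
  refine Submodule.subset_span ⟨?_, h.sFun_nonneg hc⟩
  rcases hi : r.inner with β | b
  · left
    have key : ∀ a, c (Sum.inl a) < 0 → a = β := fun a ha => by
      by_contra hne
      by_cases hao : a ∈ r.outer
      · exact absurd (h.1 a hao) (not_le.2 ha)
      · refine ha.ne (hc _ (fun a' ha' h => hao (by rwa [Sum.inl_injective h])) fun h => hne ?_)
        rw [hi] at h; exact Sum.inl_injective h
    refine ⟨fun a a' ha ha' => (key a ha).trans (key a' ha').symm, fun b => ?_⟩
    exact hc _ (fun a _ h => by simp at h) (by simp [hi])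
  · right
    have key : ∀ b', c (Sum.inr b') ≠ 0 → b' = b := fun b' hb' => by
      by_contra hne
      refine hb' (hc _ (fun a _ h => by simp at h) fun h => hne ?_)
      rw [hi] at h; exact Sum.inr_injective h
    refine ⟨fun a => ?_, fun b₁ b₂ h₁ h₂ => (key b₁ h₁).trans (key b₂ h₂).symm⟩
    by_cases hao : a ∈ r.outer
    · exact h.1 a hao
    · exact (hc _ (fun a' ha' h => hao (by rwa [Sum.inl_injective h])) (by simp [hi])).ge

lemma elim_mem_sConeCoeff {d : ↥𝒜 → ℝ} (hd : ∀ a, 0 ≤ d a) :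
    (Sum.elim d 0 : Coeff 𝒜 ℬ) ∈ sConeCoeff 𝒜 ℬ := by
  refine Submodule.subset_span ⟨Or.inl ⟨fun a _ ha => absurd (hd a) (not_le.2 ha), fun b => rfl⟩,
    fun x => ?_⟩
  by_cases hinf : ∃ a : ↥𝒜, (Sum.elim d 0 : Coeff 𝒜 ℬ) (Sum.inl a) ≠ 0 ∧
      InfiniteAt (a : Fin n → ℝ) x
  · rw [sFun_of_infinite hinf]; exact le_top
  · rw [sFun_of_finite hinf, ← WithTop.coe_zero, WithTop.coe_le_coe, Fintype.sum_sum_type]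
    simp only [Sum.elim_inl, Sum.elim_inr, Pi.zero_apply, zero_mul, Finset.sum_const_zero, add_zero]
    exact Finset.sum_nonneg fun a _ => mul_nonneg (hd a) (monom_inl_nonneg x a)

theorem mem_sConeCoeff_iff_hasLift (hodd : ∀ b ∈ ℬ, ∃ j, ¬ Even (b j))
    (hdisj : ∀ b ∈ ℬ, natVec b ∉ 𝒜) (hrat : IsRationalSet 𝒜)
    {σ : RedCircuit 𝒜 ℬ → ℕ → Option ↥𝒜}
    (hσ : ∀ r : RedCircuit 𝒜 ℬ, r.IsArrangement (σ r)) (c : Coeff 𝒜 ℬ) :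
    c ∈ sConeCoeff 𝒜 ℬ ↔ HasLift σ c := by
  constructor
  · intro hc
    refine Submodule.span_induction (p := fun c _ => HasLift σ c) ?_ ?_ ?_ ?_ hc
    · rintro c ⟨h1, h2⟩
      exact (hasLift_iff hrat hσ c).2 (hasCircuitDecomposition_of_AG hodd hdisj c h1 h2)
    · exact (hasLift_iff hrat hσ 0).2
        (hasCircuitDecomposition_of_nonneg 0 (fun _ => le_rfl) fun _ => rfl)
    · exact fun _ _ _ _ h h' => h.add h'
    · exact fun t _ _ h => h.smul t.2
  · intro hc
    obtain ⟨C, d, rfl, hd, h⟩ := (hasLift_iff hrat hσ c).1 hc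
    exact add_mem (sum_mem fun r _ => (h r).2.mem_sConeCoeff (h r).1) (elim_mem_sConeCoeff hd)

end Decomposition

/-! ### The lifted cone -/

open scoped MatrixOrder in
lemma exists_isSymm_mul_self_eq {κ : Type*} [Fintype κ] {A : Matrix κ κ ℝ} (hA : A.PosSemidef) :
    ∃ X : Matrix κ κ ℝ, X.IsSymm ∧ X * X = A := by
  classical
  refine ⟨CFC.sqrt A, ?_, CFC.sqrt_mul_sqrt_self A hA.nonneg⟩
  have := (Matrix.nonneg_iff_posSemidef.1 (CFC.sqrt_nonneg A)).isHermitian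
  rwa [Matrix.IsHermitian, Matrix.conjTranspose_eq_transpose_of_trivial] at this

lemma posSemidef_blockDiagonal'_iff {o : Type*} [Fintype o] [DecidableEq o] {m : o → Type*}
    [∀ t, Fintype (m t)] (M : ∀ t, Matrix (m t) (m t) ℝ) :
    (Matrix.blockDiagonal' M).PosSemidef ↔ ∀ t, (M t).PosSemidef := by
  constructor
  · intro h t
    have := h.submatrix (fun i : m t => (⟨t, i⟩ : Σ t, m t))
    convert this using 1
    ext i j
    rw [Matrix.submatrix_apply, Matrix.blockDiagonal'_apply_eq]
  · intro h
    choose X hX hXX using fun t => exists_isSymm_mul_self_eq (h t)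
    have : Matrix.blockDiagonal' M
        = (Matrix.blockDiagonal' X).conjTranspose * Matrix.blockDiagonal' X := by
      rw [Matrix.blockDiagonal'_conjTranspose, ← Matrix.blockDiagonal'_mul]
      congr 1
      funext t
      rw [Matrix.conjTranspose_eq_transpose_of_trivial, (hX t).eq, hXX]
    rw [this]
    exact Matrix.posSemidef_conjTranspose_mul_self _

lemma posSemidef_fin_one {a : ℝ} : (!![a]).PosSemidef ↔ 0 ≤ a := by
  have : (!![a] : Matrix (Fin 1) (Fin 1) ℝ) = Matrix.diagonal fun _ => a := by
    ext i j; fin_cases i; fin_cases j; rfl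
  rw [this, Matrix.posSemidef_diagonal_iff]
  simp

lemma posSemidef_fin_two_abs {a b : ℝ} : (!![a, b; b, a]).PosSemidef ↔ |b| ≤ a := by
  rw [posSemidef_fin_two, ← sq]
  constructor
  · rintro ⟨h1, -, h2⟩
    exact abs_le_of_sq_le_sq h2 h1
  · intro h
    have h1 := (abs_nonneg b).trans h
    exact ⟨h1, h1, sq_le_sq.2 (by rwa [abs_of_nonneg h1])⟩

section Lifted

variable {n : ℕ} {𝒜 : Finset (Fin n → ℝ)} {ℬ : Finset (Fin n → ℕ)}

lemma RedCircuit.mem_lifted_iff (r : RedCircuit 𝒜 ℬ) (s : ℕ → Option ↥𝒜)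
    (z : Coeff 𝒜 ℬ × AllVars 𝒜 ℬ) :
    z ∈ r.lifted s ↔ r.Supports z.1 ∧ r.Conditions s z.1 (z.2 r) ∧ ∀ r', r' ≠ r → z.2 r' = 0 := by
  have hmat : (r.circuitMatrix s z.1 (z.2 r)).PosSemidef ↔
      ∀ t, (r.block s z.1 (z.2 r) t).PosSemidef := posSemidef_blockDiagonal'_iff _
  constructor
  · rintro ⟨h1, h2, h3, h4⟩
    rw [hmat] at h1
    refine ⟨h3, ⟨fun k hk i hi => ?_, ?_, ?_, fun ho => ?_, fun l hl => ?_⟩, h4⟩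
    · exact h1 (Sum.inl ⟨⟨k, i⟩, Finset.mem_sigma.2 ⟨hk, hi⟩⟩)
    · exact posSemidef_fin_one.1 (h1 (Sum.inr (Sum.inl 0)))
    · exact posSemidef_fin_one.1 (h1 (Sum.inr (Sum.inl 1)))
    · exact posSemidef_fin_two_abs.1 (h2 ho)
    · exact h1 (Sum.inr (Sum.inr ⟨l, hl⟩))
  · rintro ⟨h3, h, h4⟩
    refine ⟨hmat.2 ?_, fun ho => posSemidef_fin_two_abs.2 (h.odd ho), h3, h4⟩
    rintro (⟨⟨k, i⟩, hq⟩ | j | l)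
    · exact h.inner_block k (Finset.mem_sigma.1 hq).1 i (Finset.mem_sigma.1 hq).2
    · fin_cases j
      · exact posSemidef_fin_one.2 h.root
      · exact posSemidef_fin_one.2 h.coeff
    · exact h.bottom_block l l.2

theorem image_fst_liftedCone (σ : RedCircuit 𝒜 ℬ → ℕ → Option ↥𝒜) :
    Prod.fst '' liftedCone σ = {c | HasLift σ c} := by
  classical
  ext c
  constructor
  · rintro ⟨z, hz, rfl⟩
    obtain ⟨z₁, hz₁, z₂, hz₂, rfl⟩ := Set.mem_add.1 hz
    obtain ⟨g, hg, rfl⟩ := (Set.mem_fintype_sum _ _).1 hz₁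
    obtain ⟨h, hh, rfl⟩ := (Set.mem_fintype_sum _ _).1 hz₂
    refine ⟨fun r => (g r).1, fun a => (h a).1 (Sum.inl a), fun r => (g r).2 r, ?_,
      fun a => (hh a).1, fun r => ?_⟩
    · rw [Prod.fst_add, Prod.fst_sum, Prod.fst_sum]
      congr 1
      funext t
      rw [Finset.sum_apply]
      rcases t with a | b
      · rw [Sum.elim_inl]
        exact Finset.sum_eq_single a
          (fun a' _ ha' => (hh a').2.1 _ fun h => ha' (Sum.inl_injective h).symm)
          fun h => absurd (Finset.mem_univ _) h
      · exact Finset.sum_eq_zero fun a _ => (hh a).2.1 _ (by simp)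
    · obtain ⟨h1, h2, -⟩ := (r.mem_lifted_iff _ _).1 (hg r)
      exact ⟨h1, h2⟩
  · rintro ⟨C, d, x, rfl, hd, hC⟩
    refine ⟨∑ r, (C r, Pi.single r (x r)) + ∑ a, (Pi.single (Sum.inl a) (d a), 0),
      Set.add_mem_add ((Set.mem_fintype_sum _ _).2 ⟨_, fun r => ?_, rfl⟩)
        ((Set.mem_fintype_sum _ _).2 ⟨_, fun a => ?_, rfl⟩), ?_⟩
    · refine (r.mem_lifted_iff _ _).2 ⟨(hC r).1, ?_, fun r' hr' => Pi.single_eq_of_ne hr' _⟩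
      dsimp only
      rw [Pi.single_eq_same]
      exact (hC r).2
    · refine ⟨?_, fun t ht => Pi.single_eq_of_ne ht _, rfl⟩
      dsimp only
      rw [Pi.single_eq_same]; exact hd a
    · rw [Prod.fst_add, Prod.fst_sum, Prod.fst_sum]
      congr 1
      funext t
      rw [Finset.sum_apply]
      rcases t with a | b
      · rw [Sum.elim_inl]
        simp only [Pi.single_apply, Sum.inl.injEq]
        simp
      · simp

end Lifted

/-! ### Second-order representability -/

section SecondOrder

variable {V W : Type*} [AddCommGroup V] [Module ℝ V] [AddCommGroup W] [Module ℝ W]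

/-- `P` is a finite conjunction of conditions that a symmetric `2 × 2` matrix with entries linear
in the argument is positive semidefinite. -/
def IsSOCond (P : V → Prop) : Prop :=
  ∃ (J : Type) (_ : Fintype J) (p q r : J → V →ₗ[ℝ] ℝ),
    ∀ v, P v ↔ ∀ j, (!![p j v, q j v; q j v, r j v]).PosSemidef

lemma IsSOCond.posSemidef {p q r : V → ℝ} (hp : IsLinearMap ℝ p) (hq : IsLinearMap ℝ q)
    (hr : IsLinearMap ℝ r) : IsSOCond fun v => (!![p v, q v; q v, r v]).PosSemidef :=
  ⟨Unit, inferInstance, fun _ => hp.mk' p, fun _ => hq.mk' q, fun _ => hr.mk' r, fun v => by simp⟩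

lemma IsSOCond.congr {P Q : V → Prop} (h : ∀ v, Q v ↔ P v) (hP : IsSOCond P) : IsSOCond Q := by
  obtain ⟨J, i, p, q, r, hj⟩ := hP
  exact ⟨J, i, p, q, r, fun v => (h v).trans (hj v)⟩

lemma IsSOCond.forall {K : Type} [Finite K] {P : K → V → Prop} (h : ∀ k, IsSOCond (P k)) :
    IsSOCond fun v => ∀ k, P k v := by
  have := Fintype.ofFinite K
  choose J i p q r hj using h
  refine ⟨Σ k, J k, inferInstance, fun t => p t.1 t.2, fun t => q t.1 t.2, fun t => r t.1 t.2,
    fun v => ?_⟩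
  simp only [hj, Sigma.forall]

lemma IsSOCond.and {P Q : V → Prop} (hP : IsSOCond P) (hQ : IsSOCond Q) :
    IsSOCond fun v => P v ∧ Q v := by
  have : IsSOCond fun v => ∀ b : Bool, (match b with | true => P v | false => Q v) :=
    IsSOCond.forall (P := fun (b : Bool) v => (match b with | true => P v | false => Q v))
      fun b => by cases b <;> assumption
  exact this.congr fun v => by simp [and_comm]

lemma IsSOCond.imp {a : Prop} {P : V → Prop} (h : a → IsSOCond P) : IsSOCond fun v => a → P v := by
  by_cases ha : a
  · exact (h ha).congr fun v => by simp [ha]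
  · exact ⟨Empty, inferInstance, Empty.elim, Empty.elim, Empty.elim, fun v => by simp [ha]⟩

lemma IsSOCond.forall_mem {K : Type} (s : Finset K) {P : K → V → Prop}
    (h : ∀ k ∈ s, IsSOCond (P k)) : IsSOCond fun v => ∀ k ∈ s, P k v :=
  (IsSOCond.forall fun k : ↥s => h k k.2).congr fun v => by simp

lemma IsSOCond.nonneg {p : V → ℝ} (hp : IsLinearMap ℝ p) : IsSOCond fun v => 0 ≤ p v :=
  (IsSOCond.posSemidef hp (0 : V →ₗ[ℝ] ℝ).isLinear hp).congr fun v => by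
    simp [posSemidef_fin_two, mul_self_nonneg]

lemma IsSOCond.eq_zero {p : V → ℝ} (hp : IsLinearMap ℝ p) : IsSOCond fun v => p v = 0 :=
  ((IsSOCond.nonneg hp).and (IsSOCond.nonneg (-hp.mk' p).isLinear)).congr fun v => by
    constructor
    · intro h; simp [h]
    · rintro ⟨h1, h2⟩
      have : 0 ≤ -p v := h2
      linarith

lemma IsSOCond.comp {P : V → Prop} (hP : IsSOCond P) (f : W →ₗ[ℝ] V) :
    IsSOCond fun w => P (f w) := by
  obtain ⟨J, i, p, q, r, hj⟩ := hP
  exact ⟨J, i, fun j => p j ∘ₗ f, fun j => q j ∘ₗ f, fun j => r j ∘ₗ f, fun v => hj _⟩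

/-- A positive semidefinite `2 × 2` condition is a second-order cone condition with a symmetric
matrix, the square root of a Gram matrix. -/
lemma exists_socp_of_posSemidef {κ : Type*} [Fintype κ] (p q r : (κ → ℝ) →ₗ[ℝ] ℝ) :
    ∃ (M : Matrix κ κ ℝ) (c : κ → ℝ), M.IsSymm ∧ ∀ z,
      (!![p z, q z; q z, r z]).PosSemidef ↔ ‖WithLp.toLp 2 (Matrix.mulVec M z + 0)‖ ≤ c ⬝ᵥ z + 0 := by
  classical
  have hlin : ∀ f : (κ → ℝ) →ₗ[ℝ] ℝ, ∃ c : κ → ℝ, ∀ z, f z = c ⬝ᵥ z := fun f =>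
    ⟨fun i => f (Pi.single i 1), fun z => by
      rw [LinearMap.pi_apply_eq_sum_univ f z]
      refine Finset.sum_congr rfl fun i _ => ?_
      rw [smul_eq_mul, mul_comm]
      congr 2
      funext j
      simp [Pi.single_apply, eq_comm]⟩
  -- `‖(2q, p - r)‖ ≤ p + r`, with `M` the square root of the Gram matrix of the two rows
  obtain ⟨g₁, h₁⟩ := hlin ((2 : ℝ) • q)
  obtain ⟨g₂, h₂⟩ := hlin (p - r)
  obtain ⟨c, hc⟩ := hlin (p + r)
  let G : Matrix (Fin 2) κ ℝ := ![g₁, g₂]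
  obtain ⟨M, hM, hMM⟩ := exists_isSymm_mul_self_eq (Matrix.posSemidef_conjTranspose_mul_self G)
  refine ⟨M, c, hM, fun z => ?_⟩
  have hnorm : ‖WithLp.toLp 2 (Matrix.mulVec M z)‖ ^ 2 = (2 * q z) ^ 2 + (p z - r z) ^ 2 := by
    rw [EuclideanSpace.real_norm_sq_eq]
    have e1 : ∑ i, (WithLp.toLp 2 (Matrix.mulVec M z)) i ^ 2
        = Matrix.mulVec M z ⬝ᵥ Matrix.mulVec M z :=
      Finset.sum_congr rfl fun i _ => sq _
    rw [e1, Matrix.dotProduct_mulVec, ← Matrix.mulVec_transpose, hM.eq, Matrix.mulVec_mulVec, hMM,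
      Matrix.conjTranspose_eq_transpose_of_trivial, ← Matrix.mulVec_mulVec,
      Matrix.mulVec_transpose, ← Matrix.dotProduct_mulVec, dotProduct, Fin.sum_univ_two]
    have e2 : Matrix.mulVec G z 0 = 2 * q z := (h₁ z).symm
    have e3 : Matrix.mulVec G z 1 = p z - r z := (h₂ z).symm
    rw [e2, e3]; ring
  have hcz : c ⬝ᵥ z = p z + r z := (hc z).symm
  rw [add_zero, add_zero, hcz, posSemidef_fin_two]
  constructor
  · rintro ⟨hp, hr, hq⟩
    refine le_of_sq_le_sq ?_ (add_nonneg hp hr)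
    rw [hnorm]; nlinarith
  · intro h
    have h0 := (norm_nonneg _).trans h
    have h2 := pow_le_pow_left₀ (norm_nonneg _) h 2
    rw [hnorm] at h2
    have h3 : q z ^ 2 ≤ p z * r z := by nlinarith
    have h4 : 0 ≤ p z * r z := (sq_nonneg _).trans h3
    refine ⟨?_, ?_, h3⟩
    · by_contra! hneg
      nlinarith
    · by_contra! hneg
      nlinarith

/-- Linear images of solution sets of second-order conditions are second-order representable. -/
theorem IsSOCond.isSecondOrderRepresentable {ι : Type} [Fintype ι] [FiniteDimensional ℝ V]
    {P : V → Prop} (hP : IsSOCond P) (L : V →ₗ[ℝ] ι → ℝ) :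
    IsSecondOrderRepresentable (L '' {v | P v}) := by
  classical
  let e := (Module.finBasis ℝ V).equivFun
  set N := Module.finrank ℝ V
  -- the additional variables parametrize `V`; the linear map enters as a system of equations
  let f : (ι ⊕ Fin N → ℝ) →ₗ[ℝ] V := e.symm.toLinearMap ∘ₗ LinearMap.funLeft ℝ ℝ Sum.inr
  have hQ : IsSOCond fun z : ι ⊕ Fin N → ℝ => (∀ i, z (Sum.inl i) - L (f z) i = 0) ∧ P (f z) := by
    refine IsSOCond.and (IsSOCond.forall fun i => ?_) (hP.comp f)
    exact IsSOCond.eq_zero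
      (LinearMap.proj (Sum.inl i) - LinearMap.proj i ∘ₗ L ∘ₗ f : (ι ⊕ Fin N → ℝ) →ₗ[ℝ] ℝ).isLinear
  obtain ⟨J, _, p, q, r, hj⟩ := hQ
  choose M c hM hMc using fun j => exists_socp_of_posSemidef (p j) (q j) (r j)
  let g := (Fintype.equivFin J).symm
  refine ⟨N, Fintype.card J, fun i => M (g i), fun _ => 0, fun i => c (g i), fun _ => 0,
    fun i => hM _, ?_⟩
  have hset : {z : ι ⊕ Fin N → ℝ | ∀ i, ‖WithLp.toLp 2 (Matrix.mulVec (M (g i)) z + 0)‖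
      ≤ c (g i) ⬝ᵥ z + 0} = {z | (∀ i, z (Sum.inl i) - L (f z) i = 0) ∧ P (f z)} := by
    ext z
    refine Iff.trans ?_ (hj z).symm
    rw [Set.mem_ofPred_eq, ← g.forall_congr_right]
    exact forall_congr' fun i => (hMc _ z).symm
  rw [hset]
  ext t
  constructor
  · rintro ⟨v, hv, rfl⟩
    refine ⟨Sum.elim (L v) (e v), ?_, rfl⟩
    have hfv : f (Sum.elim (L v) (e v)) = v := e.symm_apply_apply v
    rw [Set.mem_ofPred_eq, hfv]
    exact ⟨fun i => sub_self _, hv⟩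
  · rintro ⟨z, ⟨hz1, hz2⟩, rfl⟩
    refine ⟨f z, hz2, ?_⟩
    funext i
    exact (sub_eq_zero.1 (hz1 i)).symm

end SecondOrder

section Representable

variable {n : ℕ} {𝒜 : Finset (Fin n → ℝ)} {ℬ : Finset (Fin n → ℕ)}

lemma RedCircuit.node_isLinearMap (r : RedCircuit 𝒜 ℬ) (k i : ℕ) :
    IsLinearMap ℝ fun z : Coeff 𝒜 ℬ × (r.Var → ℝ) => r.node z.2 k i :=
  ⟨fun _ _ => r.node_add _ _ _ _, fun _ _ => r.node_smul _ _ _ _⟩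

lemma RedCircuit.entry_isLinearMap (r : RedCircuit 𝒜 ℬ) (s : ℕ → Option ↥𝒜) (q : ℕ) :
    IsLinearMap ℝ fun z : Coeff 𝒜 ℬ × (r.Var → ℝ) => r.entry s z.1 z.2 q :=
  ⟨fun _ _ => r.entry_add _ _ _ _ _ _, fun _ _ => r.entry_smul _ _ _ _ _⟩

lemma RedCircuit.isSOCond_conditions (r : RedCircuit 𝒜 ℬ) (s : ℕ → Option ↥𝒜) :
    IsSOCond fun z : Coeff 𝒜 ℬ × (r.Var → ℝ) => r.Conditions s z.1 z.2 := by
  have hx : IsLinearMap ℝ fun z : Coeff 𝒜 ℬ × (r.Var → ℝ) => z.2 none :=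
    ⟨fun _ _ => rfl, fun _ _ => rfl⟩
  have hc : IsLinearMap ℝ fun z : Coeff 𝒜 ℬ × (r.Var → ℝ) => z.1 r.inner :=
    ⟨fun _ _ => rfl, fun _ _ => rfl⟩
  have h1 : IsSOCond fun z : Coeff 𝒜 ℬ × (r.Var → ℝ) => ∀ k ∈ Finset.Icc 2 r.depth,
      ∀ i ∈ Finset.Icc 1 (2 ^ (r.depth - k)),
        (!![r.node z.2 (k - 1) (2 * i - 1), r.node z.2 k i;
            r.node z.2 k i, r.node z.2 (k - 1) (2 * i)]).PosSemidef :=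
    IsSOCond.forall_mem _ fun k _ => IsSOCond.forall_mem _ fun i _ =>
      IsSOCond.posSemidef (r.node_isLinearMap _ _) (r.node_isLinearMap _ _)
        (r.node_isLinearMap _ _)
  have h2 : IsSOCond fun z : Coeff 𝒜 ℬ × (r.Var → ℝ) =>
      0 ≤ r.node z.2 r.depth 1 - r.theta * z.2 none :=
    IsSOCond.nonneg ((r.node_isLinearMap _ _).mk' _ - r.theta • hx.mk' _).isLinear
  have h3 : IsSOCond fun z : Coeff 𝒜 ℬ × (r.Var → ℝ) => 0 ≤ z.2 none + z.1 r.inner :=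
    IsSOCond.nonneg (hx.mk' _ + hc.mk' _).isLinear
  have h4 : IsSOCond fun z : Coeff 𝒜 ℬ × (r.Var → ℝ) =>
      r.IsOdd → (!![z.2 none, z.1 r.inner; z.1 r.inner, z.2 none]).PosSemidef :=
    IsSOCond.imp fun _ => IsSOCond.posSemidef hx hc hx
  have h5 : IsSOCond fun z : Coeff 𝒜 ℬ × (r.Var → ℝ) =>
      ∀ l ∈ Finset.Icc 1 (2 ^ (r.depth - 1)),
        (!![r.entry s z.1 z.2 (2 * l - 1), r.node z.2 1 l;
            r.node z.2 1 l, r.entry s z.1 z.2 (2 * l)]).PosSemidef :=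
    IsSOCond.forall_mem _ fun l _ => IsSOCond.posSemidef (r.entry_isLinearMap s _)
      (r.node_isLinearMap _ _) (r.entry_isLinearMap s _)
  refine (h1.and (h2.and (h3.and (h4.and h5)))).congr fun z => ⟨fun h => ?_, fun h => ?_⟩
  · exact ⟨h.inner_block, h.root, h.coeff, fun ho => posSemidef_fin_two_abs.2 (h.odd ho),
      h.bottom_block⟩
  · exact ⟨h.1, h.2.1, h.2.2.1, fun ho => posSemidef_fin_two_abs.1 (h.2.2.2.1 ho), h.2.2.2.2⟩

lemma RedCircuit.isSOCond_supports (r : RedCircuit 𝒜 ℬ) :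
    IsSOCond fun c : Coeff 𝒜 ℬ => r.Supports c :=
  IsSOCond.forall fun t => IsSOCond.imp fun _ => IsSOCond.imp fun _ =>
    IsSOCond.eq_zero (LinearMap.proj t : Coeff 𝒜 ℬ →ₗ[ℝ] ℝ).isLinear

variable (𝒜 ℬ) in
/-- The variables of the second-order description: the vectors of the circuits, the non-negative
vector on `𝒜`, and all circuit variables. -/
abbrev LiftVars : Type := (RedCircuit 𝒜 ℬ → Coeff 𝒜 ℬ) × (↥𝒜 → ℝ) × AllVars 𝒜 ℬ

theorem isSecondOrderRepresentable_of_hasLift (σ : RedCircuit 𝒜 ℬ → ℕ → Option ↥𝒜) {ι : Type}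
    [Fintype ι] (L : Coeff 𝒜 ℬ →ₗ[ℝ] ι → ℝ) :
    IsSecondOrderRepresentable (L '' {c | HasLift σ c}) := by
  let S : LiftVars 𝒜 ℬ →ₗ[ℝ] Coeff 𝒜 ℬ :=
    { toFun := fun v => (∑ r, v.1 r) + Sum.elim v.2.1 0
      map_add' := fun v w => by
        funext t
        rcases t with a | b
        · simp only [Prod.fst_add, Prod.snd_add, Pi.add_apply, Finset.sum_apply,
            Finset.sum_add_distrib, Sum.elim_inl]
          ring
        · simp only [Prod.fst_add, Pi.add_apply, Finset.sum_apply, Finset.sum_add_distrib,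
            Sum.elim_inr, Pi.zero_apply]
          ring
      map_smul' := fun s v => by
        funext t
        rcases t with a | b
        · simp only [Prod.smul_fst, Prod.smul_snd, Pi.add_apply, Pi.smul_apply, Finset.sum_apply,
            Sum.elim_inl, RingHom.id_apply, smul_eq_mul, mul_add, Finset.mul_sum]
        · simp only [Prod.smul_fst, Pi.add_apply, Pi.smul_apply, Finset.sum_apply,
            Sum.elim_inr, RingHom.id_apply, smul_eq_mul, mul_add, Finset.mul_sum, Pi.zero_apply,
            mul_zero] }
  let πC : (r : RedCircuit 𝒜 ℬ) → LiftVars 𝒜 ℬ →ₗ[ℝ] Coeff 𝒜 ℬ := fun r =>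
    LinearMap.proj r ∘ₗ LinearMap.fst ℝ (RedCircuit 𝒜 ℬ → Coeff 𝒜 ℬ) ((↥𝒜 → ℝ) × AllVars 𝒜 ℬ)
  let πx : (r : RedCircuit 𝒜 ℬ) → LiftVars 𝒜 ℬ →ₗ[ℝ] (r.Var → ℝ) := fun r =>
    LinearMap.proj r ∘ₗ LinearMap.snd ℝ (↥𝒜 → ℝ) (AllVars 𝒜 ℬ) ∘ₗ
      LinearMap.snd ℝ (RedCircuit 𝒜 ℬ → Coeff 𝒜 ℬ) ((↥𝒜 → ℝ) × AllVars 𝒜 ℬ)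
  have hP : IsSOCond fun v : LiftVars 𝒜 ℬ => (∀ a, 0 ≤ v.2.1 a) ∧
      ∀ r : RedCircuit 𝒜 ℬ, r.Supports (v.1 r) ∧ r.Conditions (σ r) (v.1 r) (v.2.2 r) := by
    refine IsSOCond.and (IsSOCond.forall fun a => IsSOCond.nonneg ⟨fun _ _ => rfl, fun _ _ => rfl⟩)
      (IsSOCond.forall fun r => IsSOCond.and ?_ ?_)
    · exact r.isSOCond_supports.comp (πC r)
    · exact (r.isSOCond_conditions (σ r)).comp ((πC r).prod (πx r))
  convert hP.isSecondOrderRepresentable (L ∘ₗ S) using 1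
  ext t
  constructor
  · rintro ⟨c, ⟨C, d, x, rfl, hd, h⟩, rfl⟩
    exact ⟨(C, d, x), ⟨hd, h⟩, rfl⟩
  · rintro ⟨⟨C, d, x⟩, ⟨hd, h⟩, rfl⟩
    exact ⟨_, ⟨C, d, x, rfl, hd, h⟩, rfl⟩

end Representable

/-! ### The SONC cone -/

section Sonc

variable {n : ℕ} (𝒮 : Finset (Fin n →₀ ℕ))

open Classical in
/-- The even exponents of a support set, as points of `ℝⁿ`. -/
def evenExps : Finset (Fin n → ℝ) :=
  (𝒮.filter fun e : Fin n →₀ ℕ => ∀ j, Even (e j)).image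
    (fun e : Fin n →₀ ℕ => natVec (e : Fin n → ℕ))

open Classical in
/-- The exponents of a support set with at least one odd entry. -/
def oddExps : Finset (Fin n → ℕ) :=
  (𝒮.filter fun e : Fin n →₀ ℕ => ¬∀ j, Even (e j)).image
    (fun e : Fin n →₀ ℕ => (e : Fin n → ℕ))

lemma natVec_injective : Function.Injective (natVec : (Fin n → ℕ) → Fin n → ℝ) := by
  intro a b h
  funext j
  have := congrFun h j
  simp only [natVec] at this
  exact_mod_cast this

lemma natVec_finsupp_injective :
    Function.Injective fun e : ↥𝒮 => natVec ((e : Fin n →₀ ℕ) : Fin n → ℕ) :=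
  natVec_injective.comp (DFunLike.coe_injective.comp Subtype.val_injective)

lemma not_even_of_mem_oddExps : ∀ b ∈ oddExps 𝒮, ∃ j, ¬ Even (b j) := by
  intro b hb
  obtain ⟨e, he, rfl⟩ := Finset.mem_image.1 hb
  exact not_forall.1 (Finset.mem_filter.1 he).2

lemma natVec_notMem_evenExps : ∀ b ∈ oddExps 𝒮, natVec b ∉ evenExps 𝒮 := by
  intro b hb hmem
  obtain ⟨j, hj⟩ := not_even_of_mem_oddExps 𝒮 b hb
  obtain ⟨e, he, heb⟩ := Finset.mem_image.1 hmem
  rw [← natVec_injective heb] at hj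
  exact hj ((Finset.mem_filter.1 he).2 j)

lemma isRationalSet_evenExps : IsRationalSet (evenExps 𝒮) := by
  intro a ha j
  obtain ⟨e, -, rfl⟩ := Finset.mem_image.1 ha
  exact ⟨(e j : ℚ), by simp [natVec]⟩

lemma exists_sonc_index : ∃ φ : ↥𝒮 ≃ ↥(evenExps 𝒮) ⊕ ↥(oddExps 𝒮),
    (∀ e, expo (φ e) = natVec (e : Fin n →₀ ℕ)) ∧
      ∀ e, (∃ a, φ e = Sum.inl a) ↔ ∀ j, Even ((e : Fin n →₀ ℕ) j) := by
  classical
  let φ : ↥𝒮 → ↥(evenExps 𝒮) ⊕ ↥(oddExps 𝒮) := fun e =>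
    if h : ∀ j, Even ((e : Fin n →₀ ℕ) j) then
      Sum.inl ⟨natVec (e : Fin n →₀ ℕ),
        Finset.mem_image.2 ⟨e, Finset.mem_filter.2 ⟨e.2, h⟩, rfl⟩⟩
    else Sum.inr ⟨(e : Fin n →₀ ℕ),
      Finset.mem_image.2 ⟨e, Finset.mem_filter.2 ⟨e.2, h⟩, rfl⟩⟩
  have hexpo : ∀ e, expo (φ e) = natVec (e : Fin n →₀ ℕ) := by
    intro e
    simp only [φ]
    split_ifs <;> rfl
  have hinj : Function.Injective φ := fun e e' h =>
    natVec_finsupp_injective 𝒮 (by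
      change natVec (e : Fin n →₀ ℕ) = natVec (e' : Fin n →₀ ℕ)
      rw [← hexpo, ← hexpo, h])
  have hsurj : Function.Surjective φ := by
    rintro (⟨a, ha⟩ | ⟨b, hb⟩)
    · obtain ⟨e, he, rfl⟩ := Finset.mem_image.1 ha
      exact ⟨⟨e, (Finset.mem_filter.1 he).1⟩, dif_pos (Finset.mem_filter.1 he).2⟩
    · obtain ⟨e, he, rfl⟩ := Finset.mem_image.1 hb
      exact ⟨⟨e, (Finset.mem_filter.1 he).1⟩, dif_neg (Finset.mem_filter.1 he).2⟩
  refine ⟨Equiv.ofBijective φ ⟨hinj, hsurj⟩, hexpo, fun e => ?_⟩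
  change (∃ a, φ e = Sum.inl a) ↔ _
  simp only [φ]
  split_ifs with h <;> simp [h]

/-- The bijection between a support set and its even and odd parts. -/
def soncIndex : ↥𝒮 ≃ ↥(evenExps 𝒮) ⊕ ↥(oddExps 𝒮) := (exists_sonc_index 𝒮).choose

variable {𝒮}

lemma expo_soncIndex (e : ↥𝒮) : expo (soncIndex 𝒮 e) = natVec (e : Fin n →₀ ℕ) :=
  (exists_sonc_index 𝒮).choose_spec.1 e

lemma even_symm_inl (a : ↥(evenExps 𝒮)) (j : Fin n) :
    Even (((soncIndex 𝒮).symm (Sum.inl a) : Fin n →₀ ℕ) j) :=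
  ((exists_sonc_index 𝒮).choose_spec.2 _).1 ⟨a, (soncIndex 𝒮).apply_symm_apply _⟩ j

lemma not_even_symm_inr (b : ↥(oddExps 𝒮)) :
    ¬∀ j, Even (((soncIndex 𝒮).symm (Sum.inr b) : Fin n →₀ ℕ) j) := fun h => by
  obtain ⟨a, ha⟩ := ((exists_sonc_index 𝒮).choose_spec.2 _).2 h
  have := ((soncIndex 𝒮).apply_symm_apply (Sum.inr b)).symm.trans ha
  simp at this

lemma natVec_symm (t : ↥(evenExps 𝒮) ⊕ ↥(oddExps 𝒮)) :
    natVec ((soncIndex 𝒮).symm t : Fin n →₀ ℕ) = expo t := by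
  rw [← expo_soncIndex, Equiv.apply_symm_apply]

lemma monom_eq_prod_pow (x : Fin n → ℝ) (t : ↥(evenExps 𝒮) ⊕ ↥(oddExps 𝒮)) :
    monom x t = ∏ j, x j ^ ((soncIndex 𝒮).symm t : Fin n →₀ ℕ) j := by
  have h := natVec_symm t
  rcases t with a | b
  · refine Finset.prod_congr rfl fun j _ => ?_
    have hj : ((a : Fin n → ℝ) j) = (((soncIndex 𝒮).symm (Sum.inl a) : Fin n →₀ ℕ) j : ℝ) :=
      (congrFun h j).symm
    rw [hj, Real.rpow_natCast, (even_symm_inl a j).pow_abs]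
  · have hb : (b : Fin n → ℕ) = ((soncIndex 𝒮).symm (Sum.inr b) : Fin n →₀ ℕ) :=
      natVec_injective h.symm
    rw [monom, hb]

lemma eval_polyOf (c : ↥𝒮 → ℝ) (x : Fin n → ℝ) :
    MvPolynomial.eval x (polyOf c) = ∑ e : ↥𝒮, c e * ∏ j, x j ^ (e : Fin n →₀ ℕ) j := by
  rw [polyOf, map_sum]
  refine Finset.sum_congr rfl fun e _ => ?_
  rw [MvPolynomial.eval_monomial, Finsupp.prod_fintype _ _ (fun j => pow_zero _)]

lemma coeff_polyOf (c : ↥𝒮 → ℝ) (e : ↥𝒮) : MvPolynomial.coeff (e : Fin n →₀ ℕ) (polyOf c) = c e := by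
  classical
  rw [polyOf, MvPolynomial.coeff_sum]
  simp only [MvPolynomial.coeff_monomial]
  rw [Finset.sum_eq_single e (fun e' _ he' => if_neg fun h => he' (Subtype.ext h))
    (fun h => absurd (Finset.mem_univ _) h), if_pos rfl]

lemma polyOf_add (c d : ↥𝒮 → ℝ) : polyOf (c + d) = polyOf c + polyOf d := by
  simp [polyOf, Finset.sum_add_distrib]

lemma polyOf_zero : polyOf (0 : ↥𝒮 → ℝ) = 0 := by
  simp [polyOf]

lemma exists_ne_zero_of_mem_support_polyOf {c : ↥𝒮 → ℝ} {e : Fin n →₀ ℕ}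
    (he : e ∈ (polyOf c).support) : ∃ e' : ↥𝒮, (e' : Fin n →₀ ℕ) = e ∧ c e' ≠ 0 := by
  classical
  rw [MvPolynomial.mem_support_iff, polyOf, MvPolynomial.coeff_sum] at he
  obtain ⟨e', -, h⟩ := Finset.exists_ne_zero_of_sum_ne_zero he
  rw [MvPolynomial.coeff_monomial] at h
  by_cases hee : (e' : Fin n →₀ ℕ) = e
  · rw [if_pos hee] at h; exact ⟨e', hee, h⟩
  · rw [if_neg hee] at h; exact absurd rfl h

lemma polyOf_coeff {f : MvPolynomial (Fin n) ℝ} (hf : f.support ⊆ 𝒮) :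
    polyOf (fun e : ↥𝒮 => f.coeff e) = f := by
  rw [polyOf]
  conv_rhs => rw [f.as_sum]
  rw [Finset.sum_coe_sort 𝒮 fun e => MvPolynomial.monomial e (f.coeff e)]
  refine (Finset.sum_subset hf fun e _ he => ?_).symm
  rw [MvPolynomial.notMem_support_iff.1 he, MvPolynomial.monomial_zero]

lemma sFun_comp_symm (c : ↥𝒮 → ℝ) (x : Fin n → ℝ) :
    sFun (c ∘ (soncIndex 𝒮).symm) x = (MvPolynomial.eval x (polyOf c) : ℝ) := by
  rw [sFun_of_finite, eval_polyOf]
  · congr 1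
    rw [← (soncIndex 𝒮).symm.sum_comp]
    simp only [Function.comp_apply, monom_eq_prod_pow]
  · rintro ⟨a, -, j, -, hj⟩
    have h : natVec ((soncIndex 𝒮).symm (Sum.inl a) : Fin n →₀ ℕ) = (a : Fin n → ℝ) :=
      natVec_symm (Sum.inl a)
    rw [← h, natVec] at hj
    exact absurd hj (not_lt.2 (Nat.cast_nonneg _))

/-- The dominant term of a non-negative sum of exponentials has a non-negative coefficient. -/
lemma coeff_nonneg_of_dominant {ι : Type*} [Fintype ι] (c m : ι → ℝ) (i₀ : ι)
    (hm : ∀ i, i ≠ i₀ → c i = 0 ∨ m i < m i₀)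
    (h : ∀ s : ℝ, 0 ≤ ∑ i, c i * Real.exp (s * m i)) : 0 ≤ c i₀ := by
  classical
  have hlim : Filter.Tendsto (fun s : ℝ => ∑ i, c i * Real.exp (s * (m i - m i₀))) Filter.atTop
      (nhds (∑ i, if i = i₀ then c i₀ else 0)) := by
    refine tendsto_finsetSum _ fun i _ => ?_
    by_cases hi : i = i₀
    · subst hi
      simp
    · rw [if_neg hi]
      rcases hm i hi with h0 | hlt
      · simp only [h0, zero_mul]; exact tendsto_const_nhds
      · have h1 : Filter.Tendsto (fun s : ℝ => s * (m i - m i₀)) Filter.atTop Filter.atBot :=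
          Filter.tendsto_id.atTop_mul_const_of_neg (sub_neg.2 hlt)
        simpa using (Real.tendsto_exp_atBot.comp h1).const_mul (c i)
  rw [Finset.sum_ite_eq' Finset.univ i₀, if_pos (Finset.mem_univ _)] at hlim
  refine ge_of_tendsto' hlim fun s => ?_
  have h1 : ∑ i, c i * Real.exp (s * (m i - m i₀))
      = (∑ i, c i * Real.exp (s * m i)) * Real.exp (-(s * m i₀)) := by
    rw [Finset.sum_mul]
    refine Finset.sum_congr rfl fun i _ => ?_
    rw [mul_assoc, ← Real.exp_add]
    congr 2; ring
  rw [h1]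
  exact mul_nonneg (h s) (Real.exp_pos _).le

lemma PolyCircuit.coeff_eq_zero (r : PolyCircuit 𝒮) {f : MvPolynomial (Fin n) ℝ}
    (hf : f ∈ r.nonneg) {e : ↥𝒮} (heA : e ∉ r.1.1) (heβ : e ≠ r.1.2) : f.coeff e = 0 := by
  by_contra hne
  rcases hf.1 e (MvPolynomial.mem_support_iff.2 hne) with ⟨a, ha, hae⟩ | h
  · rw [Subtype.ext hae] at ha; exact heA ha
  · exact heβ (Subtype.ext h)

lemma PolyCircuit.support_subset (r : PolyCircuit 𝒮) {f : MvPolynomial (Fin n) ℝ}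
    (hf : f ∈ r.nonneg) : f.support ⊆ 𝒮 := by
  intro e he
  rcases hf.1 e he with ⟨a, -, rfl⟩ | h
  · exact a.2
  · rw [h]; exact r.1.2.2

/-- The outer exponents of a circuit are vertices of its convex hull, so that the outer
coefficients of a non-negative circuit polynomial are non-negative. -/
lemma PolyCircuit.coeff_nonneg (r : PolyCircuit 𝒮) {f : MvPolynomial (Fin n) ℝ}
    (hf : f ∈ r.nonneg) {e : ↥𝒮} (heβ : e ≠ r.1.2) : 0 ≤ f.coeff e := by
  classical
  by_cases heA : e ∉ r.1.1
  · exact (r.coeff_eq_zero hf heA heβ).ge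
  rw [not_not] at heA
  let p : ↥𝒮 → Fin n → ℝ := fun e => natVec (e : Fin n →₀ ℕ)
  obtain ⟨w, k, hwk⟩ := exists_affine_coords (p := p) r.2.2.1
  have hβ : natVec (r.1.2 : Fin n →₀ ℕ) ∈ convexHull ℝ (p '' r.1.1) :=
    intrinsicInterior_subset r.2.2.2
  obtain ⟨l, hl0, hlA, hl1, hlβ⟩ := (mem_convexHull_image_finset (natVec_finsupp_injective 𝒮)).1 hβ
  have hmA : ∀ e' ∈ r.1.1, w e ⬝ᵥ p e' + k e = if e' = e then 1 else 0 := by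
    intro e' he'
    have := hwk (fun a => if a = e' then 1 else 0) (by simp [he']) e heA
    simp only [ite_smul, one_smul, zero_smul, Finset.sum_ite_eq', he', if_true] at this
    rw [this]
    simp [eq_comm]
  have hmβ : w e ⬝ᵥ p r.1.2 + k e = l e := by
    have := hwk l hl1 e heA
    change w e ⬝ᵥ (∑ a ∈ r.1.1, l a • natVec ((a : Fin n →₀ ℕ) : Fin n → ℕ)) + k e = l e at this
    rw [hlβ] at this
    exact this
  have hlt : l e < 1 := by
    have hsum := Finset.add_sum_erase r.1.1 l heA
    rw [hl1] at hsum
    have hrest : 0 ≤ ∑ a ∈ r.1.1.erase e, l a := Finset.sum_nonneg fun a _ => hl0 a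
    refine lt_of_le_of_ne (by linarith) fun h1 => heβ ?_
    have hz : ∑ a ∈ r.1.1.erase e, l a = 0 := by linarith
    rw [Finset.sum_eq_zero_iff_of_nonneg fun a _ => hl0 a] at hz
    rw [← Finset.add_sum_erase _ _ heA, h1, one_smul,
      Finset.sum_eq_zero fun a ha => by rw [hz a ha, zero_smul], add_zero] at hlβ
    exact natVec_finsupp_injective 𝒮 hlβ
  refine coeff_nonneg_of_dominant (fun e' : ↥𝒮 => f.coeff e') (fun e' => w e ⬝ᵥ p e') e
    (fun e' he' => ?_) fun s => ?_
  · have hee := hmA e heA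
    rw [if_pos rfl] at hee
    by_cases h1 : e' = r.1.2
    · right
      rw [h1]
      linarith
    · by_cases h2 : e' ∈ r.1.1
      · right
        have := hmA e' h2
        rw [if_neg he'] at this
        linarith
      · exact Or.inl (r.coeff_eq_zero hf h2 h1)
  · have := hf.2 fun j => Real.exp ((s • w e) j)
    rw [← polyOf_coeff (r.support_subset hf), eval_polyOf] at this
    refine this.trans_eq (Finset.sum_congr rfl fun e' _ => ?_)
    have h3 := prod_exp_rpow (p e') (s • w e)
    simp only [p, natVec, Real.rpow_natCast] at h3
    rw [h3, dotProduct_comm, smul_dotProduct, smul_eq_mul]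

lemma PolyCircuit.add_mem (r : PolyCircuit 𝒮) {f g : MvPolynomial (Fin n) ℝ} (hf : f ∈ r.nonneg)
    (hg : g ∈ r.nonneg) : f + g ∈ r.nonneg := by
  classical
  refine ⟨fun e he => ?_, fun x => ?_⟩
  · rcases Finset.mem_union.1 (MvPolynomial.support_add he) with h | h
    · exact hf.1 e h
    · exact hg.1 e h
  · rw [map_add]; exact add_nonneg (hf.2 x) (hg.2 x)

lemma PolyCircuit.zero_mem (r : PolyCircuit 𝒮) : 0 ∈ r.nonneg := ⟨by simp, by simp⟩

lemma mem_soncCone_iff {f : MvPolynomial (Fin n) ℝ} :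
    f ∈ soncCone 𝒮 ↔ ∃ g : PolyCircuit 𝒮 → MvPolynomial (Fin n) ℝ,
      (∀ r, g r ∈ r.nonneg) ∧ ∑ r, g r = f := by
  rw [soncCone, Set.mem_fintype_sum]
  simp only [exists_prop]

lemma soncCone_add {f g : MvPolynomial (Fin n) ℝ} (hf : f ∈ soncCone 𝒮) (hg : g ∈ soncCone 𝒮) :
    f + g ∈ soncCone 𝒮 := by
  rw [mem_soncCone_iff] at *
  obtain ⟨F, hF, rfl⟩ := hf
  obtain ⟨G, hG, rfl⟩ := hg
  exact ⟨F + G, fun r => r.add_mem (hF r) (hG r), Finset.sum_add_distrib⟩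

lemma soncCone_zero : (0 : MvPolynomial (Fin n) ℝ) ∈ soncCone 𝒮 :=
  mem_soncCone_iff.2 ⟨0, fun r => r.zero_mem, by simp⟩

lemma PolyCircuit.mem_soncCone (r : PolyCircuit 𝒮) {f : MvPolynomial (Fin n) ℝ}
    (hf : f ∈ r.nonneg) : f ∈ soncCone 𝒮 := by
  classical
  refine mem_soncCone_iff.2 ⟨Pi.single r f, fun q => ?_, ?_⟩
  · by_cases h : q = r
    · subst h; rwa [Pi.single_eq_same]
    · rw [Pi.single_eq_of_ne h]; exact q.zero_mem
  · rw [Finset.sum_pi_single', if_pos (Finset.mem_univ _)]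

/-- The coefficient vectors `c` with `polyOf c` a SONC polynomial. -/
def soncCoeff (𝒮 : Finset (Fin n →₀ ℕ)) : AddSubmonoid (↥𝒮 → ℝ) where
  carrier := {c | polyOf c ∈ soncCone 𝒮}
  add_mem' h h' := by
    rw [Set.mem_ofPred_eq, polyOf_add]; exact soncCone_add h h'
  zero_mem' := by
    rw [Set.mem_ofPred_eq, polyOf_zero]; exact soncCone_zero

lemma PolyCircuit.mem_sConeCoeff (r : PolyCircuit 𝒮) {f : MvPolynomial (Fin n) ℝ}
    (hf : f ∈ r.nonneg) :
    (fun e : ↥𝒮 => f.coeff e) ∘ (soncIndex 𝒮).symm ∈ sConeCoeff (evenExps 𝒮) (oddExps 𝒮) := by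
  have hA : ∀ b : ↥(oddExps 𝒮), (soncIndex 𝒮).symm (Sum.inr b) ∉ r.1.1 := fun b hb =>
    not_even_symm_inr b (r.2.1 _ hb)
  refine Submodule.subset_span ⟨?_, fun x => ?_⟩
  · rcases hβ : soncIndex 𝒮 r.1.2 with a₀ | b₀
    · left
      have key : ∀ a : ↥(evenExps 𝒮), f.coeff ((soncIndex 𝒮).symm (Sum.inl a) : ↥𝒮) < 0 →
          a = a₀ := fun a ha => by
        by_contra hne
        refine absurd (r.coeff_nonneg hf (e := (soncIndex 𝒮).symm (Sum.inl a)) fun h => hne ?_)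
          (not_le.2 ha)
        rw [Equiv.symm_apply_eq, hβ] at h
        exact Sum.inl_injective h
      refine ⟨fun a a' ha ha' => (key a ha).trans (key a' ha').symm, fun b => ?_⟩
      refine r.coeff_eq_zero hf (hA b) fun h => ?_
      rw [Equiv.symm_apply_eq, hβ] at h
      simp at h
    · right
      have key : ∀ b : ↥(oddExps 𝒮), f.coeff ((soncIndex 𝒮).symm (Sum.inr b) : ↥𝒮) ≠ 0 →
          b = b₀ := fun b hb => by
        by_contra hne
        refine hb (r.coeff_eq_zero hf (hA b) fun h => hne ?_)
        rw [Equiv.symm_apply_eq, hβ] at h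
        exact Sum.inr_injective h
      refine ⟨fun a => r.coeff_nonneg hf fun h => ?_,
        fun b b' hb hb' => (key b hb).trans (key b' hb').symm⟩
      rw [Equiv.symm_apply_eq, hβ] at h
      simp at h
  · rw [sFun_comp_symm, polyOf_coeff (r.support_subset hf), ← WithTop.coe_zero, WithTop.coe_le_coe]
    exact hf.2 x

/-- A reduced circuit of the even and odd parts is a circuit of the support set. -/
lemma RedCircuit.mem_soncCoeff (r : RedCircuit (evenExps 𝒮) (oddExps 𝒮))
    {c : Coeff (evenExps 𝒮) (oddExps 𝒮)} (hc : r.Supports c) (hb : r.IsBounded c) :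
    c ∘ soncIndex 𝒮 ∈ soncCoeff 𝒮 := by
  classical
  let ψ : ↥(evenExps 𝒮) → ↥𝒮 := fun a => (soncIndex 𝒮).symm (Sum.inl a)
  have hψv : ∀ a, natVec ((ψ a : ↥𝒮) : Fin n →₀ ℕ) = (a : Fin n → ℝ) := fun a =>
    natVec_symm (Sum.inl a)
  have hmem : ∀ e : ↥(r.outer.image ψ), ∃ a : ↥r.outer, ψ a = e := fun e => by
    obtain ⟨a, ha, h⟩ := Finset.mem_image.1 e.2
    exact ⟨⟨a, ha⟩, h⟩
  choose g hg using hmem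
  have hginj : Function.Injective g := fun a b h => Subtype.ext (by rw [← hg a, ← hg b, h])
  have hcirc : IsPolyCircuit (r.outer.image ψ, (soncIndex 𝒮).symm r.inner) := by
    refine ⟨fun e he j => ?_, ?_, ?_⟩
    · obtain ⟨a, -, rfl⟩ := Finset.mem_image.1 he
      exact even_symm_inl a j
    · have h := r.2.1.comp_embedding ⟨g, hginj⟩
      have heq : (fun a : ↥r.outer => ((a : ↥(evenExps 𝒮)) : Fin n → ℝ)) ∘
          (⟨g, hginj⟩ : ↥(r.outer.image ψ) ↪ ↥r.outer)
          = fun e : ↥(r.outer.image ψ) => natVec ((e : ↥𝒮) : Fin n →₀ ℕ) := by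
        funext e
        change ((g e : ↥(evenExps 𝒮)) : Fin n → ℝ) = _
        rw [← hψv, hg]
      exact heq ▸ h
    · have hset : {y | ∃ e ∈ r.outer.image ψ, natVec ((e : ↥𝒮) : Fin n →₀ ℕ) = y}
          = pts r.outer := by
        ext y
        simp only [Set.mem_ofPred_eq, Finset.mem_image, pts]
        constructor
        · rintro ⟨_, ⟨a, ha, rfl⟩, rfl⟩
          exact ⟨a, ha, (hψv a).symm⟩
        · rintro ⟨a, ha, rfl⟩
          exact ⟨_, ⟨a, ha, rfl⟩, hψv a⟩
      simp only [hset, natVec_symm]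
      exact r.2.2.1
  refine PolyCircuit.mem_soncCone ⟨_, hcirc⟩ ⟨fun e he => ?_, fun x => ?_⟩
  · obtain ⟨e, rfl, hne⟩ := exists_ne_zero_of_mem_support_polyOf he
    by_contra! hcon
    refine hne (hc _ (fun a ha h => ?_) fun h => ?_)
    · exact hcon.1 (ψ a) (Finset.mem_image_of_mem _ ha) (by
        simp only [ψ, ← h, Equiv.symm_apply_apply])
    · exact hcon.2 (by simp only [← h, Equiv.symm_apply_apply])
  · have h := hb.sFun_nonneg hc x
    have hcc : c = (c ∘ soncIndex 𝒮) ∘ (soncIndex 𝒮).symm := by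
      funext t; simp
    rw [hcc, sFun_comp_symm, ← WithTop.coe_zero, WithTop.coe_le_coe] at h
    exact h

/-- The singleton circuit of an even exponent accounts for the non-negative vector on `𝒜`. -/
lemma single_mem_soncCoeff {t : ℝ} (ht : 0 ≤ t) (e : ↥𝒮) (he : ∀ j, Even ((e : Fin n →₀ ℕ) j)) :
    (fun e' => if e' = e then t else 0) ∈ soncCoeff 𝒮 := by
  classical
  have hcirc : IsPolyCircuit (({e} : Finset ↥𝒮), e) := by
    refine ⟨fun a ha => ?_, ?_, ?_⟩
    · rw [Finset.mem_singleton.1 ha]; exact he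
    · have : Subsingleton ↥({e} : Finset ↥𝒮) :=
        ⟨fun a b => Subtype.ext ((Finset.mem_singleton.1 a.2).trans (Finset.mem_singleton.1 b.2).symm)⟩
      exact affineIndependent_of_subsingleton ℝ _
    · have hset : {y | ∃ a ∈ ({e} : Finset ↥𝒮), natVec ((a : ↥𝒮) : Fin n →₀ ℕ) = y}
          = {natVec (e : Fin n →₀ ℕ)} := by
        ext y; simp [eq_comm]
      simp only [hset, convexHull_singleton, intrinsicInterior_singleton, Set.mem_singleton_iff]
  refine PolyCircuit.mem_soncCone ⟨_, hcirc⟩ ⟨fun e' he' => ?_, fun x => ?_⟩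
  · obtain ⟨e', rfl, hne⟩ := exists_ne_zero_of_mem_support_polyOf he'
    right
    by_contra hcon
    exact hne (if_neg fun h => hcon (congrArg _ h))
  · rw [eval_polyOf]
    refine Finset.sum_nonneg fun e' _ => ?_
    split_ifs with h
    · subst h
      exact mul_nonneg ht (Finset.prod_nonneg fun j _ => (he j).pow_nonneg _)
    · rw [zero_mul]

/-- SONC polynomials are the elements of the `𝒮`-cone of the even and odd exponents. -/
theorem mem_soncCoeff_iff (c : ↥𝒮 → ℝ) :
    c ∈ soncCoeff 𝒮 ↔ c ∘ (soncIndex 𝒮).symm ∈ sConeCoeff (evenExps 𝒮) (oddExps 𝒮) := by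
  classical
  constructor
  · intro h
    obtain ⟨g, hg, hsum⟩ := mem_soncCone_iff.1 h
    have hc : c ∘ (soncIndex 𝒮).symm
        = ∑ r, (fun e : ↥𝒮 => (g r).coeff e) ∘ (soncIndex 𝒮).symm := by
      funext t
      rw [Finset.sum_apply, Function.comp_apply, ← coeff_polyOf c, ← hsum, MvPolynomial.coeff_sum]
      rfl
    rw [hc]
    exact sum_mem fun r _ => r.mem_sConeCoeff (hg r)
  · intro h
    choose σ hσ using fun r : RedCircuit (evenExps 𝒮) (oddExps 𝒮) =>
      r.exists_isArrangement (isRationalSet_evenExps 𝒮)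
    rw [mem_sConeCoeff_iff_hasLift (not_even_of_mem_oddExps 𝒮) (natVec_notMem_evenExps 𝒮)
      (isRationalSet_evenExps 𝒮) hσ, hasLift_iff (isRationalSet_evenExps 𝒮) hσ] at h
    obtain ⟨C, d, hcd, hd, hC⟩ := h
    have hc : c = ∑ r, C r ∘ soncIndex 𝒮 + ∑ a, fun e' =>
        if e' = (soncIndex 𝒮).symm (Sum.inl a) then d a else 0 := by
      funext e
      have h1 := congrFun hcd (soncIndex 𝒮 e)
      rw [Function.comp_apply, Equiv.symm_apply_apply] at h1
      rw [h1]
      simp only [Pi.add_apply, Finset.sum_apply, Function.comp_apply, Equiv.eq_symm_apply]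
      congr 1
      rcases soncIndex 𝒮 e with a | b <;> simp
    rw [hc]
    exact add_mem (sum_mem fun r _ => r.mem_soncCoeff (hC r).1 (hC r).2)
      (sum_mem fun a _ => single_mem_soncCoeff (hd a) _ (even_symm_inl a))

end Sonc

end SCone

end

open SCone in
theorem mainTheorem1 {n : ℕ} (𝒜 : Finset (Fin n → ℝ)) (ℬ : Finset (Fin n → ℕ))
    (hne : 𝒜.Nonempty)
    (hodd : ∀ b ∈ ℬ, ∃ j, ¬ Even (b j))
    (hdisj : ∀ b ∈ ℬ, SCone.natVec b ∉ 𝒜)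
    (hrat : SCone.IsRationalSet 𝒜) :
    -- every reduced circuit has an order of appearance of the entries in the bottom blocks
    (∀ r : SCone.RedCircuit 𝒜 ℬ, ∃ s, r.IsArrangement s) ∧
    -- and for any choice of these orders
    (∀ σ : SCone.RedCircuit 𝒜 ℬ → ℕ → Option ↥𝒜,
      (∀ r : SCone.RedCircuit 𝒜 ℬ, r.IsArrangement (σ r)) →
      -- the explicit second-order description holds,
      (∀ c : SCone.Coeff 𝒜 ℬ, SCone.sFun c ∈ SCone.sCone 𝒜 ℬ ↔
        ∃ (C : SCone.RedCircuit 𝒜 ℬ → SCone.Coeff 𝒜 ℬ) (d : ↥𝒜 → ℝ) (x : SCone.AllVars 𝒜 ℬ),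
          c = (∑ r, C r) + Sum.elim d 0 ∧ (∀ a, 0 ≤ d a) ∧
          ∀ r : SCone.RedCircuit 𝒜 ℬ, r.Supports (C r) ∧ r.Conditions (σ r) (C r) (x r)) ∧
      -- and the cone is the projection of the lifted cone
      Prod.fst '' SCone.liftedCone σ = {c | SCone.sFun c ∈ SCone.sCone 𝒜 ℬ}) ∧
    SCone.IsSecondOrderRepresentable
      {c : SCone.Coeff 𝒜 ℬ | SCone.sFun c ∈ SCone.sCone 𝒜 ℬ} ∧
    ∀ 𝒮 : Finset (Fin n →₀ ℕ), SCone.IsSecondOrderRepresentable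
      {c : ↥𝒮 → ℝ | SCone.polyOf c ∈ SCone.soncCone 𝒮} := by
  have hmem : ∀ σ : RedCircuit 𝒜 ℬ → ℕ → Option ↥𝒜,
      (∀ r : RedCircuit 𝒜 ℬ, r.IsArrangement (σ r)) → ∀ c : Coeff 𝒜 ℬ,
      sFun c ∈ sCone 𝒜 ℬ ↔ HasLift σ c := fun σ hσ c =>
    (mem_sCone_iff hdisj c).trans (mem_sConeCoeff_iff_hasLift hodd hdisj hrat hσ c)
  refine ⟨fun r => r.exists_isArrangement hrat, fun σ hσ => ⟨hmem σ hσ, ?_⟩, ?_, fun 𝒮 => ?_⟩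
  · rw [image_fst_liftedCone]
    ext c
    exact (hmem σ hσ c).symm
  · choose σ hσ using fun r : RedCircuit 𝒜 ℬ => r.exists_isArrangement hrat
    convert isSecondOrderRepresentable_of_hasLift σ LinearMap.id using 1
    ext c
    rw [LinearMap.id_coe, Set.image_id]
    exact hmem σ hσ c
  · choose σ hσ using fun r : RedCircuit (evenExps 𝒮) (oddExps 𝒮) =>
      r.exists_isArrangement (isRationalSet_evenExps 𝒮)
    convert isSecondOrderRepresentable_of_hasLift σ (LinearMap.funLeft ℝ ℝ (soncIndex 𝒮)) using 1
    have h := fun c => mem_sConeCoeff_iff_hasLift (not_even_of_mem_oddExps 𝒮)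
      (natVec_notMem_evenExps 𝒮) (isRationalSet_evenExps 𝒮) hσ c
    ext c
    constructor
    · intro hc
      refine ⟨c ∘ (soncIndex 𝒮).symm, (h _).1 ((mem_soncCoeff_iff c).1 hc), ?_⟩
      funext e
      simp [LinearMap.funLeft_apply]
    · rintro ⟨c', hc', rfl⟩
      refine (mem_soncCoeff_iff _).2 ((h _).2 ?_)
      have hcc : LinearMap.funLeft ℝ ℝ (soncIndex 𝒮) c' ∘ (soncIndex 𝒮).symm = c' := by
        funext t
        simp [LinearMap.funLeft_apply]
      rw [hcc]
      exact hc'
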